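/- Let $\alpha,\beta>-1$, let $\tau(\lambda)=k(1-\lambda)^{\alpha}(1+\lambda)^{\beta}$ on $(-1,1)$ with $k>0$ chosen so that $\int_{-1}^{1}\tau\,d\lambda=1$, and let $G_0,G_1,\dots$ be the polynomials obtained by Gram–Schmidt orthonormalization of $1,\lambda,\lambda^2,\dots$ in $L^2((-1,1);\tau\,d\lambda)$, with positive leading coefficients (the orthonormal Jacobi polynomials). Let $J=J_{\alpha,\beta}$ be the corresponding Jacobi operator in $\ell^2(\mathbb Z_+)$, $$(Jf)_n=a_{n-1}f_{n-1}+b_nf_n+a_nf_{n+1},\quad a_{-1}=0,\qquad a_n=\int_{-1}^1\lambda G_nG_{n+1}\tau\,d\lambda,\quad b_n=\int_{-1}^1\lambda G_n^2\tau\,d\lambda ,$$ and define $\Phi:\ell^2(\mathbb Z_+)\to L^2(-1,1)$ by $(\Phi f)(\lambda)=\sum_{n\ge 0}\sqrt{\tau(\lambda)}\,G_n(\lambda)f_n$ (series convergent in $L^2(-1,1)$). Put $\gamma=(\alpha+\beta+1)/2$ and $\psi(\xi)=\xi\arccos\xi-\sqrt{1-\xi^2}$. For $g\in C_0^\infty((-1,1)\setminus\{0\})$,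 $t\neq0$, $s=\operatorname{sgn}t\in\{1,-1\}$, $n\in\mathbb Z_+$ and $\xi=n/|t|$, set $$(U(t)g)_n=i^{-sn}e^{is(\alpha-\beta)\pi/4}|t|^{-1/2}\bigl(e^{i\psi(\xi)t}h_{+}(\xi)+e^{-i\psi(\xi)t}h_{-}(\xi)\bigr)\quad\text{if }0<\xi<1,$$ $$h_{\pm}(\xi)=e^{\pm is\pi/4}e^{\pm is\gamma\arccos\xi}\,\xi^{1/2}(1-\xi^2)^{-1/4}g\bigl(\pm\sqrt{1-\xi^2}\bigr),$$ and $(U(t)g)_n=0$ if $n=0$ or $n\ge|t|$. If $f\in\ell^2(\mathbb Z_+)$ and $g=\Phi f\in C_0^\infty((-1,1)\setminus\{0\})$, then $$\lim_{t\to\pm\infty}\bigl\|e^{-iJt}f-U(t)\Phi f\bigr\|_{\ell^2(\mathbb Z_+)}=0 .$$ -/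

import Mathlib

open MeasureTheory Set Filter Topology
open scoped ENNReal lp ContDiff Polynomial

noncomputable section

/-- The unnormalised Jacobi weight `(1 - x)^α (1 + x)^β`, to be used for `x ∈ (-1, 1)`. -/
def jacobiWeight (α β x : ℝ) : ℝ := (1 - x) ^ α * (1 + x) ^ β

/-- The constant `k = k_{α,β}` that makes `τ(x) dx` a probability measure on `(-1, 1)`. -/
def jacobiConst (α β : ℝ) : ℝ := (∫ x in Ioo (-1 : ℝ) 1, jacobiWeight α β x)⁻¹

/-- The normalised density `τ(x) = k (1 - x)^α (1 + x)^β` of the spectral measure. -/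
def jacobiDensity (α β x : ℝ) : ℝ := jacobiConst α β * jacobiWeight α β x

/-- The scalar product of two real polynomials in `L²((-1, 1); τ(x) dx)`. -/
def jacobiPairing (α β : ℝ) (p q : ℝ[X]) : ℝ :=
  ∫ x in Ioo (-1 : ℝ) 1, p.eval x * q.eval x * jacobiDensity α β x

/-- Gram-Schmidt orthogonalisation (before normalisation) of `1, x, x², …` in
`L²((-1, 1); τ(x) dx)`; these are the monic orthogonal polynomials. -/
def jacobiMonic (α β : ℝ) : ℕ → ℝ[X]
  | n => Polynomial.X ^ n - ∑ j : Fin n,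
      Polynomial.C (jacobiPairing α β (Polynomial.X ^ n) (jacobiMonic α β j) /
        jacobiPairing α β (jacobiMonic α β j) (jacobiMonic α β j)) * jacobiMonic α β j
  termination_by n => n
  decreasing_by exact j.2

/-- The orthonormal Jacobi polynomial `G_n`, with positive leading coefficient. -/
def jacobiPoly (α β : ℝ) (n : ℕ) : ℝ[X] :=
  Polynomial.C (√(jacobiPairing α β (jacobiMonic α β n) (jacobiMonic α β n)))⁻¹ *
    jacobiMonic α β n

/-- The off-diagonal recurrence coefficient `a_n = ⟨x G_n, G_{n+1}⟩`. -/
def jacobiA (α β : ℝ) (n : ℕ) : ℝ :=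
  jacobiPairing α β (Polynomial.X * jacobiPoly α β n) (jacobiPoly α β (n + 1))

/-- The diagonal recurrence coefficient `b_n = ⟨x G_n, G_n⟩`. -/
def jacobiB (α β : ℝ) (n : ℕ) : ℝ :=
  jacobiPairing α β (Polynomial.X * jacobiPoly α β n) (jacobiPoly α β n)

/-- The function `φ_n(x) = √τ(x) G_n(x)` on `(-1, 1)`. -/
def jacobiPhi (α β : ℝ) (n : ℕ) (x : ℝ) : ℂ :=
  ((√(jacobiDensity α β x) * (jacobiPoly α β n).eval x : ℝ) : ℂ)

/-! ### Elementary facts that make the operators well defined -/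

theorem jacobiWeight_pos (α β : ℝ) {x : ℝ} (hx : x ∈ Ioo (-1 : ℝ) 1) :
    0 < jacobiWeight α β x :=
  mul_pos (Real.rpow_pos_of_pos (by linarith [hx.2]) _)
    (Real.rpow_pos_of_pos (by linarith [hx.1]) _)

theorem jacobiConst_nonneg (α β : ℝ) : 0 ≤ jacobiConst α β :=
  inv_nonneg.2 (setIntegral_nonneg measurableSet_Ioo fun _ hx => (jacobiWeight_pos α β hx).le)

theorem jacobiDensity_nonneg (α β : ℝ) {x : ℝ} (hx : x ∈ Ioo (-1 : ℝ) 1) :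
    0 ≤ jacobiDensity α β x :=
  mul_nonneg (jacobiConst_nonneg α β) (jacobiWeight_pos α β hx).le

theorem measurable_jacobiDensity (α β : ℝ) : Measurable (jacobiDensity α β) := by
  unfold jacobiDensity jacobiWeight
  fun_prop

theorem integrableOn_jacobiDensity (α β : ℝ) :
    IntegrableOn (jacobiDensity α β) (Ioo (-1 : ℝ) 1) := by
  by_cases h : IntegrableOn (jacobiWeight α β) (Ioo (-1 : ℝ) 1)
  · exact h.const_mul _
  · have h0 : jacobiConst α β = 0 := by
      unfold jacobiConst
      rw [integral_undef h, inv_zero]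
    have : jacobiDensity α β = fun _ => 0 := by
      funext x
      simp [jacobiDensity, h0]
    rw [this]
    exact integrableOn_zero

theorem integrableOn_eval_mul_jacobiDensity (α β : ℝ) (p : ℝ[X]) :
    IntegrableOn (fun x => p.eval x * jacobiDensity α β x) (Ioo (-1 : ℝ) 1) := by
  obtain ⟨C, hC⟩ := (isCompact_Icc (a := (-1 : ℝ)) (b := 1)).exists_bound_of_continuousOn
    (p.continuous.continuousOn)
  refine (integrableOn_jacobiDensity α β).bdd_mul (c := C) p.continuous.aestronglyMeasurable ?_
  filter_upwards [ae_restrict_mem measurableSet_Ioo] with x hx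
  exact hC x (Ioo_subset_Icc_self hx)

theorem integrableOn_jacobiPairing (α β : ℝ) (p q : ℝ[X]) :
    IntegrableOn (fun x => p.eval x * q.eval x * jacobiDensity α β x) (Ioo (-1 : ℝ) 1) := by
  simpa using integrableOn_eval_mul_jacobiDensity α β (p * q)

theorem jacobiPairing_self_nonneg (α β : ℝ) (p : ℝ[X]) : 0 ≤ jacobiPairing α β p p :=
  setIntegral_nonneg measurableSet_Ioo fun _ hx =>
    mul_nonneg (mul_self_nonneg _) (jacobiDensity_nonneg α β hx)

theorem jacobiPairing_C_mul (α β c : ℝ) (p q : ℝ[X]) :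
    jacobiPairing α β (Polynomial.C c * p) q = c * jacobiPairing α β p q := by
  unfold jacobiPairing
  rw [← integral_const_mul]
  simp only [Polynomial.eval_mul, Polynomial.eval_C, mul_assoc]

theorem jacobiPairing_comm (α β : ℝ) (p q : ℝ[X]) :
    jacobiPairing α β p q = jacobiPairing α β q p := by
  unfold jacobiPairing
  simp only [mul_comm (p.eval _)]

theorem jacobiPairing_poly_self_le (α β : ℝ) (n : ℕ) :
    jacobiPairing α β (jacobiPoly α β n) (jacobiPoly α β n) ≤ 1 := by
  have h0 := jacobiPairing_self_nonneg α β (jacobiMonic α β n)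
  unfold jacobiPoly
  rw [jacobiPairing_C_mul, jacobiPairing_comm α β (jacobiMonic α β n)
    (Polynomial.C _ * _), jacobiPairing_C_mul,
    ← mul_assoc, ← mul_inv, Real.mul_self_sqrt h0]
  exact inv_mul_le_one

theorem abs_jacobiPairing_X_mul_le (α β : ℝ) (m n : ℕ) :
    |jacobiPairing α β (Polynomial.X * jacobiPoly α β m) (jacobiPoly α β n)| ≤ 1 := by
  have hm := jacobiPairing_poly_self_le α β m
  have hn := jacobiPairing_poly_self_le α β n
  set p := jacobiPoly α β m
  set q := jacobiPoly α β n
  have hp := integrableOn_jacobiPairing α β p p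
  have hq := integrableOn_jacobiPairing α β q q
  have h1 : |jacobiPairing α β (Polynomial.X * p) q| ≤
      ∫ x in Ioo (-1 : ℝ) 1, (1 / 2 : ℝ) * (p.eval x * p.eval x * jacobiDensity α β x +
        q.eval x * q.eval x * jacobiDensity α β x) := by
    refine norm_integral_le_of_norm_le (f := fun x => (Polynomial.X * p).eval x * q.eval x *
      jacobiDensity α β x) ((hp.add hq).const_mul _) ?_
    filter_upwards [ae_restrict_mem measurableSet_Ioo] with x hx
    have hd := jacobiDensity_nonneg α β hx
    have hx1 : |x| ≤ 1 := abs_le.2 ⟨hx.1.le, hx.2.le⟩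
    have h2 : |x * p.eval x * q.eval x| ≤ (1 / 2 : ℝ) * (p.eval x * p.eval x +
        q.eval x * q.eval x) := by
      have h3 : |x * p.eval x * q.eval x| ≤ |p.eval x| * |q.eval x| := by
        rw [mul_assoc, abs_mul, abs_mul]
        exact mul_le_of_le_one_left (by positivity) hx1
      nlinarith [sq_nonneg (|p.eval x| - |q.eval x|), abs_mul_abs_self (p.eval x),
        abs_mul_abs_self (q.eval x)]
    simp only [Polynomial.eval_mul, Polynomial.eval_X, Real.norm_eq_abs, abs_mul _
      (jacobiDensity α β x), abs_of_nonneg hd]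
    have h4 := mul_le_mul_of_nonneg_right h2 hd
    simp only [Pi.add_apply]
    linarith
  rw [integral_const_mul, integral_add hp hq] at h1
  change _ ≤ (1 / 2 : ℝ) * (jacobiPairing α β p p + jacobiPairing α β q q) at h1
  linarith

theorem memLp_jacobiPhi (α β : ℝ) (n : ℕ) :
    MemLp (jacobiPhi α β n) 2 (volume.restrict (Ioo (-1 : ℝ) 1)) := by
  have hm : AEStronglyMeasurable (jacobiPhi α β n) (volume.restrict (Ioo (-1 : ℝ) 1)) := by
    refine Measurable.aestronglyMeasurable ?_
    unfold jacobiPhi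
    have := measurable_jacobiDensity α β
    have := (jacobiPoly α β n).continuous.measurable
    fun_prop
  rw [memLp_two_iff_integrable_sq_norm hm]
  refine (integrableOn_jacobiPairing α β (jacobiPoly α β n) (jacobiPoly α β n)).congr ?_
  filter_upwards [ae_restrict_mem measurableSet_Ioo] with x hx
  have hd := jacobiDensity_nonneg α β hx
  rw [jacobiPhi, Complex.norm_real, Real.norm_eq_abs, sq_abs, mul_pow, Real.sq_sqrt hd]
  ring

/-- The action of a Jacobi matrix:
`(J f)_n = a_{n-1} f_{n-1} + b_n f_n + a_n f_{n+1}` with `a_{-1} = 0`. -/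
def jacobiAction (a b : ℕ → ℝ) (f : ℕ → ℂ) : ℕ → ℂ
  | 0 => b 0 * f 0 + a 0 * f 1
  | n + 1 => a n * f n + b (n + 1) * f (n + 1) + a (n + 1) * f (n + 2)

theorem norm_sq_add_three_le (x y z : ℂ) :
    ‖x + y + z‖ ^ 2 ≤ 3 * (‖x‖ ^ 2 + ‖y‖ ^ 2 + ‖z‖ ^ 2) := by
  have h := norm_add₃_le (a := x) (b := y) (c := z)
  have h' : ‖x + y + z‖ ^ 2 ≤ (‖x‖ + ‖y‖ + ‖z‖) ^ 2 := by gcongr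
  nlinarith [sq_nonneg (‖x‖ - ‖y‖), sq_nonneg (‖x‖ - ‖z‖), sq_nonneg (‖y‖ - ‖z‖)]

theorem norm_sq_ofReal_mul_le {c : ℝ} (hc : |c| ≤ 1) (z : ℂ) : ‖(c : ℂ) * z‖ ^ 2 ≤ ‖z‖ ^ 2 := by
  rw [norm_mul, Complex.norm_real, Real.norm_eq_abs]
  gcongr
  exact mul_le_of_le_one_left (norm_nonneg _) hc

theorem summable_norm_sq (f : ℓ²(ℕ, ℂ)) : Summable fun n => ‖f n‖ ^ 2 := by
  simpa using (lp.memℓp f).summable (by norm_num)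

theorem norm_sq_eq_tsum (f : ℓ²(ℕ, ℂ)) : ‖f‖ ^ 2 = ∑' n, ‖f n‖ ^ 2 := by
  simpa using lp.norm_rpow_eq_tsum (p := 2) (by norm_num) f

theorem sum_jacobiAction_le {a b : ℕ → ℝ} (ha : ∀ n, |a n| ≤ 1) (hb : ∀ n, |b n| ≤ 1)
    (f : ℓ²(ℕ, ℂ)) (N : ℕ) :
    ∑ n ∈ Finset.range N, ‖jacobiAction a b f n‖ ^ 2 ≤ (3 * ‖f‖) ^ 2 := by
  have hs := summable_norm_sq f
  have key : ∀ n, ‖jacobiAction a b f n‖ ^ 2 ≤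
      3 * ((if n = 0 then 0 else ‖f (n - 1)‖ ^ 2) + ‖f n‖ ^ 2 + ‖f (n + 1)‖ ^ 2) := by
    intro n
    cases n with
    | zero =>
      have h := norm_sq_add_three_le 0 (b 0 * f 0) (a 0 * f 1)
      have h1 := norm_sq_ofReal_mul_le (hb 0) (f 0)
      have h2 := norm_sq_ofReal_mul_le (ha 0) (f 1)
      simp only [zero_add, norm_zero] at h
      simp only [jacobiAction, if_true, zero_add]
      nlinarith
    | succ n =>
      have h := norm_sq_add_three_le (a n * f n) (b (n + 1) * f (n + 1)) (a (n + 1) * f (n + 2))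
      have h1 := norm_sq_ofReal_mul_le (hb (n + 1)) (f (n + 1))
      have h2 := norm_sq_ofReal_mul_le (ha (n + 1)) (f (n + 2))
      have h3 := norm_sq_ofReal_mul_le (ha n) (f n)
      simp only [jacobiAction, Nat.add_eq_zero_iff, one_ne_zero, and_false, if_false,
        Nat.add_sub_cancel]
      have h4 : f (n + 1 + 1) = f (n + 2) := rfl
      rw [h4]
      linarith
  have hle : ∀ M, ∑ n ∈ Finset.range M, ‖f n‖ ^ 2 ≤ ‖f‖ ^ 2 := fun M => by
    rw [norm_sq_eq_tsum]
    exact hs.sum_le_tsum _ fun _ _ => by positivity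
  have h1 : ∑ n ∈ Finset.range N, (if n = 0 then (0 : ℝ) else ‖f (n - 1)‖ ^ 2) ≤ ‖f‖ ^ 2 := by
    cases N with
    | zero => simp
    | succ N =>
      rw [Finset.sum_range_succ']
      simpa using hle N
  have h3 : ∑ n ∈ Finset.range N, ‖f (n + 1)‖ ^ 2 ≤ ‖f‖ ^ 2 := by
    have := hle (N + 1)
    rw [Finset.sum_range_succ'] at this
    nlinarith [sq_nonneg ‖f 0‖]
  calc ∑ n ∈ Finset.range N, ‖jacobiAction a b f n‖ ^ 2
      ≤ ∑ n ∈ Finset.range N, 3 * ((if n = 0 then 0 else ‖f (n - 1)‖ ^ 2) + ‖f n‖ ^ 2 +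
          ‖f (n + 1)‖ ^ 2) := Finset.sum_le_sum fun n _ => key n
    _ ≤ (3 * ‖f‖) ^ 2 := by
      rw [← Finset.mul_sum, Finset.sum_add_distrib, Finset.sum_add_distrib]
      nlinarith [hle N]

theorem memℓp_jacobiAction {a b : ℕ → ℝ} (ha : ∀ n, |a n| ≤ 1) (hb : ∀ n, |b n| ≤ 1)
    (f : ℓ²(ℕ, ℂ)) : Memℓp (jacobiAction a b f) 2 := by
  refine memℓp_gen ?_
  simpa using summable_of_sum_range_le (fun _ => by positivity) (sum_jacobiAction_le ha hb f)

/-- The operator in `ℓ²` given by a Jacobi matrix with bounded coefficients. -/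
def jacobiMatrixOperator (a b : ℕ → ℝ) (ha : ∀ n, |a n| ≤ 1) (hb : ∀ n, |b n| ≤ 1) :
    ℓ²(ℕ, ℂ) →L[ℂ] ℓ²(ℕ, ℂ) :=
  LinearMap.mkContinuous
    { toFun := fun f => ⟨jacobiAction a b f, memℓp_jacobiAction ha hb f⟩
      map_add' := by
        intro f g
        ext n
        change jacobiAction a b (fun k => f k + g k) n =
          jacobiAction a b f n + jacobiAction a b g n
        cases n <;> simp only [jacobiAction] <;> ring
      map_smul' := by
        intro c f
        ext n
        change jacobiAction a b (fun k => c * f k) n = c * jacobiAction a b f n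
        cases n <;> simp only [jacobiAction] <;> ring }
    3 (by
      intro f
      refine le_of_sq_le_sq ?_ (by positivity)
      rw [norm_sq_eq_tsum]
      exact Real.tsum_le_of_sum_range_le (fun _ => by positivity) (sum_jacobiAction_le ha hb f))

/-- The Jacobi operator `J = J_{α,β}` with spectral measure `τ(x) dx`. -/
def jacobiOperator (α β : ℝ) : ℓ²(ℕ, ℂ) →L[ℂ] ℓ²(ℕ, ℂ) :=
  jacobiMatrixOperator (jacobiA α β) (jacobiB α β)
    (fun n => abs_jacobiPairing_X_mul_le α β n (n + 1))
    (fun n => abs_jacobiPairing_X_mul_le α β n n)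

/-- The evolution `e^{-iJt}`. -/
def jacobiEvolution (α β t : ℝ) : ℓ²(ℕ, ℂ) →L[ℂ] ℓ²(ℕ, ℂ) :=
  NormedSpace.exp ((-(Complex.I * (t : ℂ))) • jacobiOperator α β)

/-- The mapping `Φ f = ∑ f_n φ_n`, with the series taken in `L²(-1, 1)`. -/
def jacobiTransform (α β : ℝ) (f : ℓ²(ℕ, ℂ)) : Lp ℂ 2 (volume.restrict (Ioo (-1 : ℝ) 1)) :=
  ∑' n, f n • (memLp_jacobiPhi α β n).toLp (jacobiPhi α β n)

/-- The phase `ψ(ξ) = ξ arccos ξ - √(1 - ξ²)`. -/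
def jacobiPhase (ξ : ℝ) : ℝ := ξ * Real.arccos ξ - √(1 - ξ ^ 2)

/-- The amplitude contributed by the stationary point `e √(1 - ξ²)`, `e = ±1`, for times of
sign `s`; here `γ = (α + β + 1) / 2`. -/
def jacobiAmplitude (α β : ℝ) (g : ℝ → ℂ) (s e : ℤ) (ξ : ℝ) : ℂ :=
  Complex.exp (s * e * Complex.I * (Real.pi / 4 : ℝ)) *
    Complex.exp (s * e * Complex.I * ((α + β + 1) / 2 * Real.arccos ξ : ℝ)) *
    (ξ ^ (1 / 2 : ℝ) * (1 - ξ ^ 2) ^ (-1 / 4 : ℝ) : ℝ) * g (e * √(1 - ξ ^ 2))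

/-- The sequence `(U(t) g)_n`, with `ξ = n / |t|` and `s` the sign of `t`; it is zero unless
`0 < ξ < 1`. -/
def jacobiModelSeq (α β : ℝ) (g : ℝ → ℂ) (t : ℝ) (n : ℕ) : ℂ :=
  let s : ℤ := SignType.sign t
  let ξ : ℝ := n / |t|
  if 0 < ξ ∧ ξ < 1 then
    Complex.I ^ (-s * (n : ℤ)) * Complex.exp (s * Complex.I * ((α - β) * Real.pi / 4 : ℝ)) *
      (|t| ^ (-1 / 2 : ℝ) : ℝ) *
      (Complex.exp (Complex.I * (jacobiPhase ξ * t : ℝ)) * jacobiAmplitude α β g s 1 ξ +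
        Complex.exp (-(Complex.I * (jacobiPhase ξ * t : ℝ))) * jacobiAmplitude α β g s (-1) ξ)
  else 0

theorem memℓp_jacobiModelSeq (α β : ℝ) (g : ℝ → ℂ) (t : ℝ) :
    Memℓp (jacobiModelSeq α β g t) 2 := by
  refine memℓp_gen (summable_of_ne_finset_zero (s := Finset.range (⌈|t|⌉₊)) fun n hn => ?_)
  have h : ¬ (0 < (n : ℝ) / |t| ∧ (n : ℝ) / |t| < 1) := by
    rintro ⟨h0, h1⟩
    have ht : 0 < |t| := by
      rcases (abs_nonneg t).eq_or_lt with h | h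
      · rw [← h, div_zero] at h0
        exact absurd h0 (lt_irrefl _)
      · exact h
    rw [div_lt_one ht] at h1
    exact hn (Finset.mem_range.2 (Nat.lt_ceil.2 h1))
  simp [jacobiModelSeq, h]

/-- `U(t) g` as an element of `ℓ²` (it has finitely many non-zero components). -/
def jacobiModel (α β : ℝ) (g : ℝ → ℂ) (t : ℝ) : ℓ²(ℕ, ℂ) :=
  ⟨jacobiModelSeq α β g t, memℓp_jacobiModelSeq α β g t⟩

/-! ### The functions `φ_n` are orthonormal, so the series for `Φ f` converges in `L²` -/

theorem integrableOn_jacobiWeight {α β : ℝ} (hα : -1 < α) (hβ : -1 < β) :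
    IntegrableOn (jacobiWeight α β) (Ioo (-1 : ℝ) 1) := by
  have key : ∀ {a b : ℝ}, -1 < a → IntegrableOn (fun x => x ^ a * (2 - x) ^ b) (Ioo (0 : ℝ) 1) := by
    intro a b ha
    have h1 : IntegrableOn (fun x : ℝ => x ^ a) (Icc 0 1) :=
      (integrableOn_Icc_iff_integrableOn_Ioc).2
        ((intervalIntegrable_iff_integrableOn_Ioc_of_le zero_le_one).1
          (intervalIntegral.intervalIntegrable_rpow' ha))
    have h2 : ContinuousOn (fun x : ℝ => (2 - x) ^ b) (Icc 0 1) := by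
      refine ContinuousOn.rpow_const (by fun_prop) fun x hx => Or.inl ?_
      linarith [hx.2]
    exact (h1.mul_continuousOn h2 isCompact_Icc).mono_set Ioo_subset_Icc_self
  have hr : IntegrableOn (jacobiWeight α β) (Ioo (0 : ℝ) 1) := by
    have h := (key (a := α) (b := β) hα)
    have h' := (intervalIntegrable_iff_integrableOn_Ioo_of_le zero_le_one).2 h
    have h'' := h'.comp_sub_left 1
    simp only [sub_zero, sub_self] at h''
    have h3 := (intervalIntegrable_iff_integrableOn_Ioo_of_le zero_le_one).1 h''.symm
    refine h3.congr_fun (fun x _ => ?_) measurableSet_Ioo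
    simp only [jacobiWeight]
    ring_nf
  have hl : IntegrableOn (jacobiWeight α β) (Ioo (-1 : ℝ) 0) := by
    have h := (key (a := β) (b := α) hβ)
    have h' := (intervalIntegrable_iff_integrableOn_Ioo_of_le zero_le_one).2 h
    have h'' := h'.comp_add_right 1
    simp only [zero_sub, sub_self] at h''
    have h3 := (intervalIntegrable_iff_integrableOn_Ioo_of_le (by norm_num)).1 h''
    refine h3.congr_fun (fun x _ => ?_) measurableSet_Ioo
    simp only [jacobiWeight]
    ring_nf
  have := ((integrableOn_Ioc_iff_integrableOn_Ioo (by simp)).2 hl).union hr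
  rwa [Ioc_union_Ioo_eq_Ioo (by norm_num) (by norm_num)] at this

theorem jacobiConst_pos {α β : ℝ} (hα : -1 < α) (hβ : -1 < β) : 0 < jacobiConst α β := by
  refine inv_pos.2 ?_
  rw [setIntegral_pos_iff_support_of_nonneg_ae _ (integrableOn_jacobiWeight hα hβ)]
  · have : Function.support (jacobiWeight α β) ∩ Ioo (-1 : ℝ) 1 = Ioo (-1 : ℝ) 1 :=
      inter_eq_right.2 fun x hx => (jacobiWeight_pos α β hx).ne'
    rw [this]
    simp
  · filter_upwards [ae_restrict_mem measurableSet_Ioo] with x hx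
    exact (jacobiWeight_pos α β hx).le

theorem jacobiPairing_self_pos {α β : ℝ} (hα : -1 < α) (hβ : -1 < β) {p : ℝ[X]} (hp : p ≠ 0) :
    0 < jacobiPairing α β p p := by
  unfold jacobiPairing
  rw [setIntegral_pos_iff_support_of_nonneg_ae _ (integrableOn_jacobiPairing α β p p)]
  · have hsub : Ioo (-1 : ℝ) 1 \ p.rootSet ℝ ⊆ Function.support (fun x => p.eval x * p.eval x *
        jacobiDensity α β x) ∩ Ioo (-1 : ℝ) 1 := by
      rintro x ⟨hx, hr⟩
      refine ⟨?_, hx⟩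
      have h1 : p.eval x ≠ 0 := fun h => hr (by
        rw [Polynomial.mem_rootSet]
        exact ⟨hp, by simpa using h⟩)
      exact mul_ne_zero (mul_ne_zero h1 h1)
        (mul_pos (jacobiConst_pos hα hβ) (jacobiWeight_pos α β hx)).ne'
    refine lt_of_lt_of_le ?_ (measure_mono hsub)
    rw [measure_sdiff_null ((p.rootSet_finite ℝ).measure_zero _)]
    simp
  · filter_upwards [ae_restrict_mem measurableSet_Ioo] with x hx
    exact mul_nonneg (mul_self_nonneg _) (jacobiDensity_nonneg α β hx)

theorem jacobiMonic_monic (α β : ℝ) (n : ℕ) :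
    (jacobiMonic α β n).Monic ∧ (jacobiMonic α β n).degree = n := by
  induction n using Nat.strong_induction_on with
  | _ n ih =>
    have h : (∑ j : Fin n,
      Polynomial.C (jacobiPairing α β (Polynomial.X ^ n) (jacobiMonic α β j) /
        jacobiPairing α β (jacobiMonic α β j) (jacobiMonic α β j)) *
          jacobiMonic α β j).degree < n := by
      refine (Polynomial.degree_sum_le _ _).trans_lt ?_
      refine (Finset.sup_lt_iff (WithBot.bot_lt_coe n)).2 ?_
      intro j _
      rw [← Polynomial.smul_eq_C_mul]
      refine (Polynomial.degree_smul_le _ _).trans_lt ?_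
      rw [(ih j j.2).2]
      exact Nat.cast_lt.2 j.2
    rw [jacobiMonic]
    refine ⟨Polynomial.monic_X_pow_sub h, ?_⟩
    rw [Polynomial.degree_sub_eq_left_of_degree_lt]
    · simp
    · simpa using h

theorem jacobiPairing_sub (α β : ℝ) (p q r : ℝ[X]) :
    jacobiPairing α β (p - q) r = jacobiPairing α β p r - jacobiPairing α β q r := by
  unfold jacobiPairing
  rw [← integral_sub (integrableOn_jacobiPairing α β p r) (integrableOn_jacobiPairing α β q r)]
  simp only [Polynomial.eval_sub, sub_mul]

theorem jacobiPairing_sum (α β : ℝ) {n : ℕ} (p : Fin n → ℝ[X]) (r : ℝ[X]) :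
    jacobiPairing α β (∑ j, p j) r = ∑ j, jacobiPairing α β (p j) r := by
  unfold jacobiPairing
  rw [← integral_finsetSum _ fun j _ => integrableOn_jacobiPairing α β (p j) r]
  simp only [Polynomial.eval_finsetSum, Finset.sum_mul]

theorem jacobiMonic_orthogonal {α β : ℝ} (hα : -1 < α) (hβ : -1 < β) (n : ℕ) :
    ∀ m < n, jacobiPairing α β (jacobiMonic α β n) (jacobiMonic α β m) = 0 := by
  induction n using Nat.strong_induction_on with
  | _ n ih =>
    intro m hm
    rw [jacobiMonic, jacobiPairing_sub, jacobiPairing_sum]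
    simp only [jacobiPairing_C_mul]
    rw [Finset.sum_eq_single (⟨m, hm⟩ : Fin n)]
    · rw [div_mul_cancel₀ _ (jacobiPairing_self_pos hα hβ (jacobiMonic_monic α β m).1.ne_zero).ne',
        sub_self]
    · intro j _ hj
      have hne : (j : ℕ) ≠ m := fun h => hj (Fin.ext h)
      rcases hne.lt_or_gt with h | h
      · rw [jacobiPairing_comm α β (jacobiMonic α β j) (jacobiMonic α β m), ih m hm j h, mul_zero]
      · rw [ih j j.2 m h, mul_zero]
    · simp

theorem jacobiPoly_orthonormal {α β : ℝ} (hα : -1 < α) (hβ : -1 < β) (m n : ℕ) :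
    jacobiPairing α β (jacobiPoly α β m) (jacobiPoly α β n) = if m = n then 1 else 0 := by
  unfold jacobiPoly
  rw [jacobiPairing_C_mul, jacobiPairing_comm α β (jacobiMonic α β m)
    (Polynomial.C _ * _), jacobiPairing_C_mul]
  split_ifs with h
  · subst h
    have h0 := jacobiPairing_self_pos hα hβ (jacobiMonic_monic α β m).1.ne_zero
    rw [← mul_assoc, ← mul_inv, Real.mul_self_sqrt h0.le, inv_mul_cancel₀ h0.ne']
  · rcases Ne.lt_or_gt h with h | h
    · rw [jacobiMonic_orthogonal hα hβ n m h, mul_zero, mul_zero]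
    · rw [jacobiPairing_comm α β (jacobiMonic α β n) (jacobiMonic α β m),
        jacobiMonic_orthogonal hα hβ m n h, mul_zero, mul_zero]

theorem orthonormal_jacobiPhi {α β : ℝ} (hα : -1 < α) (hβ : -1 < β) :
    Orthonormal ℂ fun n => (memLp_jacobiPhi α β n).toLp (jacobiPhi α β n) := by
  rw [orthonormal_iff_ite]
  intro m n
  rw [L2.inner_def]
  have h1 : ∫ x in Ioo (-1 : ℝ) 1, inner ℂ ((memLp_jacobiPhi α β m).toLp (jacobiPhi α β m) x)
      ((memLp_jacobiPhi α β n).toLp (jacobiPhi α β n) x) =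
      ∫ x in Ioo (-1 : ℝ) 1, (((jacobiPoly α β m).eval x * (jacobiPoly α β n).eval x *
        jacobiDensity α β x : ℝ) : ℂ) := by
    refine integral_congr_ae ?_
    filter_upwards [(memLp_jacobiPhi α β m).coeFn_toLp, (memLp_jacobiPhi α β n).coeFn_toLp,
      ae_restrict_mem measurableSet_Ioo] with x hm hn hx
    rw [hm, hn, jacobiPhi, jacobiPhi, RCLike.inner_apply, Complex.conj_ofReal,
      ← Complex.ofReal_mul]
    congr 1
    have := Real.mul_self_sqrt (jacobiDensity_nonneg α β hx)
    linear_combination ((jacobiPoly α β m).eval x * (jacobiPoly α β n).eval x) * this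
  rw [h1, integral_complex_ofReal]
  change ((jacobiPairing α β (jacobiPoly α β m) (jacobiPoly α β n) : ℝ) : ℂ) = _
  rw [jacobiPoly_orthonormal hα hβ]
  split_ifs <;> simp

theorem hasSum_jacobiTransform {α β : ℝ} (hα : -1 < α) (hβ : -1 < β) (f : ℓ²(ℕ, ℂ)) :
    HasSum (fun n => f n • (memLp_jacobiPhi α β n).toLp (jacobiPhi α β n))
      (jacobiTransform α β f) := by
  refine Summable.hasSum ?_
  have h := (orthonormal_jacobiPhi hα hβ).orthogonalFamily.summable_of_lp f
  simpa using h

end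

/-! In the spectral representation `J` is multiplication by `x`, so the coordinates of `e^{-iJt} f`
are the integrals `∫ e^{-ixt} φ_n(x) g(x) dx` (`jacobiEvolution_apply`). The proof puts the
large-`n` asymptotics of `φ_n` into them, applies stationary phase with an error bound uniform in
`t`, and passes to the limit in `ℓ²` by dominated convergence.

The asymptotics are, with `x = cos θ` in a compact part of `(-1, 1)`, `φ_n = √(2/π) (sin θ)^{-1/2}
cos((n + γ)θ - (2α + 1)π/4) + O(1/(n + 1))` (`jacobi_asymptotics`). They come from a Jost function.
Comparing coefficients in the Jacobi differential equation and in the recurrence gives `a_n - 1/2 =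
O(n⁻²)` and `b_n = O(n⁻²)`. For `H_n(z) = z^n G_n((z + z⁻¹)/2)` the differences `D_n = H_{n+1} - z²
H_n` therefore converge at rate `1/(n + 1)` on the closed unit disc, uniformly away from `±1`.
Inside the disc `H_n → D/(1 - z²)`; after division by `n` the differential equation degenerates to
one of first order, whose solution is `D = c (1 - z)^{1/2-α} (1 + z)^{1/2-β}`
(`exists_jostFun_jacobi_eq`). Its boundary values give modulus and phase of `G_n(cos θ)`. The
unknown constant is found from `⟨(1 - x²) G_n, G_n⟩ → 1/2` (`jacobi_amplitude_eq`).

With `x = cos θ` the cosine splits into exponentials. On `[0, π/2]` the phase `-t cos θ - nθ` is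
convex and is stationary where `sin θ = n/t`; the phase `-t cos θ + nθ` has no stationary point. A
window of width of order `t^{-2/5}` gives the error `O((1 + n)^{-3/5})` for all `t ≥ 1`
(`exists_stationary_bound`). The half `[π/2, π]` is the complex conjugate of a half of the first
kind, by `θ ↦ π - θ`, and yields `h_-`. The stationary terms add up exactly to `U(t)g`
(`jacobiModelSeq_of_pos`).

Since `2 · 3/5 > 1`, the squared error has a summable majorant independent of `t`. Each single
coordinate of the wave and of the model tends to zero, so the `ℓ²` error does too. Negative times
follow by complex conjugation. -/

/-! ### Orthogonality and the three-term recurrence -/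

theorem jacobiPairing_sub_right (α β : ℝ) (p q r : ℝ[X]) :
    jacobiPairing α β p (q - r) = jacobiPairing α β p q - jacobiPairing α β p r := by
  rw [jacobiPairing_comm, jacobiPairing_sub, jacobiPairing_comm α β q, jacobiPairing_comm α β r]

theorem jacobiPairing_C_mul_right (α β c : ℝ) (p q : ℝ[X]) :
    jacobiPairing α β p (Polynomial.C c * q) = c * jacobiPairing α β p q := by
  rw [jacobiPairing_comm, jacobiPairing_C_mul, jacobiPairing_comm]

theorem jacobiPairing_mul_X_left (α β : ℝ) (p q : ℝ[X]) :
    jacobiPairing α β (Polynomial.X * p) q = jacobiPairing α β p (Polynomial.X * q) := by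
  unfold jacobiPairing
  refine integral_congr_ae (Eventually.of_forall fun x => ?_)
  simp only [Polynomial.eval_mul, Polynomial.eval_X]
  ring

theorem jacobiPairing_zero_right (α β : ℝ) (p : ℝ[X]) : jacobiPairing α β p 0 = 0 := by
  simp [jacobiPairing]

theorem jacobiMonic_coeff_self (α β : ℝ) (n : ℕ) : (jacobiMonic α β n).coeff n = 1 := by
  have h := jacobiMonic_monic α β n
  have h2 : (jacobiMonic α β n).natDegree = n := Polynomial.natDegree_eq_of_degree_eq_some h.2
  have h1 := h.1.coeff_natDegree
  rwa [h2] at h1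

theorem jacobiMonic_coeff_of_lt (α β : ℝ) {n k : ℕ} (h : n < k) :
    (jacobiMonic α β n).coeff k = 0 :=
  Polynomial.coeff_eq_zero_of_degree_lt (by
    rw [(jacobiMonic_monic α β n).2]
    exact_mod_cast h)

theorem degree_sub_C_mul_jacobiMonic_lt (α β : ℝ) {m : ℕ} {p : ℝ[X]}
    (hp : p.degree < (m + 1 : ℕ)) :
    (p - Polynomial.C (p.coeff m) * jacobiMonic α β m).degree < m := by
  rw [Polynomial.degree_lt_iff_coeff_zero]
  intro k hk
  rw [Polynomial.coeff_sub, Polynomial.coeff_C_mul]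
  rcases hk.eq_or_lt with h | h
  · rw [← h, jacobiMonic_coeff_self]
    ring
  · rw [jacobiMonic_coeff_of_lt α β h, (Polynomial.degree_lt_iff_coeff_zero _ _).1 hp k h]
    ring

/-- Induction on `m`: removing the top coefficient of `p` times the monic polynomial of that degree
lowers the degree. -/
theorem jacobiPairing_eq_zero_of_orthogonal {α β : ℝ} {r : ℝ[X]} {m : ℕ}
    (hr : ∀ j < m, jacobiPairing α β r (jacobiMonic α β j) = 0) :
    ∀ p : ℝ[X], p.degree < m → jacobiPairing α β r p = 0 := by
  induction m with
  | zero =>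
    intro p hp
    have : p = 0 := by
      rw [← Polynomial.degree_eq_bot]
      simpa using hp
    rw [this, jacobiPairing_zero_right]
  | succ m ih =>
    intro p hp
    have h := ih (fun j hj => hr j (by omega)) _ (degree_sub_C_mul_jacobiMonic_lt α β hp)
    rw [jacobiPairing_sub_right, jacobiPairing_C_mul_right, hr m (by omega)] at h
    linarith

theorem jacobiPairing_jacobiMonic_of_degree_lt {α β : ℝ} (hα : -1 < α) (hβ : -1 < β) {n : ℕ}
    {p : ℝ[X]} (hp : p.degree < n) : jacobiPairing α β (jacobiMonic α β n) p = 0 :=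
  jacobiPairing_eq_zero_of_orthogonal (fun j hj => jacobiMonic_orthogonal hα hβ n j hj) p hp

/-- Polynomial identities below are proved this way: the difference of the two sides has low degree
and is orthogonal to everything of that degree, in particular to itself. -/
theorem eq_zero_of_orthogonal {α β : ℝ} (hα : -1 < α) (hβ : -1 < β) {r : ℝ[X]} {m : ℕ}
    (hd : r.degree < m) (hr : ∀ j < m, jacobiPairing α β r (jacobiMonic α β j) = 0) : r = 0 := by
  by_contra h
  exact (jacobiPairing_self_pos hα hβ h).ne' (jacobiPairing_eq_zero_of_orthogonal hr r hd)

/-- The leading coefficient of the orthonormal polynomial `G_n`. -/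
noncomputable def jacobiLeading (α β : ℝ) (n : ℕ) : ℝ :=
  (√(jacobiPairing α β (jacobiMonic α β n) (jacobiMonic α β n)))⁻¹

theorem jacobiPoly_eq (α β : ℝ) (n : ℕ) :
    jacobiPoly α β n = Polynomial.C (jacobiLeading α β n) * jacobiMonic α β n := rfl

theorem jacobiLeading_pos {α β : ℝ} (hα : -1 < α) (hβ : -1 < β) (n : ℕ) :
    0 < jacobiLeading α β n :=
  inv_pos.2 (Real.sqrt_pos.2 (jacobiPairing_self_pos hα hβ (jacobiMonic_monic α β n).1.ne_zero))

theorem jacobiPairing_monic_eq_div {α β : ℝ} (hα : -1 < α) (hβ : -1 < β) (p : ℝ[X]) (n : ℕ) :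
    jacobiPairing α β p (jacobiMonic α β n) =
      jacobiPairing α β p (jacobiPoly α β n) / jacobiLeading α β n := by
  rw [jacobiPoly_eq, jacobiPairing_C_mul_right]
  field_simp [(jacobiLeading_pos hα hβ n).ne']

theorem degree_jacobiPoly_le (α β : ℝ) (n : ℕ) : (jacobiPoly α β n).degree ≤ n := by
  rw [jacobiPoly_eq, ← Polynomial.smul_eq_C_mul]
  exact (Polynomial.degree_smul_le _ _).trans (jacobiMonic_monic α β n).2.le

theorem jacobiPairing_jacobiPoly_of_degree_lt {α β : ℝ} (hα : -1 < α) (hβ : -1 < β) {n : ℕ}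
    {p : ℝ[X]} (hp : p.degree < n) : jacobiPairing α β (jacobiPoly α β n) p = 0 := by
  rw [jacobiPoly_eq, jacobiPairing_C_mul, jacobiPairing_jacobiMonic_of_degree_lt hα hβ hp, mul_zero]

theorem degree_X_mul_jacobiPoly_lt (α β : ℝ) {n m : ℕ} (h : n + 1 < m) :
    (Polynomial.X * jacobiPoly α β n).degree < (m : WithBot ℕ) := by
  rw [Polynomial.degree_lt_iff_coeff_zero]
  intro k hk
  obtain ⟨k, rfl⟩ : ∃ j, k = j + 1 := ⟨k - 1, by omega⟩
  rw [Polynomial.coeff_X_mul]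
  refine Polynomial.coeff_eq_zero_of_degree_lt ((degree_jacobiPoly_le α β n).trans_lt ?_)
  exact_mod_cast (by omega : n < k)

theorem jacobiPoly_recurrence_zero {α β : ℝ} (hα : -1 < α) (hβ : -1 < β) :
    Polynomial.X * jacobiPoly α β 0 =
      Polynomial.C (jacobiB α β 0) * jacobiPoly α β 0 +
      Polynomial.C (jacobiA α β 0) * jacobiPoly α β 1 := by
  have key := eq_zero_of_orthogonal hα hβ (r := Polynomial.X * jacobiPoly α β 0 -
      Polynomial.C (jacobiB α β 0) * jacobiPoly α β 0 -
      Polynomial.C (jacobiA α β 0) * jacobiPoly α β 1) (m := 2) ?_ ?_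
  · linear_combination key
  · refine (Polynomial.degree_sub_le _ _).trans_lt (max_lt ((Polynomial.degree_sub_le _ _).trans_lt
      (max_lt (degree_X_mul_jacobiPoly_lt α β (by omega)) ?_)) ?_)
    all_goals
      rw [← Polynomial.smul_eq_C_mul]
      refine (Polynomial.degree_smul_le _ _).trans_lt ((degree_jacobiPoly_le α β _).trans_lt ?_)
      norm_num
  · intro j hj
    rw [jacobiPairing_monic_eq_div hα hβ, div_eq_zero_iff]
    left
    rw [jacobiPairing_sub, jacobiPairing_sub, jacobiPairing_C_mul, jacobiPairing_C_mul,
      jacobiPoly_orthonormal hα hβ, jacobiPoly_orthonormal hα hβ]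
    interval_cases j
    · simp [jacobiB]
    · simp [jacobiA]

theorem jacobiPoly_recurrence {α β : ℝ} (hα : -1 < α) (hβ : -1 < β) (n : ℕ) :
    Polynomial.X * jacobiPoly α β (n + 1) =
      Polynomial.C (jacobiA α β n) * jacobiPoly α β n +
      Polynomial.C (jacobiB α β (n + 1)) * jacobiPoly α β (n + 1) +
      Polynomial.C (jacobiA α β (n + 1)) * jacobiPoly α β (n + 2) := by
  have key := eq_zero_of_orthogonal hα hβ (r := Polynomial.X * jacobiPoly α β (n + 1) -
      Polynomial.C (jacobiA α β n) * jacobiPoly α β n -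
      Polynomial.C (jacobiB α β (n + 1)) * jacobiPoly α β (n + 1) -
      Polynomial.C (jacobiA α β (n + 1)) * jacobiPoly α β (n + 2)) (m := n + 3) ?_ ?_
  · linear_combination key
  · refine (Polynomial.degree_sub_le _ _).trans_lt (max_lt ((Polynomial.degree_sub_le _ _).trans_lt
      (max_lt ((Polynomial.degree_sub_le _ _).trans_lt
      (max_lt (degree_X_mul_jacobiPoly_lt α β (by omega)) ?_)) ?_)) ?_)
    all_goals
      rw [← Polynomial.smul_eq_C_mul]
      refine (Polynomial.degree_smul_le _ _).trans_lt ((degree_jacobiPoly_le α β _).trans_lt ?_)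
      exact_mod_cast (by omega)
  · intro j hj
    rw [jacobiPairing_monic_eq_div hα hβ, div_eq_zero_iff]
    left
    rw [jacobiPairing_sub, jacobiPairing_sub, jacobiPairing_sub, jacobiPairing_C_mul,
      jacobiPairing_C_mul, jacobiPairing_C_mul,
      jacobiPoly_orthonormal hα hβ, jacobiPoly_orthonormal hα hβ, jacobiPoly_orthonormal hα hβ]
    have hcase : j < n ∨ j = n ∨ j = n + 1 ∨ j = n + 2 := by omega
    rcases hcase with h | rfl | rfl | rfl
    -- Multiplication by `X` is symmetric; moved onto `G_j` with `j < n`, it gives degree below `n +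
    -- 1`.
    · rw [jacobiPairing_mul_X_left, jacobiPairing_jacobiPoly_of_degree_lt hα hβ
        (degree_X_mul_jacobiPoly_lt α β (by omega))]
      rw [if_neg (by omega), if_neg (by omega), if_neg (by omega)]
      ring
    · rw [jacobiPairing_mul_X_left, jacobiPairing_comm]
      simp [jacobiA]
    · simp [jacobiB]
    · simp [jacobiA]

/-! ### The differential equation -/

/-- The Jacobi differential operator `(1 - x²) p'' + (β - α - (α + β + 2) x) p'`. -/
noncomputable def jacobiDiff (α β : ℝ) (p : ℝ[X]) : ℝ[X] :=
  (1 - Polynomial.X ^ 2) * p.derivative.derivative +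
    (Polynomial.C (β - α) - Polynomial.C (α + β + 2) * Polynomial.X) * p.derivative

/-- The operator is triangular on coefficients with diagonal entries `-k (k + α + β + 1)`. Degree
preservation, the eigenvalues and the subleading coefficients are all read off here. -/
theorem coeff_jacobiDiff (α β : ℝ) (p : ℝ[X]) (k : ℕ) :
    (jacobiDiff α β p).coeff k = p.coeff (k + 2) * ((k + 2) * (k + 1)) +
      (β - α) * (p.coeff (k + 1) * (k + 1)) - k * (k + α + β + 1) * p.coeff k := by
  have e1 : jacobiDiff α β p = p.derivative.derivative
      - Polynomial.X ^ 2 * p.derivative.derivative + Polynomial.C (β - α) * p.derivative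
      - Polynomial.C (α + β + 2) * (Polynomial.X * p.derivative) := by
    unfold jacobiDiff; ring
  rw [e1]
  simp only [Polynomial.coeff_add, Polynomial.coeff_sub, Polynomial.coeff_C_mul]
  rcases k with _ | _ | k
  · simp only [Polynomial.coeff_derivative, Polynomial.mul_coeff_zero, Polynomial.coeff_X_zero]
    norm_num
  · have h2 := Polynomial.coeff_X_mul p.derivative 0
    rw [zero_add] at h2 ⊢
    rw [Polynomial.coeff_X_pow_mul', if_neg (by omega), h2]
    simp only [Polynomial.coeff_derivative]
    push_cast
    ring
  · rw [show k + 1 + 1 = k + 2 from rfl, Polynomial.coeff_X_pow_mul', if_pos (by omega),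
      Polynomial.coeff_X_mul]
    simp only [Polynomial.coeff_derivative, Nat.add_sub_cancel]
    push_cast
    ring

theorem hasDerivAt_jacobiWeight_succ (α β : ℝ) {x : ℝ} (hx : x ∈ Ioo (-1 : ℝ) 1) :
    HasDerivAt (jacobiWeight (α + 1) (β + 1))
      (jacobiWeight α β x * (β - α - (α + β + 2) * x)) x := by
  have h1 : 0 < 1 - x := by linarith [hx.2]
  have h2 : 0 < 1 + x := by linarith [hx.1]
  have d1 : HasDerivAt (fun y : ℝ => (1 - y) ^ (α + 1)) (-1 * (α + 1) * (1 - x) ^ (α + 1 - 1)) x :=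
    ((hasDerivAt_id x).const_sub 1).rpow_const (Or.inl h1.ne')
  have d2 : HasDerivAt (fun y : ℝ => (1 + y) ^ (β + 1)) (1 * (β + 1) * (1 + x) ^ (β + 1 - 1)) x :=
    ((hasDerivAt_id x).const_add 1).rpow_const (Or.inl h2.ne')
  refine (d1.mul d2).congr_deriv ?_
  unfold jacobiWeight
  rw [Real.rpow_add_one h1.ne', Real.rpow_add_one h2.ne']
  simp only [add_sub_cancel_right]
  ring

theorem jacobiWeight_succ (α β : ℝ) {x : ℝ} (hx : x ∈ Ioo (-1 : ℝ) 1) :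
    jacobiWeight (α + 1) (β + 1) x = (1 - x ^ 2) * jacobiWeight α β x := by
  have h1 : 0 < 1 - x := by linarith [hx.2]
  have h2 : 0 < 1 + x := by linarith [hx.1]
  unfold jacobiWeight
  rw [Real.rpow_add_one h1.ne', Real.rpow_add_one h2.ne']
  ring

/-- Lagrange's identity: the difference of the integrands is the derivative of `F`, which contains
the weight with exponents `α + 1` and `β + 1`. Both are positive, so `F` is continuous up to `±1`
and vanishes there. -/
theorem jacobiPairing_jacobiDiff_comm {α β : ℝ} (hα : -1 < α) (hβ : -1 < β) (p q : ℝ[X]) :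
    jacobiPairing α β (jacobiDiff α β p) q = jacobiPairing α β p (jacobiDiff α β q) := by
  set k := jacobiConst α β with hk
  set F : ℝ → ℝ := fun x => k * (jacobiWeight (α + 1) (β + 1) x *
    (p.derivative.eval x * q.eval x - p.eval x * q.derivative.eval x)) with hF
  have hcont : ContinuousOn F (Icc (-1) 1) := by
    have hw : Continuous (jacobiWeight (α + 1) (β + 1)) := by
      unfold jacobiWeight
      exact ((continuous_const.sub continuous_id).rpow_const fun _ => Or.inr (by linarith)).mul
        ((continuous_const.add continuous_id).rpow_const fun _ => Or.inr (by linarith))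
    exact (continuous_const.mul (hw.mul ((p.derivative.continuous.mul q.continuous).sub
      (p.continuous.mul q.derivative.continuous)))).continuousOn
  have hderiv : ∀ x ∈ Ioo (-1 : ℝ) 1, HasDerivAt F
      ((jacobiDiff α β p).eval x * q.eval x * jacobiDensity α β x -
        p.eval x * (jacobiDiff α β q).eval x * jacobiDensity α β x) x := by
    intro x hx
    have hd := ((hasDerivAt_jacobiWeight_succ α β hx).mul
      (((p.derivative.hasDerivAt x).mul (q.hasDerivAt x)).sub
        ((p.hasDerivAt x).mul (q.derivative.hasDerivAt x)))).const_mul k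
    refine hd.congr_deriv ?_
    simp only [Pi.mul_apply, Pi.sub_apply]
    rw [jacobiWeight_succ α β hx]
    simp only [jacobiDiff, jacobiDensity, Polynomial.eval_add, Polynomial.eval_mul,
      Polynomial.eval_sub, Polynomial.eval_one, Polynomial.eval_pow, Polynomial.eval_X,
      Polynomial.eval_C, ← hk]
    ring
  have i1 := integrableOn_jacobiPairing α β (jacobiDiff α β p) q
  have i2 := integrableOn_jacobiPairing α β p (jacobiDiff α β q)
  have hint := (intervalIntegrable_iff_integrableOn_Ioo_of_le (by norm_num : (-1 : ℝ) ≤ 1)).2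
    (i1.sub i2)
  have h := intervalIntegral.integral_eq_sub_of_hasDerivAt_of_le (by norm_num) hcont hderiv hint
  rw [intervalIntegral.integral_of_le (by norm_num), integral_Ioc_eq_integral_Ioo,
    integral_sub i1 i2] at h
  have h1 : F 1 = 0 := by
    simp [hF, jacobiWeight, Real.zero_rpow (by linarith : α + 1 ≠ 0)]
  have h2 : F (-1) = 0 := by
    simp [hF, jacobiWeight, Real.zero_rpow (by linarith : β + 1 ≠ 0)]
  unfold jacobiPairing
  linarith

theorem degree_jacobiDiff_lt (α β : ℝ) {p : ℝ[X]} {m : ℕ} (hp : p.degree < m) :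
    (jacobiDiff α β p).degree < m := by
  rw [Polynomial.degree_lt_iff_coeff_zero] at hp ⊢
  intro k hk
  rw [coeff_jacobiDiff, hp _ hk, hp _ (by omega), hp _ (by omega)]
  ring

/-- The eigenvalue cancels the top coefficient, so the difference has degree below `n`; by symmetry
and degree preservation it is orthogonal to all lower monic polynomials, hence zero. -/
theorem jacobiDiff_jacobiMonic {α β : ℝ} (hα : -1 < α) (hβ : -1 < β) (n : ℕ) :
    jacobiDiff α β (jacobiMonic α β n) =
      - (Polynomial.C (n * (n + α + β + 1)) * jacobiMonic α β n) := by
  have key := eq_zero_of_orthogonal hα hβ (r := jacobiDiff α β (jacobiMonic α β n) -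
    Polynomial.C (-(n * (n + α + β + 1))) * jacobiMonic α β n) (m := n) ?_ ?_
  · rw [sub_eq_zero] at key
    rw [key, Polynomial.C_neg, neg_mul]
  · rw [Polynomial.degree_lt_iff_coeff_zero]
    intro k hk
    rw [Polynomial.coeff_sub, coeff_jacobiDiff, Polynomial.coeff_C_mul,
      jacobiMonic_coeff_of_lt α β (by omega : n < k + 2),
      jacobiMonic_coeff_of_lt α β (by omega : n < k + 1)]
    rcases hk.eq_or_lt with rfl | h
    · ring
    · rw [jacobiMonic_coeff_of_lt α β h]
      ring
  · intro j hj
    have hdj : (jacobiMonic α β j).degree < n := by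
      rw [(jacobiMonic_monic α β j).2]
      exact_mod_cast hj
    rw [jacobiPairing_sub, jacobiPairing_C_mul, jacobiPairing_jacobiDiff_comm hα hβ,
      jacobiPairing_jacobiMonic_of_degree_lt hα hβ hdj,
      jacobiPairing_jacobiMonic_of_degree_lt hα hβ (degree_jacobiDiff_lt α β hdj)]
    ring

theorem jacobiDiff_C_mul (α β c : ℝ) (p : ℝ[X]) :
    jacobiDiff α β (Polynomial.C c * p) = Polynomial.C c * jacobiDiff α β p := by
  simp only [jacobiDiff, Polynomial.derivative_C_mul]
  ring

theorem jacobiDiff_jacobiPoly {α β : ℝ} (hα : -1 < α) (hβ : -1 < β) (n : ℕ) :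
    jacobiDiff α β (jacobiPoly α β n) =
      - (Polynomial.C (n * (n + α + β + 1)) * jacobiPoly α β n) := by
  rw [jacobiPoly_eq, jacobiDiff_C_mul, jacobiDiff_jacobiMonic hα hβ]
  ring

/-! ### The recurrence coefficients -/

/-- Comparison of the coefficients of `x^m` in the eigenvalue equation; the next lemma goes one
degree further down. -/
theorem jacobiMonic_coeff_pred {α β : ℝ} (hα : -1 < α) (hβ : -1 < β) (m : ℕ) :
    (jacobiMonic α β (m + 1)).coeff m = (m + 1) * (α - β) / (2 * m + 2 + (α + β)) := by
  have h := congrArg (fun p => Polynomial.coeff p m) (jacobiDiff_jacobiMonic hα hβ (m + 1))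
  simp only [coeff_jacobiDiff, Polynomial.coeff_neg, Polynomial.coeff_C_mul,
    jacobiMonic_coeff_self, jacobiMonic_coeff_of_lt α β (by omega : m + 1 < m + 2)] at h
  have hm : (0 : ℝ) ≤ m := m.cast_nonneg
  rw [eq_div_iff (by linarith)]
  push_cast at h
  linear_combination h

theorem jacobiMonic_coeff_pred_pred {α β : ℝ} (hα : -1 < α) (hβ : -1 < β) (m : ℕ) :
    (jacobiMonic α β (m + 2)).coeff m =
      - ((m + 1) * ((m + 2) - (α - β) * ((m + 2) * (α - β) / (2 * m + 4 + (α + β)))) /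
        (2 * (2 * m + 3 + (α + β)))) := by
  have h := congrArg (fun p => Polynomial.coeff p m) (jacobiDiff_jacobiMonic hα hβ (m + 2))
  have h1 := jacobiMonic_coeff_pred hα hβ (m + 1)
  simp only [coeff_jacobiDiff, Polynomial.coeff_neg, Polynomial.coeff_C_mul,
    jacobiMonic_coeff_self] at h
  rw [show m + 1 + 1 = m + 2 from rfl] at h1
  rw [h1] at h
  have hm : (0 : ℝ) ≤ m := m.cast_nonneg
  have e : (((m + 1 : ℕ) : ℝ) + 1) * (α - β) / (2 * ((m + 1 : ℕ) : ℝ) + 2 + (α + β)) =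
      (m + 2) * (α - β) / (2 * m + 4 + (α + β)) := by
    push_cast
    ring_nf
  rw [e] at h
  rw [← neg_div, eq_div_iff (by linarith)]
  push_cast at h
  linear_combination h

/-- Leading coefficients in the recurrence. Positivity of `a_n` follows from it, and the two next
orders of the same comparison give `jacobiB_eq_sub` and `sq_jacobiA_eq_sub`. -/
theorem jacobiLeading_eq_mul {α β : ℝ} (hα : -1 < α) (hβ : -1 < β) (n : ℕ) :
    jacobiLeading α β n = jacobiA α β n * jacobiLeading α β (n + 1) := by
  cases n with
  | zero =>
    have h := congrArg (fun p => Polynomial.coeff p 1) (jacobiPoly_recurrence_zero hα hβ)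
    simp only [jacobiPoly_eq, Polynomial.coeff_add, Polynomial.coeff_C_mul] at h
    have h2 := Polynomial.coeff_X_mul (Polynomial.C (jacobiLeading α β 0) * jacobiMonic α β 0) 0
    rw [zero_add] at h2
    rw [h2, Polynomial.coeff_C_mul, jacobiMonic_coeff_self, jacobiMonic_coeff_self,
      jacobiMonic_coeff_of_lt α β (by omega : 0 < 1)] at h
    linear_combination h
  | succ n =>
    have h := congrArg (fun p => Polynomial.coeff p (n + 2)) (jacobiPoly_recurrence hα hβ n)
    simp only [jacobiPoly_eq, Polynomial.coeff_add, Polynomial.coeff_C_mul] at h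
    rw [Polynomial.coeff_X_mul, Polynomial.coeff_C_mul, jacobiMonic_coeff_self,
      jacobiMonic_coeff_self, jacobiMonic_coeff_of_lt α β (by omega : n < n + 2),
      jacobiMonic_coeff_of_lt α β (by omega : n + 1 < n + 2)] at h
    linear_combination h

theorem jacobiA_pos {α β : ℝ} (hα : -1 < α) (hβ : -1 < β) (n : ℕ) : 0 < jacobiA α β n := by
  have h := jacobiLeading_eq_mul hα hβ n
  have h1 := jacobiLeading_pos hα hβ n
  rw [h] at h1
  exact pos_of_mul_pos_left h1 (jacobiLeading_pos hα hβ (n + 1)).le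

theorem jacobiB_eq_sub {α β : ℝ} (hα : -1 < α) (hβ : -1 < β) (n : ℕ) :
    jacobiB α β (n + 1) =
      (jacobiMonic α β (n + 1)).coeff n - (jacobiMonic α β (n + 2)).coeff (n + 1) := by
  have h := congrArg (fun p => Polynomial.coeff p (n + 1)) (jacobiPoly_recurrence hα hβ n)
  simp only [jacobiPoly_eq, Polynomial.coeff_add, Polynomial.coeff_C_mul] at h
  rw [Polynomial.coeff_X_mul, Polynomial.coeff_C_mul, jacobiMonic_coeff_self,
    jacobiMonic_coeff_of_lt α β (by omega : n < n + 1)] at h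
  have hk := jacobiLeading_eq_mul hα hβ (n + 1)
  have hp := jacobiLeading_pos hα hβ (n + 1)
  rw [← mul_left_inj' hp.ne']
  rw [show n + 1 + 1 = n + 2 from rfl] at *
  linear_combination -h + (jacobiMonic α β (n + 2)).coeff (n + 1) * hk

theorem sq_jacobiA_eq_sub {α β : ℝ} (hα : -1 < α) (hβ : -1 < β) (n : ℕ) :
    jacobiA α β (n + 1) ^ 2 =
      (jacobiMonic α β (n + 2)).coeff n - (jacobiMonic α β (n + 3)).coeff (n + 1) -
        jacobiB α β (n + 2) * (jacobiMonic α β (n + 2)).coeff (n + 1) := by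
  have h := congrArg (fun p => Polynomial.coeff p (n + 1)) (jacobiPoly_recurrence hα hβ (n + 1))
  simp only [jacobiPoly_eq, Polynomial.coeff_add, Polynomial.coeff_C_mul] at h
  rw [Polynomial.coeff_X_mul, Polynomial.coeff_C_mul, jacobiMonic_coeff_self] at h
  have hk := jacobiLeading_eq_mul hα hβ (n + 2)
  have hk1 := jacobiLeading_eq_mul hα hβ (n + 1)
  have hp := jacobiLeading_pos hα hβ (n + 2)
  rw [← mul_left_inj' hp.ne']
  rw [show n + 1 + 1 = n + 2 from rfl] at *
  rw [show n + 1 + 2 = n + 3 from rfl] at *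
  rw [show n + 2 + 1 = n + 3 from rfl] at *
  linear_combination -h + (jacobiMonic α β (n + 3)).coeff (n + 1) * hk - jacobiA α β (n + 1) * hk1

/-- The indices `0` and `1` are left out; there `exists_jacobi_coeff_bound` uses only that the
coefficients are bounded by `1`. -/
theorem jacobiB_formula {α β : ℝ} (hα : -1 < α) (hβ : -1 < β) (m : ℕ) :
    jacobiB α β (m + 2) = -((α - β) * (α + β)) /
      ((2 * m + 4 + (α + β)) * (2 * m + 6 + (α + β))) := by
  rw [show m + 2 = m + 1 + 1 from rfl, jacobiB_eq_sub hα hβ (m + 1),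
    jacobiMonic_coeff_pred hα hβ (m + 1), show m + 1 + 2 = m + 2 + 1 from rfl,
    show m + 1 + 1 = m + 2 from rfl, jacobiMonic_coeff_pred hα hβ (m + 2)]
  have hm : (0 : ℝ) ≤ m := m.cast_nonneg
  push_cast
  have h1 : 2 * ((m : ℝ) + 1) + 2 + (α + β) ≠ 0 := by linarith
  have h2 : 2 * ((m : ℝ) + 2) + 2 + (α + β) ≠ 0 := by linarith
  have h3 : 2 * (m : ℝ) + 4 + (α + β) ≠ 0 := by linarith
  have h4 : 2 * (m : ℝ) + 6 + (α + β) ≠ 0 := by linarith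
  rw [div_sub_div _ _ h1 h2, div_eq_div_iff (mul_ne_zero h1 h2) (mul_ne_zero h3 h4)]
  ring

/-- In the variable `u` all denominators become `u`, `u ± 1` or `u + 2`, and the last one cancels.
The numerator is quadratic in `u` and the denominator quartic, which is the decay `O(n⁻²)`. -/
theorem sq_jacobiA_formula {α β : ℝ} (hα : -1 < α) (hβ : -1 < β) (m : ℕ) {u : ℝ}
    (hu : u = 2 * m + 4 + (α + β)) :
    jacobiA α β (m + 1) ^ 2 - 1 / 4 =
      (u ^ 2 * (1 - (α + β) ^ 2 - (α - β) ^ 2) + (α + β) ^ 2 * (α - β) ^ 2) /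
        (4 * u ^ 2 * (u ^ 2 - 1)) := by
  have hm : (0 : ℝ) ≤ m := m.cast_nonneg
  have hc := jacobiMonic_coeff_pred hα hβ (m + 1)
  have hd := jacobiMonic_coeff_pred_pred hα hβ m
  have hd1 := jacobiMonic_coeff_pred_pred hα hβ (m + 1)
  rw [sq_jacobiA_eq_sub hα hβ, jacobiB_formula hα hβ]
  rw [show m + 1 + 1 = m + 2 from rfl] at hc
  rw [show m + 1 + 2 = m + 3 from rfl] at hd1
  rw [hc, hd, hd1]
  push_cast
  obtain ⟨n, hn⟩ : ∃ n : ℝ, n = m := ⟨_, rfl⟩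
  rw [← hn] at hu hm ⊢
  have hn2 : n = (u - 4 - (α + β)) / 2 := by linarith
  have e1 : 2 * (n + 1) + 4 + (α + β) = u + 2 := by linarith
  have e2 : 2 * n + 4 + (α + β) = u := by linarith
  have e3 : 2 * n + 3 + (α + β) = u - 1 := by linarith
  have e4 : 2 * (n + 1) + 3 + (α + β) = u + 1 := by linarith
  have e5 : 2 * n + 6 + (α + β) = u + 2 := by linarith
  have e6 : 2 * (n + 1) + 2 + (α + β) = u := by linarith
  rw [e1, e2, e3, e4, e5, e6, hn2]
  have u0 : u ≠ 0 := by linarith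
  have u1 : u - 1 ≠ 0 := by linarith
  have u2 : u + 1 ≠ 0 := by linarith
  have u3 : u + 2 ≠ 0 := by linarith
  have u4 : u ^ 2 - 1 ≠ 0 := by
    have : u ^ 2 - 1 = (u - 1) * (u + 1) := by ring
    rw [this]
    exact mul_ne_zero u1 u2
  field_simp
  ring

theorem exists_jacobi_coeff_bound {α β : ℝ} (hα : -1 < α) (hβ : -1 < β) :
    ∃ C : ℝ, 0 ≤ C ∧ ∀ n : ℕ, |jacobiA α β n - 1 / 2| ≤ C / (n + 1) ^ 2 ∧
      |jacobiB α β n| ≤ C / (n + 1) ^ 2 := by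
  set K := |1 - (α + β) ^ 2 - (α - β) ^ 2| + (α + β) ^ 2 * (α - β) ^ 2 with hK
  set K' := |(α - β) * (α + β)| with hK'
  have hK0 : 0 ≤ K := by positivity
  have hK'0 : 0 ≤ K' := by positivity
  have hAb : ∀ n, |jacobiA α β n| ≤ 1 := fun n => abs_jacobiPairing_X_mul_le α β n (n + 1)
  have hBb : ∀ n, |jacobiB α β n| ≤ 1 := fun n => abs_jacobiPairing_X_mul_le α β n n
  -- `K` serves `a_n`, `2 K'` serves `b_n`, and `8` absorbs the few small indices for which only the
  -- bound by `1` is used.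
  refine ⟨K + 2 * K' + 8, by positivity, fun n => ⟨?_, ?_⟩⟩
  · rcases n with _ | m
    · have h1 := (abs_sub (jacobiA α β 0) (1 / 2)).trans (add_le_add_left (hAb 0) _)
      norm_num at h1 ⊢
      linarith
    · have hm : (0 : ℝ) ≤ m := m.cast_nonneg
      obtain ⟨u, hu⟩ : ∃ u : ℝ, u = 2 * m + 4 + (α + β) := ⟨_, rfl⟩
      have h := sq_jacobiA_formula hα hβ m hu
      have hpos := jacobiA_pos hα hβ (m + 1)
      have hu2 : 2 * (m : ℝ) + 2 ≤ u := by linarith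
      have hu4 : 4 ≤ u ^ 2 := by nlinarith
      have hden : 0 < 4 * u ^ 2 * (u ^ 2 - 1) := by
        have : 0 < u ^ 2 - 1 := by linarith
        positivity
      have h1 : |jacobiA α β (m + 1) ^ 2 - 1 / 4| ≤ K / (2 * u ^ 2) := by
        rw [h, abs_div, abs_of_pos hden, div_le_div_iff₀ hden (by positivity)]
        have h2 : |u ^ 2 * (1 - (α + β) ^ 2 - (α - β) ^ 2) + (α + β) ^ 2 * (α - β) ^ 2| ≤
            u ^ 2 * K := by
          refine (abs_add_le _ _).trans ?_
          rw [abs_mul, abs_of_nonneg (sq_nonneg u),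
            abs_of_nonneg (by positivity : 0 ≤ (α + β) ^ 2 * (α - β) ^ 2), hK, mul_add]
          have h5 : 0 ≤ (α + β) ^ 2 * (α - β) ^ 2 := by positivity
          nlinarith
        calc _ ≤ u ^ 2 * K * (2 * u ^ 2) := by gcongr
          _ ≤ K * (4 * u ^ 2 * (u ^ 2 - 1)) := by
            have : 0 ≤ K * u ^ 2 := by positivity
            nlinarith
      -- Dividing by `a + 1/2`, which exceeds `1/2` because `a_n` is positive.
      have h3 : |jacobiA α β (m + 1) - 1 / 2| ≤ 2 * |jacobiA α β (m + 1) ^ 2 - 1 / 4| := by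
        have : jacobiA α β (m + 1) ^ 2 - 1 / 4 =
            (jacobiA α β (m + 1) - 1 / 2) * (jacobiA α β (m + 1) + 1 / 2) := by ring
        rw [this, abs_mul, abs_of_pos (by linarith : 0 < jacobiA α β (m + 1) + 1 / 2)]
        nlinarith [abs_nonneg (jacobiA α β (m + 1) - 1 / 2)]
      refine h3.trans ((mul_le_mul_of_nonneg_left h1 (by norm_num)).trans ?_)
      push_cast
      have hu5 : ((m : ℝ) + 1 + 1) ^ 2 ≤ u ^ 2 := by
        gcongr
        linarith
      calc 2 * (K / (2 * u ^ 2)) = K / u ^ 2 := by field_simp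
        _ ≤ (K + 2 * K' + 8) / (m + 1 + 1) ^ 2 := by
          gcongr
          linarith
  · rcases n with _ | _ | m
    · have h1 := hBb 0
      norm_num at h1 ⊢
      linarith
    · have h1 := hBb 1
      norm_num at h1 ⊢
      linarith
    · have hm : (0 : ℝ) ≤ m := m.cast_nonneg
      have e1 : 0 < 2 * (m : ℝ) + 4 + (α + β) := by linarith
      have e2 : 0 < 2 * (m : ℝ) + 6 + (α + β) := by linarith
      rw [show m + 1 + 1 = m + 2 from rfl, jacobiB_formula hα hβ, abs_div, abs_neg,
        abs_of_pos (mul_pos e1 e2), div_le_div_iff₀ (mul_pos e1 e2) (by positivity)]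
      push_cast
      have h6 : ((m : ℝ) + 2 + 1) ^ 2 ≤ 2 * ((2 * m + 4 + (α + β)) * (2 * m + 6 + (α + β))) := by
        have : (2 * (m : ℝ) + 2) * (2 * m + 4) ≤
            (2 * m + 4 + (α + β)) * (2 * m + 6 + (α + β)) :=
          mul_le_mul (by linarith) (by linarith) (by linarith) e1.le
        nlinarith
      calc K' * ((m : ℝ) + 2 + 1) ^ 2 ≤
          K' * (2 * ((2 * m + 4 + (α + β)) * (2 * m + 6 + (α + β)))) := by gcongr
        _ ≤ (K + 2 * K' + 8) * ((2 * m + 4 + (α + β)) * (2 * m + 6 + (α + β))) := by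
          have := mul_pos e1 e2
          nlinarith

/-! ### Perturbations of the free recurrence -/

theorem inv_sq_le_two_mul_sub (k : ℕ) :
    1 / ((k : ℝ) + 1) ^ 2 ≤ 2 * (1 / ((k : ℝ) + 1) - 1 / ((k : ℝ) + 1 + 1)) := by
  have hk : (0 : ℝ) ≤ k := k.cast_nonneg
  rw [div_sub_div _ _ (by positivity) (by positivity), ← mul_div_assoc,
    div_le_div_iff₀ (by positivity) (by positivity)]
  nlinarith

theorem sum_inv_sq_le_two (n : ℕ) : ∑ k ∈ Finset.range n, 1 / ((k : ℝ) + 1) ^ 2 ≤ 2 := by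
  have h : ∑ k ∈ Finset.range n, 1 / ((k : ℝ) + 1) ^ 2 ≤ 2 * (1 - 1 / ((n : ℝ) + 1)) := by
    induction n with
    | zero => simp
    | succ n ih =>
      rw [Finset.sum_range_succ]
      have := inv_sq_le_two_mul_sub n
      push_cast
      linarith
  have : 0 ≤ 1 / ((n : ℝ) + 1) := by positivity
  linarith

/-- The increments are dominated by the telescoping differences of `2B/(n + 1)`, which give both the
Cauchy property and the rate. -/
theorem exists_limit_of_norm_sub_le {x : ℕ → ℂ} {B : ℝ} (hB : 0 ≤ B)
    (h : ∀ n, ‖x (n + 1) - x n‖ ≤ B / ((n : ℝ) + 1) ^ 2) :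
    ∃ l, ∀ n, ‖x n - l‖ ≤ 2 * B / ((n : ℝ) + 1) := by
  have key : ∀ n k, ‖x (n + k) - x n‖ ≤
      2 * B * (1 / ((n : ℝ) + 1) - 1 / ((n : ℝ) + k + 1)) := by
    intro n k
    induction k with
    | zero => simp
    | succ k ih =>
      have h1 := h (n + k)
      have h2 := mul_le_mul_of_nonneg_left (inv_sq_le_two_mul_sub (n + k)) hB
      have h3 := norm_add_le (x (n + k + 1) - x (n + k)) (x (n + k) - x n)
      rw [sub_add_sub_cancel] at h3
      rw [show n + (k + 1) = n + k + 1 from rfl]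
      rw [← div_eq_mul_one_div] at h2
      push_cast at h1 h2 ⊢
      rw [show (n : ℝ) + (k + 1) + 1 = n + k + 1 + 1 by ring]
      linarith
  have key' : ∀ n k, ‖x (n + k) - x n‖ ≤ 2 * B / ((n : ℝ) + 1) := by
    intro n k
    refine (key n k).trans ?_
    have : 0 ≤ 2 * B * (1 / ((n : ℝ) + k + 1)) := by positivity
    rw [mul_sub, ← div_eq_mul_one_div]
    linarith
  have hc : CauchySeq x := by
    refine cauchySeq_of_le_tendsto_0' (fun n => 2 * B / ((n : ℝ) + 1)) ?_ ?_
    · intro n m hnm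
      obtain ⟨k, rfl⟩ := Nat.exists_eq_add_of_le hnm
      rw [dist_comm, dist_eq_norm]
      exact key' n k
    · exact tendsto_const_div_atTop_nhds_zero_nat (2 * B) |>.comp (tendsto_add_atTop_nat 1) |>.congr
        fun n => by simp
  obtain ⟨l, hl⟩ := cauchySeq_tendsto_of_complete hc
  refine ⟨l, fun n => ?_⟩
  have h1 : Tendsto (fun k => ‖x (n + k) - x n‖) atTop (𝓝 ‖l - x n‖) :=
    ((hl.comp (tendsto_add_atTop_nat n)).congr (fun k => by simp [add_comm])).sub_const _ |>.norm
  rw [norm_sub_rev]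
  exact le_of_tendsto' h1 fun k => key' n k

/-- Summing the recursion bounds the partial sums of `e` by `(e 0 + 2B)/(1 - ρ)`; the terms of a
convergent series tend to zero. -/
theorem tendsto_zero_of_le_mul_add {e : ℕ → ℝ} {ρ B : ℝ} (h0 : ∀ n, 0 ≤ e n) (hρ1 : ρ < 1)
    (hB : 0 ≤ B) (h : ∀ n, e (n + 1) ≤ ρ * e n + B / ((n : ℝ) + 1) ^ 2) :
    Tendsto e atTop (𝓝 0) := by
  have hs : ∀ n, ∑ k ∈ Finset.range n, e k ≤ (e 0 + 2 * B) / (1 - ρ) := by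
    intro n
    rw [le_div_iff₀ (by linarith)]
    have h1 : ∑ k ∈ Finset.range n, e (k + 1) ≤ ρ * ∑ k ∈ Finset.range n, e k + 2 * B := by
      calc _ ≤ ∑ k ∈ Finset.range n, (ρ * e k + B * (1 / ((k : ℝ) + 1) ^ 2)) :=
            Finset.sum_le_sum fun k _ => by rw [← div_eq_mul_one_div]; exact h k
        _ = ρ * ∑ k ∈ Finset.range n, e k + B * ∑ k ∈ Finset.range n, 1 / ((k : ℝ) + 1) ^ 2 := by
            rw [Finset.sum_add_distrib, Finset.mul_sum, Finset.mul_sum]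
        _ ≤ _ := by nlinarith [sum_inv_sq_le_two n]
    have h2 := Finset.sum_range_succ' e n
    have h3 := Finset.sum_range_succ e n
    have h4 := h0 n
    linarith
  exact (summable_of_sum_range_le h0 hs).tendsto_atTop_zero

/-- For a Jacobi matrix with coefficients `a`, `b` and orthonormal polynomials `G_n`, the
polynomial `z ^ n * G_n ((z + z⁻¹) / 2)`. -/
noncomputable def jostSeq (a b : ℕ → ℝ) : ℕ → ℂ → ℂ
  | 0, _ => 1
  | 1, z => ((1 + z ^ 2) / 2 - b 0 * z) / a 0
  | n + 2, z => (((1 + z ^ 2) / 2 - b (n + 1) * z) * jostSeq a b (n + 1) z -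
      a n * z ^ 2 * jostSeq a b n z) / a (n + 1)

theorem differentiable_jostSeq (a b : ℕ → ℝ) : ∀ n, Differentiable ℂ (jostSeq a b n)
  | 0 => by
    have : jostSeq a b 0 = fun _ => 1 := by funext z; rw [jostSeq]
    rw [this]; fun_prop
  | 1 => by
    have : jostSeq a b 1 = fun z : ℂ => ((1 + z ^ 2) / 2 - b 0 * z) / a 0 := by funext z; rw [jostSeq]
    rw [this]; fun_prop
  | n + 2 => by
    have : jostSeq a b (n + 2) = fun z : ℂ => (((1 + z ^ 2) / 2 - b (n + 1) * z) *
        jostSeq a b (n + 1) z - a n * z ^ 2 * jostSeq a b n z) / a (n + 1) := by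
      funext z; rw [jostSeq]
    have h1 := differentiable_jostSeq a b (n + 1)
    have h2 := differentiable_jostSeq a b n
    rw [this]; fun_prop

/-- `D_n = H_{n+1} - z² H_n`. -/
noncomputable def jostD (a b : ℕ → ℝ) (n : ℕ) (z : ℂ) : ℂ :=
  jostSeq a b (n + 1) z - z ^ 2 * jostSeq a b n z

/-- The Jost function of the Jacobi matrix. -/
noncomputable def jostFun (a b : ℕ → ℝ) (z : ℂ) : ℂ := limUnder atTop fun n => jostD a b n z

/-- Coefficients of Jacobi matrices that approach those of the free matrix like `n⁻²`. -/
structure NearFree (a b : ℕ → ℝ) (C m : ℝ) : Prop where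
  C_nonneg : 0 ≤ C
  m_pos : 0 < m
  le_a : ∀ n, m ≤ a n
  a_sub : ∀ n, |a n - 1 / 2| ≤ C / ((n : ℝ) + 1) ^ 2
  abs_b : ∀ n, |b n| ≤ C / ((n : ℝ) + 1) ^ 2

section NearFree

variable {a b : ℕ → ℝ} {C m : ℝ}

/-- For the free matrix, `a = 1/2` and `b = 0`, the left side vanishes. In general it is linear in
`a - 1/2`, in `b` and in differences of consecutive `a`, divided by `a (n + 1) ≥ m`. -/
theorem NearFree.norm_remainder_le (h : NearFree a b C m) {z : ℂ} (hz : ‖z‖ ≤ 1) (n : ℕ) :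
    ‖jostSeq a b (n + 2) z - (1 + z ^ 2) * jostSeq a b (n + 1) z + z ^ 2 * jostSeq a b n z‖ ≤
      3 * C / m / ((n : ℝ) + 1) ^ 2 * (‖jostSeq a b n z‖ + ‖jostSeq a b (n + 1) z‖) := by
  have hm := h.m_pos
  have hC := h.C_nonneg
  have ha : 0 < a (n + 1) := hm.trans_le (h.le_a _)
  have hac : (a (n + 1) : ℂ) ≠ 0 := by exact_mod_cast ha.ne'
  have e : jostSeq a b (n + 2) z - (1 + z ^ 2) * jostSeq a b (n + 1) z +
      z ^ 2 * jostSeq a b n z = ((a (n + 1) : ℂ))⁻¹ *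
      ((((1 + z ^ 2) * ((-(a (n + 1) - 1 / 2) : ℝ) : ℂ)) + ((-b (n + 1) : ℝ) : ℂ) * z) *
        jostSeq a b (n + 1) z + ((a (n + 1) - a n : ℝ) : ℂ) * z ^ 2 * jostSeq a b n z) := by
    rw [jostSeq]
    push_cast
    field_simp
    ring
  have hz2 : ‖z ^ 2‖ ≤ 1 := by rw [norm_pow]; exact pow_le_one₀ (norm_nonneg _) hz
  have hz3 : ‖1 + z ^ 2‖ ≤ 2 := (norm_add_le _ _).trans (by rw [norm_one]; linarith)
  set q := C / ((n : ℝ) + 1) ^ 2 with hq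
  have hq0 : 0 ≤ q := by positivity
  have hqn : C / (((n + 1 : ℕ) : ℝ) + 1) ^ 2 ≤ q := by
    rw [hq]
    push_cast
    gcongr
    linarith
  have a1 := (h.a_sub (n + 1)).trans hqn
  have b1 := (h.abs_b (n + 1)).trans hqn
  have a0 := h.a_sub n
  have a2 : |a (n + 1) - a n| ≤ 2 * q := by
    have : a (n + 1) - a n = (a (n + 1) - 1 / 2) - (a n - 1 / 2) := by ring
    rw [this]
    exact (abs_sub _ _).trans (by linarith)
  rw [e, norm_mul, norm_inv, Complex.norm_real, Real.norm_of_nonneg ha.le]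
  have h1 : ‖((1 + z ^ 2) * ((-(a (n + 1) - 1 / 2) : ℝ) : ℂ)) + ((-b (n + 1) : ℝ) : ℂ) * z‖ ≤
      3 * q := by
    refine (norm_add_le _ _).trans ?_
    rw [norm_mul, norm_mul, Complex.norm_real, Complex.norm_real, norm_neg, norm_neg,
      Real.norm_eq_abs, Real.norm_eq_abs]
    have i1 : ‖1 + z ^ 2‖ * |a (n + 1) - 1 / 2| ≤ 2 * q := by gcongr
    have i2 : |b (n + 1)| * ‖z‖ ≤ q * 1 := by gcongr
    linarith
  have h2 : ‖((a (n + 1) - a n : ℝ) : ℂ) * z ^ 2‖ ≤ 3 * q := by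
    rw [norm_mul, Complex.norm_real, Real.norm_eq_abs]
    have : |a (n + 1) - a n| * ‖z ^ 2‖ ≤ 2 * q * 1 := by gcongr
    linarith
  have hinv : (a (n + 1))⁻¹ ≤ m⁻¹ := inv_anti₀ hm (h.le_a _)
  calc _ ≤ m⁻¹ * (3 * q * ‖jostSeq a b (n + 1) z‖ + 3 * q * ‖jostSeq a b n z‖) := by
        refine mul_le_mul hinv ((norm_add_le _ _).trans ?_) (norm_nonneg _) (by positivity)
        rw [norm_mul, norm_mul _ (jostSeq a b n z)]
        gcongr
    _ = _ := by
        rw [hq]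
        field_simp
        ring

theorem norm_jostSeq_one_le (a b : ℕ → ℝ) {z : ℂ} (hz : ‖z‖ ≤ 1) :
    ‖jostSeq a b 1 z‖ ≤ (1 + |b 0|) / |a 0| := by
  rw [jostSeq, norm_div, Complex.norm_real, Real.norm_eq_abs]
  have hz2 : ‖z ^ 2‖ ≤ 1 := by rw [norm_pow]; exact pow_le_one₀ (norm_nonneg _) hz
  gcongr
  refine (norm_sub_le _ _).trans (add_le_add ?_ ?_)
  · rw [norm_div, RCLike.norm_ofNat]
    have : ‖1 + z ^ 2‖ ≤ 2 := (norm_add_le _ _).trans (by rw [norm_one]; linarith)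
    linarith
  · rw [norm_mul, Complex.norm_real, Real.norm_eq_abs]
    exact mul_le_of_le_one_right (abs_nonneg _) hz

/-- The combinations `H_{n+1} - z² H_n` and `H_{n+1} - H_n` diagonalise the free recurrence: a step
multiplies them by `1` and by `z²`, neither of which increases the norm on the disc. Their
difference is `(1 - z²) H_n`, so `|1 - z²| ≥ δ` recovers `H_n` from them. A discrete Gronwall
inequality with the summable weights `(n + 1)⁻²` then bounds both. -/
theorem NearFree.exists_bound (h : NearFree a b C m) {δ : ℝ} (hδ : 0 < δ) :
    ∃ B : ℝ, 0 ≤ B ∧ ∀ z : ℂ, ‖z‖ ≤ 1 → δ ≤ ‖1 - z ^ 2‖ → ∀ n,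
      ‖jostSeq a b (n + 2) z - (1 + z ^ 2) * jostSeq a b (n + 1) z + z ^ 2 * jostSeq a b n z‖ ≤
        B / ((n : ℝ) + 1) ^ 2 := by
  have hm := h.m_pos
  have hC := h.C_nonneg
  set K := 3 * C / m with hK
  have hK0 : 0 ≤ K := by positivity
  -- A bound for the initial value `‖H 1 - z²‖ + ‖H 1 - 1‖`.
  set M0 : ℝ := 2 * ((1 + |b 0|) / |a 0| + 1) with hM0
  have hM00 : 0 ≤ M0 := by positivity
  set c := K * (2 / δ + 1) with hc
  have hc0 : 0 ≤ c := by positivity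
  refine ⟨c * (M0 * Real.exp (2 * c * 2)), by positivity, fun z hz hzδ n => ?_⟩
  set H := fun n => jostSeq a b n z with hH
  set M : ℕ → ℝ := fun n => ‖H (n + 1) - z ^ 2 * H n‖ + ‖H (n + 1) - H n‖ with hMdef
  have hz2 : ‖z ^ 2‖ ≤ 1 := by rw [norm_pow]; exact pow_le_one₀ (norm_nonneg _) hz
  have hMnn : ∀ n, 0 ≤ M n := fun n => by positivity
  have hHle : ∀ n, ‖H n‖ ≤ M n / δ := by
    intro n
    rw [le_div_iff₀ hδ]
    have : (1 - z ^ 2) * H n = (H (n + 1) - z ^ 2 * H n) - (H (n + 1) - H n) := by ring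
    calc ‖H n‖ * δ ≤ ‖H n‖ * ‖1 - z ^ 2‖ := by gcongr
      _ = ‖(1 - z ^ 2) * H n‖ := by rw [norm_mul, mul_comm]
      _ ≤ M n := by rw [this]; exact norm_sub_le _ _
  have hrem : ∀ n, ‖H (n + 2) - (1 + z ^ 2) * H (n + 1) + z ^ 2 * H n‖ ≤
      c * M n / ((n : ℝ) + 1) ^ 2 := by
    intro n
    refine (h.norm_remainder_le hz n).trans ?_
    have h1 : ‖H (n + 1)‖ ≤ M n + M n / δ := by
      calc ‖H (n + 1)‖ = ‖(H (n + 1) - H n) + H n‖ := by rw [sub_add_cancel]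
        _ ≤ ‖H (n + 1) - H n‖ + ‖H n‖ := norm_add_le _ _
        _ ≤ M n + M n / δ := add_le_add (le_add_of_nonneg_left (norm_nonneg _)) (hHle n)
    have h2 : ‖H n‖ + ‖H (n + 1)‖ ≤ (2 / δ + 1) * M n := by
      have := hHle n
      calc _ ≤ M n / δ + (M n + M n / δ) := add_le_add this h1
        _ = _ := by ring
    calc _ ≤ K / ((n : ℝ) + 1) ^ 2 * ((2 / δ + 1) * M n) := by gcongr
      _ = _ := by rw [hc]; ring
  have hstep : ∀ n, M (n + 1) ≤ M n * (1 + 2 * c * (1 / ((n : ℝ) + 1) ^ 2)) := by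
    intro n
    set r := H (n + 2) - (1 + z ^ 2) * H (n + 1) + z ^ 2 * H n with hr
    have e1 : H (n + 1 + 1) - z ^ 2 * H (n + 1) = (H (n + 1) - z ^ 2 * H n) + r := by
      rw [hr]; ring
    have e2 : H (n + 1 + 1) - H (n + 1) = z ^ 2 * (H (n + 1) - H n) + r := by
      rw [hr]; ring
    have h3 : ‖z ^ 2 * (H (n + 1) - H n)‖ ≤ ‖H (n + 1) - H n‖ := by
      rw [norm_mul]
      exact mul_le_of_le_one_left (norm_nonneg _) hz2
    have h4 := hrem n
    simp only [hMdef]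
    rw [e1, e2]
    have h5 := norm_add_le (H (n + 1) - z ^ 2 * H n) r
    have h6 := norm_add_le (z ^ 2 * (H (n + 1) - H n)) r
    have h7 : M n * (1 + 2 * c * (1 / ((n : ℝ) + 1) ^ 2)) =
        M n + 2 * (c * M n / ((n : ℝ) + 1) ^ 2) := by ring
    have h8 : M n = ‖H (n + 1) - z ^ 2 * H n‖ + ‖H (n + 1) - H n‖ := rfl
    rw [← h8, h7]
    linarith
  have hMb : ∀ n, M n ≤ M0 * Real.exp (2 * c * ∑ k ∈ Finset.range n, 1 / ((k : ℝ) + 1) ^ 2) := by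
    intro n
    induction n with
    | zero =>
      simp only [Finset.range_zero, Finset.sum_empty, mul_zero, Real.exp_zero, mul_one]
      have h1 := norm_jostSeq_one_le a b hz
      have h0 : H 0 = 1 := by simp only [hH]; rw [jostSeq]
      simp only [hMdef, zero_add, h0, mul_one]
      have i1 := norm_sub_le (H 1) (z ^ 2)
      have i2 := norm_sub_le (H 1) 1
      rw [norm_one] at i2
      change ‖H 1‖ ≤ _ at h1
      linarith
    | succ n ih =>
      refine (hstep n).trans ?_
      rw [Finset.sum_range_succ, mul_add (2 * c), Real.exp_add, ← mul_assoc M0]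
      refine mul_le_mul ih ?_ (by positivity) (by positivity)
      rw [add_comm]
      exact Real.add_one_le_exp _
  refine (hrem n).trans ?_
  gcongr
  refine (hMb n).trans ?_
  gcongr
  exact sum_inv_sq_le_two n

/-- The increment `D_{n+1} - D_n` is exactly the remainder bounded in `NearFree.exists_bound`. -/
theorem NearFree.exists_jostD_bound (h : NearFree a b C m) {δ : ℝ} (hδ : 0 < δ) :
    ∃ B : ℝ, 0 ≤ B ∧ ∀ z : ℂ, ‖z‖ ≤ 1 → δ ≤ ‖1 - z ^ 2‖ → ∀ n,
      ‖jostD a b n z - jostFun a b z‖ ≤ B / ((n : ℝ) + 1) := by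
  obtain ⟨B, hB, hb⟩ := h.exists_bound hδ
  refine ⟨2 * B, by positivity, fun z hz hzδ => ?_⟩
  obtain ⟨l, hl⟩ := exists_limit_of_norm_sub_le (x := fun n => jostD a b n z) hB (fun n => by
    have := hb z hz hzδ n
    simp only [jostD]
    convert this using 2
    ring)
  have ht : Tendsto (fun n => jostD a b n z) atTop (𝓝 l) := by
    rw [tendsto_iff_norm_sub_tendsto_zero]
    refine squeeze_zero (fun _ => norm_nonneg _) hl ?_
    exact tendsto_const_div_atTop_nhds_zero_nat (2 * B) |>.comp (tendsto_add_atTop_nat 1) |>.congr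
        fun n => by simp
  have : jostFun a b z = l := ht.limUnder_eq
  rw [this]
  exact hl

theorem tendsto_const_div_add_one (B : ℝ) :
    Tendsto (fun n : ℕ => B / ((n : ℝ) + 1)) atTop (𝓝 0) :=
  tendsto_const_div_atTop_nhds_zero_nat B |>.comp (tendsto_add_atTop_nat 1) |>.congr
    fun n => by simp

theorem NearFree.continuousOn_jostFun (h : NearFree a b C m) {δ : ℝ} (hδ : 0 < δ) :
    ContinuousOn (jostFun a b) {z | ‖z‖ ≤ 1 ∧ δ ≤ ‖1 - z ^ 2‖} := by
  obtain ⟨B, hB, hb⟩ := h.exists_jostD_bound hδ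
  have hu : TendstoUniformlyOn (fun n z => jostD a b n z) (jostFun a b) atTop
      {z | ‖z‖ ≤ 1 ∧ δ ≤ ‖1 - z ^ 2‖} := by
    rw [Metric.tendstoUniformlyOn_iff]
    intro ε hε
    filter_upwards [(tendsto_const_div_add_one B).eventually_lt_const hε] with n hn z hz
    rw [dist_comm, dist_eq_norm]
    exact (hb z hz.1 hz.2 n).trans_lt hn
  refine hu.continuousOn (Eventually.frequently (Eventually.of_forall fun n => ?_))
  have h1 := (differentiable_jostSeq a b (n + 1)).continuous
  have h2 := (differentiable_jostSeq a b n).continuous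
  unfold jostD
  fun_prop

/-- `(1 - z²) H_n = D_n - (H_{n+1} - H_n)`, and inside the disc the last difference dies out: each
step multiplies it by `z²` and adds a summable remainder. -/
theorem NearFree.tendstoLocallyUniformlyOn_jostSeq (h : NearFree a b C m) :
    TendstoLocallyUniformlyOn (fun n z => jostSeq a b n z)
      (fun z => jostFun a b z / (1 - z ^ 2)) atTop (Metric.ball 0 1) := by
  rw [Metric.tendstoLocallyUniformlyOn_iff]
  intro ε hε z hz
  rw [mem_ball_zero_iff] at hz
  obtain ⟨ρ, hρ, hρ1⟩ := exists_between hz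
  have hρ0 : 0 < ρ := (norm_nonneg z).trans_lt hρ
  have hδ : 0 < 1 - ρ ^ 2 := by nlinarith
  obtain ⟨B, hB, hb⟩ := h.exists_bound hδ
  obtain ⟨B', hB', hb'⟩ := h.exists_jostD_bound hδ
  -- A majorant for `‖H_{n+1} - H_n‖` on the whole ball of radius `ρ`, defined by the recursion
  -- itself so that the convergence is uniform there.
  set e : ℕ → ℝ := fun n => Nat.rec ((1 + |b 0|) / |a 0| + 1)
    (fun n y => ρ * y + B / ((n : ℝ) + 1) ^ 2) n with he
  have he1 : ∀ n, e (n + 1) = ρ * e n + B / ((n : ℝ) + 1) ^ 2 := fun n => rfl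
  have he0 : ∀ n, 0 ≤ e n := by
    intro n
    induction n with
    | zero =>
      change 0 ≤ (1 + |b 0|) / |a 0| + 1
      positivity
    | succ n ih => rw [he1]; positivity
  have het : Tendsto e atTop (𝓝 0) :=
    tendsto_zero_of_le_mul_add he0 hρ1 hB fun n => (he1 n).le
  have htot : Tendsto (fun n : ℕ => (B' / ((n : ℝ) + 1) + e n) / (1 - ρ ^ 2)) atTop (𝓝 0) := by
    have := ((tendsto_const_div_add_one B').add het).div_const (1 - ρ ^ 2)
    simpa using this
  refine ⟨Metric.ball 0 ρ, mem_nhdsWithin_of_mem_nhds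
    (Metric.isOpen_ball.mem_nhds (mem_ball_zero_iff.2 hρ)), ?_⟩
  filter_upwards [htot.eventually_lt_const hε] with n hn y hy
  rw [mem_ball_zero_iff] at hy
  have hy1 : ‖y‖ ≤ 1 := by linarith
  have hy2 : ‖y ^ 2‖ ≤ ρ := by
    rw [norm_pow]
    nlinarith [norm_nonneg y]
  have hyδ : 1 - ρ ^ 2 ≤ ‖1 - y ^ 2‖ := by
    have h1 := norm_sub_norm_le (1 : ℂ) (y ^ 2)
    rw [norm_one, norm_pow] at h1
    have : ‖y‖ ^ 2 ≤ ρ ^ 2 := by gcongr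
    linarith
  have hE : ∀ n, ‖jostSeq a b (n + 1) y - jostSeq a b n y‖ ≤ e n := by
    intro n
    induction n with
    | zero =>
      have h1 := norm_jostSeq_one_le a b hy1
      have h0 : jostSeq a b 0 y = 1 := by rw [jostSeq]
      have i2 := norm_sub_le (jostSeq a b 1 y) 1
      rw [norm_one] at i2
      rw [zero_add, h0]
      change _ ≤ (1 + |b 0|) / |a 0| + 1
      linarith
    | succ n ih =>
      have h1 := hb y hy1 hyδ n
      have e2 : jostSeq a b (n + 1 + 1) y - jostSeq a b (n + 1) y =
          y ^ 2 * (jostSeq a b (n + 1) y - jostSeq a b n y) +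
          (jostSeq a b (n + 2) y - (1 + y ^ 2) * jostSeq a b (n + 1) y +
            y ^ 2 * jostSeq a b n y) := by ring
      rw [e2, he1]
      refine (norm_add_le _ _).trans (add_le_add ?_ h1)
      rw [norm_mul]
      gcongr
  have hne : (1 - y ^ 2) ≠ 0 := norm_pos_iff.1 (hδ.trans_le hyδ)
  refine lt_of_le_of_lt ?_ hn
  rw [dist_eq_norm]
  have e3 : jostFun a b y / (1 - y ^ 2) - jostSeq a b n y =
      -((jostD a b n y - jostFun a b y) - (jostSeq a b (n + 1) y - jostSeq a b n y)) /
        (1 - y ^ 2) := by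
    unfold jostD
    field_simp
    ring
  rw [e3, norm_div, norm_neg]
  have hen := he0 n
  exact div_le_div₀ (by positivity)
    ((norm_sub_le _ _).trans (add_le_add (hb' y hy1 hyδ n) (hE n))) hδ hyδ

/-- At `z = 0` every `H_n` is a nonnegative real number. This fixes the sign of the constant in the
Jost function, and later that of the amplitude. -/
theorem NearFree.jostFun_zero (h : NearFree a b C m) : ∃ c : ℝ, 0 ≤ c ∧ jostFun a b 0 = c := by
  have h0 : ∀ n, ∃ c : ℝ, 0 ≤ c ∧ jostSeq a b n 0 = c := by
    intro n
    induction n using Nat.strong_induction_on with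
    | _ n ih =>
      rcases n with _ | _ | n
      · exact ⟨1, zero_le_one, by rw [jostSeq]; simp⟩
      · have := h.m_pos.trans_le (h.le_a 0)
        exact ⟨1 / 2 / a 0, by positivity, by rw [jostSeq]; push_cast; simp⟩
      · obtain ⟨c, hc, e⟩ := ih (n + 1) (by omega)
        have := h.m_pos.trans_le (h.le_a (n + 1))
        exact ⟨1 / 2 * c / a (n + 1), by positivity, by rw [jostSeq, e]; push_cast; simp⟩
  choose c hc0 hc using h0
  obtain ⟨B, hB, hb⟩ := h.exists_jostD_bound one_pos
  have hb0 := hb 0 (by simp) (by simp)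
  have ht : Tendsto (fun n => jostD a b n 0) atTop (𝓝 (jostFun a b 0)) := by
    rw [tendsto_iff_norm_sub_tendsto_zero]
    exact squeeze_zero (fun _ => norm_nonneg _) hb0 (tendsto_const_div_add_one B)
  have e : (fun n => jostD a b n 0) = fun n => ((c (n + 1) : ℝ) : ℂ) := by
    funext n
    simp [jostD, hc]
  rw [e] at ht
  refine ⟨(jostFun a b 0).re, ?_, ?_⟩
  · exact ge_of_tendsto' ((Complex.continuous_re.tendsto _).comp ht) fun n => by
      simpa using hc0 (n + 1)
  · have : (jostFun a b 0).im = 0 :=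
      tendsto_nhds_unique ((Complex.continuous_im.tendsto _).comp ht) (by simp [Function.comp_def])
    apply Complex.ext <;> simp [this]

end NearFree

/-! ### The Jost function of the Jacobi operator -/

/-- The lower bound for `a_n` is `1/4` once `n ≥ 4C`, combined with a minimum over the finitely many
remaining positive values. -/
theorem exists_nearFree_jacobi {α β : ℝ} (hα : -1 < α) (hβ : -1 < β) :
    ∃ C m, NearFree (jacobiA α β) (jacobiB α β) C m := by
  obtain ⟨C, hC, h⟩ := exists_jacobi_coeff_bound hα hβ
  obtain ⟨N, hN⟩ : ∃ N : ℕ, 4 * C ≤ N := exists_nat_ge _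
  have hev : ∀ n, N ≤ n → 1 / 4 ≤ jacobiA α β n := by
    intro n hn
    have h1 := (abs_le.1 (h n).1).1
    have hn' : (N : ℝ) ≤ n := by exact_mod_cast hn
    have h2 : C / ((n : ℝ) + 1) ^ 2 ≤ 1 / 4 := by
      rw [div_le_iff₀ (by positivity)]
      nlinarith [n.cast_nonneg (α := ℝ)]
    linarith
  obtain ⟨m, hm, hle⟩ : ∃ m : ℝ, 0 < m ∧ ∀ n < N, m ≤ jacobiA α β n := by
    clear hev hN
    induction N with
    | zero => exact ⟨1, one_pos, by simp⟩
    | succ N ih =>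
      obtain ⟨m, hm, hle⟩ := ih
      refine ⟨min m (jacobiA α β N), lt_min hm (jacobiA_pos hα hβ N), fun n hn => ?_⟩
      rcases Nat.lt_succ_iff_lt_or_eq.1 hn with hlt | rfl
      · exact (min_le_left _ _).trans (hle n hlt)
      · exact min_le_right _ _
  refine ⟨C, min m (1 / 4), hC, lt_min hm (by norm_num), fun n => ?_, fun n => (h n).1,
    fun n => (h n).2⟩
  rcases lt_or_ge n N with hn | hn
  · exact (min_le_left _ _).trans (hle n hn)
  · exact (min_le_right _ _).trans (hev n hn)

theorem jacobiPoly_zero {α β : ℝ} (hα : -1 < α) (hβ : -1 < β) : jacobiPoly α β 0 = 1 := by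
  have h0 : jacobiMonic α β 0 = 1 := by
    rw [jacobiMonic]
    simp
  have hk := jacobiConst_pos hα hβ
  have h1 : jacobiPairing α β 1 1 = 1 := by
    unfold jacobiPairing jacobiDensity
    simp only [Polynomial.eval_one, one_mul]
    rw [integral_const_mul]
    unfold jacobiConst at hk ⊢
    exact inv_mul_cancel₀ (inv_pos.1 hk).ne'
  rw [jacobiPoly, h0, h1]
  simp

theorem jostSeq_jacobi_eq {α β : ℝ} (hα : -1 < α) (hβ : -1 < β) {z : ℂ} (hz : z ≠ 0) (n : ℕ) :
    jostSeq (jacobiA α β) (jacobiB α β) n z =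
      z ^ n * Polynomial.aeval ((z + z⁻¹) / 2) (jacobiPoly α β n) := by
  induction n using Nat.strong_induction_on with
  | _ n ih =>
    rcases n with _ | _ | n
    · rw [jostSeq, jacobiPoly_zero hα hβ]
      simp
    · have h := congrArg (Polynomial.aeval ((z + z⁻¹) / 2)) (jacobiPoly_recurrence_zero hα hβ)
      have ha : (jacobiA α β 0 : ℂ) ≠ 0 := by exact_mod_cast (jacobiA_pos hα hβ 0).ne'
      simp only [map_add, map_mul, Polynomial.aeval_X, Polynomial.aeval_C, jacobiPoly_zero hα hβ,
        Complex.coe_algebraMap, mul_one] at h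
      rw [jostSeq, zero_add, div_eq_iff ha]
      field_simp at h ⊢
      linear_combination h
    · have h := congrArg (Polynomial.aeval ((z + z⁻¹) / 2)) (jacobiPoly_recurrence hα hβ n)
      have ha : (jacobiA α β (n + 1) : ℂ) ≠ 0 := by exact_mod_cast (jacobiA_pos hα hβ (n + 1)).ne'
      simp only [map_add, map_mul, Polynomial.aeval_X, Polynomial.aeval_C,
        Complex.coe_algebraMap] at h
      rw [jostSeq, ih (n + 1) (by omega), ih n (by omega), div_eq_iff ha]
      have hzz : z * z⁻¹ = 1 := mul_inv_cancel₀ hz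
      set y := z⁻¹ with hy
      clear_value y
      rw [show n + 1 + 1 = n + 2 from rfl]
      linear_combination (z ^ (n + 2)) * h - (z ^ (n + 1) / 2 *
        (Polynomial.aeval ((z + y) / 2)) (jacobiPoly α β (n + 1))) * hzz

/-- The differential equation of the Jacobi polynomials in the variable `z`, `2x = z + z⁻¹`. -/
theorem jostSeq_jacobi_ode {α β : ℝ} (hα : -1 < α) (hβ : -1 < β) {z : ℂ} (hz : z ≠ 0) (n : ℕ) :
    (z ^ 2 - 1) * (-(z * deriv (deriv (jostSeq (jacobiA α β) (jacobiB α β) n)) z +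
      deriv (jostSeq (jacobiA α β) (jacobiB α β) n) z) +
      2 * n * deriv (jostSeq (jacobiA α β) (jacobiB α β) n) z) +
    (2 * (β - α) * z - (α + β + 1) * (z ^ 2 + 1)) *
      deriv (jostSeq (jacobiA α β) (jacobiB α β) n) z +
    n * (2 * (α + β + 1) * z - 2 * (β - α)) * jostSeq (jacobiA α β) (jacobiB α β) n z = 0 := by
  set H := jostSeq (jacobiA α β) (jacobiB α β) n with hH
  set P := jacobiPoly α β n with hP
  set x : ℂ → ℂ := fun z => (z + z⁻¹) / 2 with hx
  have hHeq : ∀ y : ℂ, y ≠ 0 → H y = y ^ (n : ℤ) * Polynomial.aeval (x y) P := fun y hy => by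
    rw [hH, jostSeq_jacobi_eq hα hβ hy, zpow_natCast]
  have hxd : ∀ y : ℂ, y ≠ 0 → HasDerivAt x ((1 + -(y ^ 2)⁻¹) / 2) y := fun y hy =>
    (((hasDerivAt_id y).add (hasDerivAt_inv hy)).div_const 2)
  have hPd : ∀ (Q : ℝ[X]) (y : ℂ), y ≠ 0 → HasDerivAt (fun y => Polynomial.aeval (x y) Q)
      (Polynomial.aeval (x y) Q.derivative * ((1 + -(y ^ 2)⁻¹) / 2)) y := fun Q y hy =>
    HasDerivAt.comp y (Q.hasDerivAt_aeval (x y)) (hxd y hy)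
  have hd1 : ∀ y : ℂ, y ≠ 0 → HasDerivAt H (n * y ^ ((n : ℤ) - 1) * Polynomial.aeval (x y) P +
      y ^ (n : ℤ) * (Polynomial.aeval (x y) P.derivative * ((1 + -(y ^ 2)⁻¹) / 2))) y := by
    intro y hy
    have h1 := (hasDerivAt_zpow (n : ℤ) y (Or.inl hy)).mul (hPd P y hy)
    refine (h1.congr_of_eventuallyEq ?_).congr_deriv ?_
    · filter_upwards [isOpen_ne.mem_nhds hy] with w hw
      exact hHeq w hw
    · push_cast
      rfl
  have hd2 : HasDerivAt (deriv H)
      ((n * (((n : ℤ) - 1 : ℤ) * z ^ ((n : ℤ) - 1 - 1))) * Polynomial.aeval (x z) P +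
        n * z ^ ((n : ℤ) - 1) * (Polynomial.aeval (x z) P.derivative * ((1 + -(z ^ 2)⁻¹) / 2)) +
      (n * z ^ ((n : ℤ) - 1) * (Polynomial.aeval (x z) P.derivative * ((1 + -(z ^ 2)⁻¹) / 2)) +
      z ^ (n : ℤ) * (Polynomial.aeval (x z) P.derivative.derivative * ((1 + -(z ^ 2)⁻¹) / 2) *
        ((1 + -(z ^ 2)⁻¹) / 2) + Polynomial.aeval (x z) P.derivative *
          (-(-(2 * z) / (z ^ 2) ^ 2) / 2)))) z := by
    have hinv : HasDerivAt (fun y : ℂ => (1 + -(y ^ 2)⁻¹) / 2) (-(-(2 * z) / (z ^ 2) ^ 2) / 2) z := by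
      have h0 : HasDerivAt (fun y : ℂ => y ^ 2) (2 * z) z := by simpa using hasDerivAt_pow 2 z
      exact ((h0.inv (pow_ne_zero 2 hz)).neg.const_add 1).div_const 2
    have h1 := (((hasDerivAt_zpow ((n : ℤ) - 1) z (Or.inl hz)).const_mul (n : ℂ)).mul
      (hPd P z hz)).add ((hasDerivAt_zpow (n : ℤ) z (Or.inl hz)).mul
        ((hPd P.derivative z hz).mul hinv))
    refine (h1.congr_of_eventuallyEq ?_).congr_deriv ?_
    · filter_upwards [isOpen_ne.mem_nhds hz] with w hw
      exact (hd1 w hw).deriv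
    · simp only [Pi.mul_apply]
      push_cast
      ring
  have hode := congrArg (Polynomial.aeval (x z)) (jacobiDiff_jacobiPoly hα hβ n)
  simp only [jacobiDiff, map_add, map_mul, map_sub, map_neg, map_pow, map_one, Polynomial.aeval_X,
    Polynomial.aeval_C, Complex.coe_algebraMap, ← hP] at hode
  rw [hd2.deriv, (hd1 z hz).deriv, hHeq z hz]
  rw [zpow_sub_one₀ hz, zpow_sub_one₀ hz]
  set W := z ^ (n : ℤ)
  set P0 := Polynomial.aeval (x z) P
  set P1 := Polynomial.aeval (x z) P.derivative
  set P2 := Polynomial.aeval (x z) P.derivative.derivative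
  have hxz : x z = (z + z⁻¹) / 2 := rfl
  rw [hxz] at hode
  push_cast at hode ⊢
  clear_value W P0 P1 P2
  linear_combination (norm := (field_simp; ring)) ((z ^ 2 - 1) * W * z⁻¹) * hode

theorem one_sub_mem_slitPlane {z : ℂ} (hz : ‖z‖ < 1) : 1 - z ∈ Complex.slitPlane := by
  left
  have := (Complex.abs_re_le_norm z).trans_lt hz
  simp only [Complex.sub_re, Complex.one_re]
  linarith [(abs_lt.1 this).2]

theorem one_add_mem_slitPlane {z : ℂ} (hz : ‖z‖ < 1) : 1 + z ∈ Complex.slitPlane := by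
  have := one_sub_mem_slitPlane (z := -z) (by rwa [norm_neg])
  rwa [sub_neg_eq_add] at this

/-- The equation for `H_n` is only linear in `n`, because the factor `z^n` has absorbed the
quadratic eigenvalue. Divided by `n`, it loses its second-order term in the limit, since locally
uniform convergence of holomorphic functions extends to derivatives. -/
theorem jostFun_jacobi_ode {α β : ℝ} (hα : -1 < α) (hβ : -1 < β) {z : ℂ} (hz : ‖z‖ < 1) :
    (z ^ 2 - 1) * deriv (fun z => jostFun (jacobiA α β) (jacobiB α β) z / (1 - z ^ 2)) z +
      ((α + β + 1) * z - (β - α)) * (jostFun (jacobiA α β) (jacobiB α β) z / (1 - z ^ 2)) = 0 := by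
  obtain ⟨C, m, hCm⟩ := exists_nearFree_jacobi hα hβ
  set H := jostSeq (jacobiA α β) (jacobiB α β) with hH
  set L : ℂ → ℂ := fun z => jostFun (jacobiA α β) (jacobiB α β) z / (1 - z ^ 2) with hL
  have hlim : TendstoLocallyUniformlyOn (fun n z => H n z) L atTop (Metric.ball 0 1) :=
    hCm.tendstoLocallyUniformlyOn_jostSeq
  have hHd : ∀ n, Differentiable ℂ (H n) := differentiable_jostSeq _ _
  have hHd' : ∀ n, DifferentiableOn ℂ (deriv (H n)) (Metric.ball 0 1) := fun n =>
    (hHd n).differentiableOn.deriv Metric.isOpen_ball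
  have hlim1 := hlim.deriv (Eventually.of_forall fun n => (hHd n).differentiableOn)
    Metric.isOpen_ball
  have hlim2 := hlim1.deriv (Eventually.of_forall hHd') Metric.isOpen_ball
  have hLd : DifferentiableOn ℂ L (Metric.ball 0 1) :=
    hlim.differentiableOn (Eventually.of_forall fun n => (hHd n).differentiableOn)
      Metric.isOpen_ball
  have hpunct : ∀ w : ℂ, ‖w‖ < 1 → w ≠ 0 →
      (w ^ 2 - 1) * deriv L w + ((α + β + 1) * w - (β - α)) * L w = 0 := by
    intro w hw hw0
    have hwb : w ∈ Metric.ball (0 : ℂ) 1 := mem_ball_zero_iff.2 hw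
    have t0 := hlim.tendsto_at hwb
    have t1 := hlim1.tendsto_at hwb
    have t2 := hlim2.tendsto_at hwb
    have tn : Tendsto (fun n : ℕ => ((n : ℂ))⁻¹) atTop (𝓝 0) :=
      tendsto_inv_atTop_nhds_zero_nat (𝕜 := ℂ)
    have ht : Tendsto (fun n : ℕ => (w ^ 2 - 1) * (-((w * deriv (deriv (H n)) w + deriv (H n) w) *
        ((n : ℂ))⁻¹) + 2 * deriv (H n) w) + (2 * (β - α) * w - (α + β + 1) * (w ^ 2 + 1)) *
        (deriv (H n) w * ((n : ℂ))⁻¹) + (2 * (α + β + 1) * w - 2 * (β - α)) * H n w) atTop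
        (𝓝 ((w ^ 2 - 1) * (-((w * deriv (deriv L) w + deriv L w) * 0) + 2 * deriv L w) +
          (2 * (β - α) * w - (α + β + 1) * (w ^ 2 + 1)) * (deriv L w * 0) +
          (2 * (α + β + 1) * w - 2 * (β - α)) * L w)) := by
      refine ((((((t2.const_mul w).add t1).mul tn).neg.add (t1.const_mul 2)).const_mul _).add
        ((t1.mul tn).const_mul _)).add (t0.const_mul _)
    have hz : Tendsto (fun n : ℕ => (w ^ 2 - 1) * (-((w * deriv (deriv (H n)) w + deriv (H n) w) *
        ((n : ℂ))⁻¹) + 2 * deriv (H n) w) + (2 * (β - α) * w - (α + β + 1) * (w ^ 2 + 1)) *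
        (deriv (H n) w * ((n : ℂ))⁻¹) + (2 * (α + β + 1) * w - 2 * (β - α)) * H n w) atTop
        (𝓝 0) := by
      refine tendsto_const_nhds.congr' ?_
      filter_upwards [eventually_gt_atTop 0] with n hn
      have hn' : (n : ℂ) ≠ 0 := by exact_mod_cast hn.ne'
      have := jostSeq_jacobi_ode hα hβ hw0 n
      rw [← hH] at this
      linear_combination (norm := (field_simp; ring)) (-((n : ℂ))⁻¹) * this
    have := tendsto_nhds_unique ht hz
    linear_combination this / 2
  -- The substitution `2x = z + z⁻¹` excludes the origin; the equation extends there by continuity.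
  by_cases hz0 : z = 0
  · subst hz0
    have hLd' : ContinuousAt (deriv L) 0 :=
      ((hLd.deriv Metric.isOpen_ball).continuousOn).continuousAt
        (Metric.isOpen_ball.mem_nhds (by simp))
    have hLc : ContinuousAt L 0 :=
      hLd.continuousOn.continuousAt (Metric.isOpen_ball.mem_nhds (by simp))
    have hc : ContinuousAt (fun w : ℂ => (w ^ 2 - 1) * deriv L w +
        ((α + β + 1) * w - (β - α)) * L w) 0 := by fun_prop
    have h1 := hc.tendsto.mono_left (nhdsWithin_le_nhds (s := {(0 : ℂ)}ᶜ))
    refine tendsto_nhds_unique h1 (tendsto_const_nhds.congr' ?_)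
    filter_upwards [self_mem_nhdsWithin, mem_nhdsWithin_of_mem_nhds
      (Metric.ball_mem_nhds (0 : ℂ) one_pos)] with w hw hw1
    exact (hpunct w (mem_ball_zero_iff.1 hw1) hw).symm
  · exact hpunct z hz hz0

/-- Multiplying the limit of `H_n` by the reciprocal of the expected solution gives a function `Q`
whose derivative is zero by the first-order equation; on the disc it equals its value `c` at the
origin. -/
theorem exists_jostFun_jacobi_eq {α β : ℝ} (hα : -1 < α) (hβ : -1 < β) :
    ∃ c : ℝ, 0 ≤ c ∧ ∀ z : ℂ, ‖z‖ < 1 → jostFun (jacobiA α β) (jacobiB α β) z =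
      c * (1 - z) ^ ((1 / 2 - α : ℝ) : ℂ) * (1 + z) ^ ((1 / 2 - β : ℝ) : ℂ) := by
  obtain ⟨C, m, hCm⟩ := exists_nearFree_jacobi hα hβ
  obtain ⟨c, hc0, hc⟩ := hCm.jostFun_zero
  refine ⟨c, hc0, ?_⟩
  set D := jostFun (jacobiA α β) (jacobiB α β) with hD
  set L : ℂ → ℂ := fun z => D z / (1 - z ^ 2) with hL
  have hLd : DifferentiableOn ℂ L (Metric.ball 0 1) :=
    hCm.tendstoLocallyUniformlyOn_jostSeq.differentiableOn
      (Eventually.of_forall fun n => (differentiable_jostSeq _ _ n).differentiableOn)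
      Metric.isOpen_ball
  set Q : ℂ → ℂ := fun z => L z * ((1 - z) ^ ((α + 1 / 2 : ℝ) : ℂ) *
    (1 + z) ^ ((β + 1 / 2 : ℝ) : ℂ)) with hQ
  have hQd : ∀ z ∈ Metric.ball (0 : ℂ) 1, HasDerivAt Q 0 z := by
    intro z hz
    have hz1 : ‖z‖ < 1 := mem_ball_zero_iff.1 hz
    have hs1 := one_sub_mem_slitPlane hz1
    have hs2 := one_add_mem_slitPlane hz1
    have n1 := Complex.slitPlane_ne_zero hs1
    have n2 := Complex.slitPlane_ne_zero hs2
    have d0 := (hLd.differentiableAt (Metric.isOpen_ball.mem_nhds hz)).hasDerivAt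
    have d1 : HasDerivAt (fun z : ℂ => (1 - z) ^ ((α + 1 / 2 : ℝ) : ℂ))
        (((α + 1 / 2 : ℝ) : ℂ) * (1 - z) ^ (((α + 1 / 2 : ℝ) : ℂ) - 1) * (-1)) z :=
      ((hasDerivAt_id z).const_sub 1).cpow_const hs1
    have d2 : HasDerivAt (fun z : ℂ => (1 + z) ^ ((β + 1 / 2 : ℝ) : ℂ))
        (((β + 1 / 2 : ℝ) : ℂ) * (1 + z) ^ (((β + 1 / 2 : ℝ) : ℂ) - 1) * 1) z :=
      ((hasDerivAt_id z).const_add 1).cpow_const hs2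
    refine (d0.mul (d1.mul d2)).congr_deriv ?_
    have hode : (z ^ 2 - 1) * deriv L z + ((α + β + 1) * z - (β - α)) * L z = 0 :=
      jostFun_jacobi_ode hα hβ hz1
    rw [Complex.cpow_sub _ _ n1, Complex.cpow_sub _ _ n2, Complex.cpow_one, Complex.cpow_one]
    simp only [Pi.mul_apply]
    set X := (1 - z) ^ ((α + 1 / 2 : ℝ) : ℂ)
    set Y := (1 + z) ^ ((β + 1 / 2 : ℝ) : ℂ)
    push_cast
    linear_combination (norm := (field_simp; ring)) (-(X * Y / ((1 - z) * (1 + z)))) * hode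
  have hconst : ∀ z ∈ Metric.ball (0 : ℂ) 1, Q z = Q 0 := by
    intro z hz
    refine (convex_ball (0 : ℂ) 1).is_const_of_fderivWithin_eq_zero (𝕜 := ℂ)
      (fun y hy => (hQd y hy).differentiableAt.differentiableWithinAt) (fun y hy => ?_) hz
      (by simp)
    rw [fderivWithin_of_isOpen Metric.isOpen_ball hy]
    have := (hQd y hy).hasFDerivAt.fderiv
    rw [this]
    ext
    simp
  have hQ0 : Q 0 = c := by
    simp [hQ, hL, hc]
  intro z hz1
  have h1 := hconst z (mem_ball_zero_iff.2 hz1)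
  rw [hQ0] at h1
  have n1 := Complex.slitPlane_ne_zero (one_sub_mem_slitPlane hz1)
  have n2 := Complex.slitPlane_ne_zero (one_add_mem_slitPlane hz1)
  have e1 : (1 - z) ^ ((1 / 2 - α : ℝ) : ℂ) * (1 - z) ^ ((α + 1 / 2 : ℝ) : ℂ) = 1 - z := by
    rw [← Complex.cpow_add _ _ n1]
    push_cast
    ring_nf
    exact Complex.cpow_one _
  have e2 : (1 + z) ^ ((1 / 2 - β : ℝ) : ℂ) * (1 + z) ^ ((β + 1 / 2 : ℝ) : ℂ) = 1 + z := by
    rw [← Complex.cpow_add _ _ n2]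
    push_cast
    ring_nf
    exact Complex.cpow_one _
  have e3 : 1 - z ^ 2 = (1 - z) * (1 + z) := by ring
  have hLz : D z = L z * ((1 - z) * (1 + z)) := by
    simp only [hL]
    rw [e3]
    field_simp
  rw [hLz, ← h1]
  simp only [hQ]
  linear_combination -(L z * (1 + z)) * e1 - (L z * (1 - z) ^ ((1 / 2 - α : ℝ) : ℂ) * (1 - z) ^ ((α + 1 / 2 : ℝ) : ℂ)) * e2

/-! ### Boundary values on the unit circle -/

theorem ofReal_mul_exp_cpow {r φ : ℝ} (hr : 0 < r) (h1 : -Real.pi < φ) (h2 : φ ≤ Real.pi) (a : ℝ) :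
    ((r : ℂ) * Complex.exp (φ * Complex.I)) ^ (a : ℂ) =
      ((r ^ a : ℝ) : ℂ) * Complex.exp (((a * φ : ℝ) : ℂ) * Complex.I) := by
  have hne : (r : ℂ) * Complex.exp (φ * Complex.I) ≠ 0 :=
    mul_ne_zero (by exact_mod_cast hr.ne') (Complex.exp_ne_zero _)
  have e : (r : ℂ) * Complex.exp (φ * Complex.I) =
      Complex.exp ((Real.log r : ℝ) + φ * Complex.I) := by
    rw [Complex.exp_add, ← Complex.ofReal_exp, Real.exp_log hr]
  rw [Complex.cpow_def_of_ne_zero hne, e, Complex.log_exp (by simpa using h1) (by simpa using h2),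
    Real.rpow_def_of_pos hr, Complex.ofReal_exp, ← Complex.exp_add]
  congr 1
  push_cast
  ring

theorem one_sub_exp_eq (θ : ℝ) : 1 - Complex.exp (θ * Complex.I) =
    ((2 * Real.sin (θ / 2) : ℝ) : ℂ) * Complex.exp (((θ - Real.pi) / 2 : ℝ) * Complex.I) := by
  have h1 := Real.sin_sq_add_cos_sq (θ / 2)
  have hs : Real.sin θ = 2 * Real.sin (θ / 2) * Real.cos (θ / 2) := by
    rw [← Real.sin_two_mul]; ring_nf
  have hc : Real.cos θ = 2 * Real.cos (θ / 2) ^ 2 - 1 := by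
    rw [← Real.cos_two_mul]; ring_nf
  have e1 : Real.cos ((θ - Real.pi) / 2) = Real.sin (θ / 2) := by
    rw [sub_div, Real.cos_sub_pi_div_two]
  have e2 : Real.sin ((θ - Real.pi) / 2) = -Real.cos (θ / 2) := by
    rw [sub_div, Real.sin_sub_pi_div_two]
  apply Complex.ext
  · simp only [Complex.sub_re, Complex.one_re, Complex.exp_ofReal_mul_I_re, Complex.re_ofReal_mul]
    rw [e1, hc]
    linear_combination -2 * h1
  · simp only [Complex.sub_im, Complex.one_im, Complex.exp_ofReal_mul_I_im, Complex.im_ofReal_mul]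
    rw [e2, hs]
    ring

theorem one_add_exp_eq (θ : ℝ) : 1 + Complex.exp (θ * Complex.I) =
    ((2 * Real.cos (θ / 2) : ℝ) : ℂ) * Complex.exp ((θ / 2 : ℝ) * Complex.I) := by
  have hs : Real.sin θ = 2 * Real.sin (θ / 2) * Real.cos (θ / 2) := by
    rw [← Real.sin_two_mul]; ring_nf
  have hc : Real.cos θ = 2 * Real.cos (θ / 2) ^ 2 - 1 := by
    rw [← Real.cos_two_mul]; ring_nf
  apply Complex.ext
  · simp only [Complex.add_re, Complex.one_re, Complex.exp_ofReal_mul_I_re, Complex.re_ofReal_mul]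
    rw [hc]
    ring
  · simp only [Complex.add_im, Complex.one_im, Complex.exp_ofReal_mul_I_im, Complex.im_ofReal_mul]
    rw [hs]
    ring

theorem norm_one_sub_exp_sq {θ : ℝ} (h0 : 0 ≤ Real.sin θ) :
    ‖1 - Complex.exp (θ * Complex.I) ^ 2‖ = 2 * Real.sin θ := by
  rw [← Complex.exp_nat_mul]
  have : ((2 : ℕ) : ℂ) * (θ * Complex.I) = ((2 * θ : ℝ) : ℂ) * Complex.I := by push_cast; ring
  rw [this, one_sub_exp_eq, norm_mul, Complex.norm_exp_ofReal_mul_I, mul_one, Complex.norm_real,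
    mul_div_cancel_left₀ _ (two_ne_zero), Real.norm_of_nonneg (by positivity)]

/-- Boundary values of the Jost function on the unit circle. -/
theorem jostFun_jacobi_exp {α β : ℝ} (hα : -1 < α) (hβ : -1 < β) {c : ℝ}
    (hc : ∀ z : ℂ, ‖z‖ < 1 → jostFun (jacobiA α β) (jacobiB α β) z =
      c * (1 - z) ^ ((1 / 2 - α : ℝ) : ℂ) * (1 + z) ^ ((1 / 2 - β : ℝ) : ℂ))
    {θ : ℝ} (h0 : 0 < θ) (hpi : θ < Real.pi) :
    jostFun (jacobiA α β) (jacobiB α β) (Complex.exp (θ * Complex.I)) =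
      ((c * (2 * Real.sin (θ / 2)) ^ (1 / 2 - α) * (2 * Real.cos (θ / 2)) ^ (1 / 2 - β) : ℝ) : ℂ) *
      Complex.exp (((1 / 2 - α) * ((θ - Real.pi) / 2) + (1 / 2 - β) * (θ / 2) : ℝ) *
        Complex.I) := by
  obtain ⟨C, m, hCm⟩ := exists_nearFree_jacobi hα hβ
  set w := Complex.exp (θ * Complex.I) with hw
  have hsin : 0 < Real.sin θ := Real.sin_pos_of_pos_of_lt_pi h0 hpi
  have hS : 0 < Real.sin (θ / 2) := Real.sin_pos_of_pos_of_lt_pi (by linarith) (by linarith)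
  have hC : 0 < Real.cos (θ / 2) := Real.cos_pos_of_mem_Ioo ⟨by linarith, by linarith⟩
  have hwn : ‖w‖ = 1 := Complex.norm_exp_ofReal_mul_I θ
  have hw2 : ‖1 - w ^ 2‖ = 2 * Real.sin θ := norm_one_sub_exp_sq hsin.le
  set p : ℝ → ℂ := fun r => r * w with hp
  have hpc : Continuous p := by fun_prop
  have hp1 : p 1 = w := by simp [hp]
  have hpt : Tendsto p (𝓝[<] 1) (𝓝 w) := by
    have := hpc.tendsto 1
    rw [hp1] at this
    exact this.mono_left nhdsWithin_le_nhds
  have hev : ∀ᶠ r : ℝ in 𝓝[<] 1, ‖p r‖ < 1 := by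
    filter_upwards [Ioo_mem_nhdsLT (zero_lt_one (α := ℝ))] with r hr
    rw [hp, norm_mul, hwn, Complex.norm_real, Real.norm_of_nonneg hr.1.le, mul_one]
    exact hr.2
  have hev2 : ∀ᶠ r : ℝ in 𝓝[<] 1, Real.sin θ < ‖1 - p r ^ 2‖ := by
    have : Tendsto (fun r => ‖1 - p r ^ 2‖) (𝓝[<] 1) (𝓝 ‖1 - w ^ 2‖) :=
      ((hpt.pow 2).const_sub 1).norm
    refine this.eventually_const_lt ?_
    rw [hw2]
    linarith
  -- The threshold `sin θ` is half of `|1 - w²|`, so `w` and the points `r w` with `r < 1` close to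
  -- `1` lie in one region of continuity, and the formula inside the disc passes to the limit along
  -- the radius.
  have hcont := hCm.continuousOn_jostFun hsin w ⟨hwn.le, by rw [hw2]; linarith⟩
  have t1 : Tendsto (fun r => jostFun (jacobiA α β) (jacobiB α β) (p r)) (𝓝[<] 1)
      (𝓝 (jostFun (jacobiA α β) (jacobiB α β) w)) := by
    refine hcont.tendsto.comp (tendsto_nhdsWithin_iff.2 ⟨hpt, ?_⟩)
    filter_upwards [hev, hev2] with r h1 h2
    exact ⟨h1.le, h2.le⟩
  have hs1 : 1 - w ∈ Complex.slitPlane := by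
    left
    rw [hw]
    simp only [Complex.sub_re, Complex.one_re, Complex.exp_ofReal_mul_I_re]
    have := Real.sin_sq_add_cos_sq θ
    nlinarith
  have hs2 : 1 + w ∈ Complex.slitPlane := by
    left
    rw [hw]
    simp only [Complex.add_re, Complex.one_re, Complex.exp_ofReal_mul_I_re]
    have := Real.sin_sq_add_cos_sq θ
    nlinarith
  have t2 : Tendsto (fun r => (c : ℂ) * (1 - p r) ^ ((1 / 2 - α : ℝ) : ℂ) *
      (1 + p r) ^ ((1 / 2 - β : ℝ) : ℂ)) (𝓝[<] 1)
      (𝓝 (c * (1 - w) ^ ((1 / 2 - α : ℝ) : ℂ) * (1 + w) ^ ((1 / 2 - β : ℝ) : ℂ))) := by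
    refine (Tendsto.const_mul _ ?_).mul ?_
    · exact (hpt.const_sub 1).cpow tendsto_const_nhds hs1
    · exact (hpt.const_add 1).cpow tendsto_const_nhds hs2
  have h3 := tendsto_nhds_unique t1 (t2.congr' (by
    filter_upwards [hev] with r hr
    exact (hc _ hr).symm))
  rw [h3, hw, one_sub_exp_eq, one_add_exp_eq,
    ofReal_mul_exp_cpow (by positivity) (by linarith) (by linarith),
    ofReal_mul_exp_cpow (by positivity) (by linarith) (by linarith)]
  push_cast
  rw [add_mul, Complex.exp_add]
  ring

/-! ### Asymptotics of the orthonormal polynomials up to a constant -/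

/-- At `z = e^{iθ}` the product on the right is `G_{n+1} - e^{iθ} G_n` with real `G_n` and
`G_{n+1}`, so its imaginary part isolates `G_n`. -/
theorem jacobiPoly_eval_cos_mul_sin {α β : ℝ} (hα : -1 < α) (hβ : -1 < β) (n : ℕ) (θ : ℝ) :
    (jacobiPoly α β n).eval (Real.cos θ) * Real.sin θ =
      -(jostD (jacobiA α β) (jacobiB α β) n (Complex.exp (θ * Complex.I)) *
        Complex.exp (-((n + 1) * θ : ℝ) * Complex.I)).im := by
  set w := Complex.exp (θ * Complex.I) with hw
  have hw0 : w ≠ 0 := Complex.exp_ne_zero _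
  have hcos : (w + w⁻¹) / 2 = ((Real.cos θ : ℝ) : ℂ) := by
    rw [hw, ← Complex.exp_neg, Complex.ofReal_cos, Complex.cos, neg_mul]
  have hH : ∀ k, jostSeq (jacobiA α β) (jacobiB α β) k w =
      w ^ k * (((jacobiPoly α β k).eval (Real.cos θ) : ℝ) : ℂ) := by
    intro k
    rw [jostSeq_jacobi_eq hα hβ hw0, hcos, ← Complex.coe_algebraMap,
      Polynomial.aeval_algebraMap_apply]
    simp
  have hinv : Complex.exp (-((n + 1) * θ : ℝ) * Complex.I) * w ^ (n + 1) = 1 := by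
    rw [hw, ← Complex.exp_nat_mul, ← Complex.exp_add]
    push_cast
    rw [← Complex.exp_zero]
    congr 1
    ring
  have e : jostD (jacobiA α β) (jacobiB α β) n w * Complex.exp (-((n + 1) * θ : ℝ) * Complex.I) =
      (((jacobiPoly α β (n + 1)).eval (Real.cos θ) : ℝ) : ℂ) -
      (((jacobiPoly α β n).eval (Real.cos θ) : ℝ) : ℂ) * w := by
    unfold jostD
    rw [hH, hH]
    linear_combination ((((jacobiPoly α β (n + 1)).eval (Real.cos θ) : ℝ) : ℂ) -
      (((jacobiPoly α β n).eval (Real.cos θ) : ℝ) : ℂ) * w) * hinv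
  rw [e, Complex.sub_im, Complex.ofReal_im, Complex.im_ofReal_mul, hw, Complex.exp_ofReal_mul_I_im]
  ring

theorem sqrt_mul_rpow_identity {k q S T : ℝ} (hk : 0 < k) (hq : 0 < q) (hS : 0 < S) (hT : 0 < T)
    (α β : ℝ) :
    √(k * ((q * S ^ 2) ^ α * (q * T ^ 2) ^ β)) * ((q * S) ^ (1 / 2 - α) * (q * T) ^ (1 / 2 - β)) /
      (q * S * T) = √k * q ^ ((1 - (α + β)) / 2) * (q * S * T) ^ (-1 / 2 : ℝ) := by
  obtain ⟨s, rfl⟩ : ∃ s, Real.exp s = S := ⟨Real.log S, Real.exp_log hS⟩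
  obtain ⟨t, rfl⟩ : ∃ t, Real.exp t = T := ⟨Real.log T, Real.exp_log hT⟩
  obtain ⟨r, rfl⟩ : ∃ r, Real.exp r = q := ⟨Real.log q, Real.exp_log hq⟩
  rw [Real.sqrt_mul hk.le, mul_assoc (√k), mul_div_assoc (√k), mul_assoc (√k)]
  congr 1
  simp only [← Real.exp_add, ← Real.exp_nat_mul, ← Real.exp_mul, Real.sqrt_eq_rpow,
    ← Real.exp_sub]
  congr 1
  push_cast
  ring

/-- The root of the weight cancels the `α`- and `β`-dependent powers in the modulus of the Jost
function; only `(sin θ)^{-1/2}` and a constant remain. -/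
theorem sqrt_jacobiDensity_cos {α β : ℝ} (hα : -1 < α) (hβ : -1 < β) {θ : ℝ} (h0 : 0 < θ)
    (hpi : θ < Real.pi) :
    √(jacobiDensity α β (Real.cos θ)) * ((2 * Real.sin (θ / 2)) ^ (1 / 2 - α) *
      (2 * Real.cos (θ / 2)) ^ (1 / 2 - β)) / Real.sin θ =
      √(jacobiConst α β) * 2 ^ ((1 - (α + β)) / 2) * Real.sin θ ^ (-1 / 2 : ℝ) := by
  have hS : 0 < Real.sin (θ / 2) := Real.sin_pos_of_pos_of_lt_pi (by linarith) (by linarith)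
  have hC : 0 < Real.cos (θ / 2) := Real.cos_pos_of_mem_Ioo ⟨by linarith, by linarith⟩
  have h1 := Real.sin_sq_add_cos_sq (θ / 2)
  have hs : Real.sin θ = 2 * Real.sin (θ / 2) * Real.cos (θ / 2) := by
    rw [← Real.sin_two_mul]; ring_nf
  have hc : Real.cos θ = 2 * Real.cos (θ / 2) ^ 2 - 1 := by
    rw [← Real.cos_two_mul]; ring_nf
  have e1 : 1 - Real.cos θ = 2 * Real.sin (θ / 2) ^ 2 := by rw [hc]; linear_combination -2 * h1
  have e2 : 1 + Real.cos θ = 2 * Real.cos (θ / 2) ^ 2 := by rw [hc]; ring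
  have hk := jacobiConst_pos hα hβ
  unfold jacobiDensity jacobiWeight
  rw [e1, e2, hs]
  exact sqrt_mul_rpow_identity hk two_pos hS hC α β

/-- The Jost function replaces `D_n` at the cost `B/(n + 1)`, and its boundary phase combines with
`e^{-i(n+1)θ}` into the stated cosine. The value of `A` stays open here because `c` is not known. -/
theorem exists_jacobi_asymptotics {α β : ℝ} (hα : -1 < α) (hβ : -1 < β) :
    ∃ A : ℝ, 0 ≤ A ∧ ∀ ε > 0, ∃ B : ℝ, 0 ≤ B ∧ ∀ n : ℕ, ∀ θ ∈ Icc ε (Real.pi - ε),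
      |√(jacobiDensity α β (Real.cos θ)) * (jacobiPoly α β n).eval (Real.cos θ) -
        A * Real.sin θ ^ (-1 / 2 : ℝ) *
          Real.cos ((n + (α + β + 1) / 2) * θ - (2 * α + 1) * Real.pi / 4)| ≤ B / ((n : ℝ) + 1) := by
  obtain ⟨c, hc0, hc⟩ := exists_jostFun_jacobi_eq hα hβ
  obtain ⟨C, m, hCm⟩ := exists_nearFree_jacobi hα hβ
  refine ⟨c * (√(jacobiConst α β) * 2 ^ ((1 - (α + β)) / 2)), by positivity, fun ε hε => ?_⟩
  -- For `ε > π/2` the interval is empty.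
  rcases lt_or_ge (Real.pi / 2) ε with hε2 | hε2
  · refine ⟨0, le_rfl, fun n θ hθ => ?_⟩
    have := hθ.1.trans hθ.2
    linarith
  have hsε : 0 < Real.sin ε := Real.sin_pos_of_pos_of_lt_pi hε (by linarith)
  have hsin : ∀ θ ∈ Icc ε (Real.pi - ε), Real.sin ε ≤ Real.sin θ := by
    intro θ hθ
    rcases le_total θ (Real.pi / 2) with h | h
    · exact Real.sin_le_sin_of_le_of_le_pi_div_two (by linarith) h hθ.1
    · rw [← Real.sin_pi_sub θ]
      exact Real.sin_le_sin_of_le_of_le_pi_div_two (by linarith) (by linarith)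
        (by linarith [hθ.2])
  obtain ⟨B, hB, hb⟩ := hCm.exists_jostD_bound hsε
  have hcos : ∀ θ ∈ Icc ε (Real.pi - ε), Real.cos θ ∈ Ioo (-1 : ℝ) 1 := by
    intro θ hθ
    have h1 := hsin θ hθ
    have h2 := Real.sin_sq_add_cos_sq θ
    constructor <;> nlinarith
  have hcont : ContinuousOn (fun θ => √(jacobiDensity α β (Real.cos θ)) / Real.sin θ)
      (Icc ε (Real.pi - ε)) := by
    refine ContinuousOn.div (Real.continuous_sqrt.comp_continuousOn ?_)
      Real.continuous_sin.continuousOn (fun θ hθ => (hsε.trans_le (hsin θ hθ)).ne')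
    unfold jacobiDensity jacobiWeight
    refine continuousOn_const.mul (ContinuousOn.mul ?_ ?_)
    · exact ContinuousOn.rpow_const (by fun_prop) fun θ hθ =>
        Or.inl (by linarith [(hcos θ hθ).2])
    · exact ContinuousOn.rpow_const (by fun_prop) fun θ hθ =>
        Or.inl (by linarith [(hcos θ hθ).1])
  obtain ⟨M, hM⟩ := isCompact_Icc.exists_bound_of_continuousOn hcont
  refine ⟨|M| * B, by positivity, fun n θ hθ => ?_⟩
  have hθ0 : 0 < θ := hε.trans_le hθ.1
  have hθpi : θ < Real.pi := by linarith [hθ.2]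
  have hsθ : 0 < Real.sin θ := hsε.trans_le (hsin θ hθ)
  set w := Complex.exp (θ * Complex.I) with hw
  set D := jostFun (jacobiA α β) (jacobiB α β) w with hD
  set E := Complex.exp (-((n + 1) * θ : ℝ) * Complex.I) with hE
  have hEn : ‖E‖ = 1 := by
    have : E = Complex.exp ((-((n + 1) * θ) : ℝ) * Complex.I) := by rw [hE]; push_cast; ring_nf
    rw [this, Complex.norm_exp_ofReal_mul_I]
  have hmain : c * (√(jacobiConst α β) * 2 ^ ((1 - (α + β)) / 2)) * Real.sin θ ^ (-1 / 2 : ℝ) *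
      Real.cos ((n + (α + β + 1) / 2) * θ - (2 * α + 1) * Real.pi / 4) =
      √(jacobiDensity α β (Real.cos θ)) / Real.sin θ * -(D * E).im := by
    have e1 : D * E = ((c * (2 * Real.sin (θ / 2)) ^ (1 / 2 - α) *
        (2 * Real.cos (θ / 2)) ^ (1 / 2 - β) : ℝ) : ℂ) *
        Complex.exp ((-((n + (α + β + 1) / 2) * θ + Real.pi / 4 - α * Real.pi / 2) : ℝ) *
          Complex.I) := by
      rw [hD, hw, jostFun_jacobi_exp hα hβ hc hθ0 hθpi, hE, mul_assoc, ← Complex.exp_add]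
      congr 2
      push_cast
      ring
    rw [e1, Complex.im_ofReal_mul, Complex.exp_ofReal_mul_I_im, Real.sin_neg]
    have e2 : Real.cos ((n + (α + β + 1) / 2) * θ - (2 * α + 1) * Real.pi / 4) =
        Real.sin ((n + (α + β + 1) / 2) * θ + Real.pi / 4 - α * Real.pi / 2) := by
      rw [← Real.cos_pi_div_two_sub, ← Real.cos_neg]
      congr 1
      ring
    rw [e2]
    have := sqrt_jacobiDensity_cos hα hβ hθ0 hθpi
    linear_combination (-c * Real.sin ((n + (α + β + 1) / 2) * θ + Real.pi / 4 - α * Real.pi / 2)) *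
      this
  have hpoly : √(jacobiDensity α β (Real.cos θ)) * (jacobiPoly α β n).eval (Real.cos θ) =
      √(jacobiDensity α β (Real.cos θ)) / Real.sin θ *
        -(jostD (jacobiA α β) (jacobiB α β) n w * E).im := by
    have := jacobiPoly_eval_cos_mul_sin hα hβ n θ
    rw [hw, hE, ← this]
    field_simp
  rw [hmain, hpoly, ← mul_sub, abs_mul]
  have hb1 := hb w (Complex.norm_exp_ofReal_mul_I θ).le (by
    rw [hw, norm_one_sub_exp_sq hsθ.le]
    linarith [hsin θ hθ]) n
  have h5 : |-(jostD (jacobiA α β) (jacobiB α β) n w * E).im - -(D * E).im| ≤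
      B / ((n : ℝ) + 1) := by
    have : -(jostD (jacobiA α β) (jacobiB α β) n w * E).im - -(D * E).im =
        -((jostD (jacobiA α β) (jacobiB α β) n w - D) * E).im := by
      rw [sub_mul, Complex.sub_im]
      ring
    rw [this, abs_neg]
    refine (Complex.abs_im_le_norm _).trans ?_
    rwa [norm_mul, hEn, mul_one]
  have h6 : |√(jacobiDensity α β (Real.cos θ)) / Real.sin θ| ≤ |M| :=
    (hM θ hθ).trans (le_abs_self M)
  calc _ ≤ |M| * (B / ((n : ℝ) + 1)) := by gcongr
    _ = _ := by ring

/-! ### Oscillatory integrals -/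

/-- Non-stationary phase with a convex phase function. -/
theorem norm_integral_exp_mul_le {φ φ' φ'' : ℝ → ℝ} {a a' : ℝ → ℂ} {c d μ A V : ℝ} (hcd : c ≤ d)
    (hφ : ∀ x ∈ Icc c d, HasDerivAt φ (φ' x) x)
    (hφ' : ∀ x ∈ Icc c d, HasDerivAt φ' (φ'' x) x)
    (hφc : ContinuousOn φ'' (Icc c d)) (hφ0 : ∀ x ∈ Icc c d, 0 ≤ φ'' x) (hμ : 0 < μ)
    (hφμ : ∀ x ∈ Icc c d, μ ≤ |φ' x|)
    (ha : ∀ x ∈ Icc c d, HasDerivAt a (a' x) x) (hac : ContinuousOn a' (Icc c d))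
    (hA : ∀ x ∈ Icc c d, ‖a x‖ ≤ A) (hV : ∫ x in c..d, ‖a' x‖ ≤ V) :
    ‖∫ x in c..d, Complex.exp (Complex.I * φ x) * a x‖ ≤ (4 * A + V) / μ := by
  have hu : uIcc c d = Icc c d := uIcc_of_le hcd
  have hne : ∀ x ∈ Icc c d, φ' x ≠ 0 := fun x hx => abs_pos.1 (hμ.trans_le (hφμ x hx))
  have hneC : ∀ x ∈ Icc c d, (φ' x : ℂ) ≠ 0 := fun x hx => by exact_mod_cast hne x hx
  have hφ'c : ContinuousOn φ' (Icc c d) := fun x hx => (hφ' x hx).continuousAt.continuousWithinAt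
  have hφcc : ContinuousOn φ (Icc c d) := fun x hx => (hφ x hx).continuousAt.continuousWithinAt
  have hacc : ContinuousOn a (Icc c d) := fun x hx => (ha x hx).continuousAt.continuousWithinAt
  have hA0 : 0 ≤ A := (norm_nonneg _).trans (hA c (left_mem_Icc.2 hcd))
  set u : ℝ → ℂ := fun x => a x / (Complex.I * φ' x) with hudef
  set u' : ℝ → ℂ := fun x => a' x / (Complex.I * φ' x) -
    a x * φ'' x / (Complex.I * φ' x ^ 2) with hu'def
  set v : ℝ → ℂ := fun x => Complex.exp (Complex.I * φ x) with hvdef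
  set v' : ℝ → ℂ := fun x => Complex.exp (Complex.I * φ x) * (Complex.I * φ' x) with hv'def
  have hvd : ∀ x ∈ uIcc c d, HasDerivAt v (v' x) x := by
    intro x hx
    rw [hu] at hx
    exact (((hφ x hx).ofReal_comp).const_mul Complex.I).cexp
  have hud : ∀ x ∈ uIcc c d, HasDerivAt u (u' x) x := by
    intro x hx
    rw [hu] at hx
    have h1 := (ha x hx).div (((hφ' x hx).ofReal_comp).const_mul Complex.I)
      (mul_ne_zero Complex.I_ne_zero (hneC x hx))
    refine h1.congr_deriv ?_
    have := hneC x hx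
    simp only [hu'def]
    field_simp [Complex.I_ne_zero]
  have hv'c : ContinuousOn v' (Icc c d) := by
    have h1 : ContinuousOn (fun x => (φ x : ℂ)) (Icc c d) :=
      Complex.continuous_ofReal.comp_continuousOn hφcc
    have h2 : ContinuousOn (fun x => (φ' x : ℂ)) (Icc c d) :=
      Complex.continuous_ofReal.comp_continuousOn hφ'c
    exact (Complex.continuous_exp.comp_continuousOn (continuousOn_const.mul h1)).mul
      (continuousOn_const.mul h2)
  have hu'c : ContinuousOn u' (Icc c d) := by
    have h1 : ContinuousOn (fun x => (φ'' x : ℂ)) (Icc c d) :=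
      Complex.continuous_ofReal.comp_continuousOn hφc
    have h2 : ContinuousOn (fun x => (φ' x : ℂ)) (Icc c d) :=
      Complex.continuous_ofReal.comp_continuousOn hφ'c
    refine (hac.div (continuousOn_const.mul h2) fun x hx =>
      mul_ne_zero Complex.I_ne_zero (hneC x hx)).sub ((hacc.mul h1).div
        (continuousOn_const.mul (h2.pow 2)) fun x hx =>
          mul_ne_zero Complex.I_ne_zero (pow_ne_zero 2 (hneC x hx)))
  have hibp := intervalIntegral.integral_mul_deriv_eq_deriv_mul hud hvd
    (hu'c.intervalIntegrable_of_Icc hcd) (hv'c.intervalIntegrable_of_Icc hcd)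
  have hlhs : ∫ x in c..d, Complex.exp (Complex.I * φ x) * a x = ∫ x in c..d, u x * v' x := by
    refine intervalIntegral.integral_congr fun x hx => ?_
    rw [hu] at hx
    have := hneC x hx
    simp only [hudef, hv'def]
    field_simp [Complex.I_ne_zero]
  have hvn : ∀ x, ‖v x‖ = 1 := fun x => by
    simp only [hvdef]
    rw [mul_comm, Complex.norm_exp_ofReal_mul_I]
  have hun : ∀ x ∈ Icc c d, ‖u x‖ ≤ A / μ := by
    intro x hx
    simp only [hudef]
    rw [norm_div, norm_mul, Complex.norm_I, one_mul, Complex.norm_real, Real.norm_eq_abs]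
    exact div_le_div₀ hA0 (hA x hx) hμ (hφμ x hx)
  have hu'n : ∀ x ∈ Icc c d, ‖u' x * v x‖ ≤ μ⁻¹ * ‖a' x‖ + A * (φ'' x / φ' x ^ 2) := by
    intro x hx
    rw [norm_mul, hvn, mul_one]
    refine (norm_sub_le _ _).trans (add_le_add ?_ ?_)
    · rw [norm_div, norm_mul, Complex.norm_I, one_mul, Complex.norm_real, Real.norm_eq_abs,
        div_eq_inv_mul]
      exact mul_le_mul_of_nonneg_right (inv_anti₀ hμ (hφμ x hx)) (norm_nonneg _)
    · rw [norm_div, norm_mul, norm_mul, Complex.norm_I, one_mul, norm_pow, Complex.norm_real,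
        Complex.norm_real, Real.norm_of_nonneg (hφ0 x hx), Real.norm_eq_abs, sq_abs, mul_div_assoc]
      have := hφ0 x hx
      gcongr
      exact hA x hx
  have hφdiv : ContinuousOn (fun x => φ'' x / φ' x ^ 2) (Icc c d) :=
    hφc.div (hφ'c.pow 2) fun x hx => pow_ne_zero 2 (hne x hx)
  -- Convexity is used here: `φ'' / φ'²` is nonnegative and is the derivative of `-1/φ'`, so its
  -- integral is at most `2/μ`, whatever the size of `φ''` or the length of the interval.
  have hftc : ∫ x in c..d, φ'' x / φ' x ^ 2 = (φ' c)⁻¹ - (φ' d)⁻¹ := by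
    have := intervalIntegral.integral_eq_sub_of_hasDerivAt (f := fun x => -(φ' x)⁻¹)
      (f' := fun x => φ'' x / φ' x ^ 2) (a := c) (b := d) (fun x hx => by
        rw [hu] at hx
        refine ((hφ' x hx).inv (hne x hx)).neg.congr_deriv ?_
        rw [neg_div, neg_neg]) (hφdiv.intervalIntegrable_of_Icc hcd)
    rw [this]
    ring
  have hinv : ∀ x ∈ Icc c d, |(φ' x)⁻¹| ≤ μ⁻¹ := fun x hx => by
    rw [abs_inv]
    exact inv_anti₀ hμ (hφμ x hx)
  have i1 : IntervalIntegrable (fun x => μ⁻¹ * ‖a' x‖) volume c d :=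
    (continuousOn_const.mul hac.norm).intervalIntegrable_of_Icc hcd
  have i2 : IntervalIntegrable (fun x => A * (φ'' x / φ' x ^ 2)) volume c d :=
    (continuousOn_const.mul hφdiv).intervalIntegrable_of_Icc hcd
  have hint : ‖∫ x in c..d, u' x * v x‖ ≤ μ⁻¹ * V + A * (2 * μ⁻¹) := by
    refine (intervalIntegral.norm_integral_le_of_norm_le hcd
      (ae_of_all _ fun x hx => hu'n x (Ioc_subset_Icc_self hx)) (i1.add i2)).trans ?_
    rw [intervalIntegral.integral_add i1 i2, intervalIntegral.integral_const_mul,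
      intervalIntegral.integral_const_mul, hftc]
    have h1 := (abs_le.1 (hinv c (left_mem_Icc.2 hcd))).2
    have h2 := (abs_le.1 (hinv d (right_mem_Icc.2 hcd))).1
    have : (φ' c)⁻¹ - (φ' d)⁻¹ ≤ 2 * μ⁻¹ := by linarith
    gcongr
  rw [hlhs, hibp]
  have h1 : ‖u d * v d‖ ≤ A / μ := by
    rw [norm_mul, hvn, mul_one]; exact hun d (right_mem_Icc.2 hcd)
  have h2 : ‖u c * v c‖ ≤ A / μ := by
    rw [norm_mul, hvn, mul_one]; exact hun c (left_mem_Icc.2 hcd)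
  calc _ ≤ ‖u d * v d‖ + ‖u c * v c‖ + ‖∫ x in c..d, u' x * v x‖ :=
        (norm_sub_le _ _).trans (add_le_add_left (norm_sub_le _ _) _)
    _ ≤ A / μ + A / μ + (μ⁻¹ * V + A * (2 * μ⁻¹)) := by gcongr
    _ = _ := by
      field_simp
      ring

/-- The damping `e^{-εx²}` is treated as an amplitude. It is at most `1` and decreasing on `[δ, R]`,
so its variation is at most `1` and the bound depends neither on `ε` nor on `R`. -/
theorem norm_integral_gaussian_tail_le {κ δ R ε : ℝ} (hκ : 0 < κ) (hδ : 0 < δ) (hR : δ ≤ R)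
    (hε : 0 ≤ ε) :
    ‖∫ x in δ..R, Complex.exp (-(ε - Complex.I * (κ / 2)) * x ^ 2)‖ ≤ 5 / (κ * δ) := by
  have h := norm_integral_exp_mul_le (φ := fun x => κ / 2 * x ^ 2) (φ' := fun x => κ * x)
    (φ'' := fun _ => κ) (a := fun x => ((Real.exp (-ε * x ^ 2) : ℝ) : ℂ))
    (a' := fun x => ((Real.exp (-ε * x ^ 2) * (-ε * (2 * x)) : ℝ) : ℂ)) (c := δ) (d := R)
    (μ := κ * δ) (A := 1) (V := 1) hR
    (fun x _ => by
      refine ((hasDerivAt_pow 2 x).const_mul (κ / 2)).congr_deriv ?_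
      push_cast
      ring)
    (fun x _ => by simpa using (hasDerivAt_id x).const_mul κ)
    continuousOn_const (fun _ _ => hκ.le) (by positivity)
    (fun x hx => by
      rw [abs_of_nonneg (mul_nonneg hκ.le (hδ.le.trans hx.1))]
      exact mul_le_mul_of_nonneg_left hx.1 hκ.le)
    (fun x _ => by
      refine HasDerivAt.ofReal_comp ?_
      refine ((hasDerivAt_pow 2 x).const_mul (-ε)).exp.congr_deriv ?_
      push_cast
      ring)
    (Continuous.continuousOn (by fun_prop))
    (fun x _ => by
      rw [Complex.norm_real, Real.norm_of_nonneg (Real.exp_pos _).le, Real.exp_le_one_iff]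
      nlinarith [sq_nonneg x])
    (by
      have e : ∫ x in δ..R, ‖((Real.exp (-ε * x ^ 2) * (-ε * (2 * x)) : ℝ) : ℂ)‖ =
          ∫ x in δ..R, -(Real.exp (-ε * x ^ 2) * (-ε * (2 * x))) := by
        refine intervalIntegral.integral_congr fun x hx => ?_
        rw [uIcc_of_le hR] at hx
        have hx0 : 0 ≤ x := hδ.le.trans hx.1
        have : Real.exp (-ε * x ^ 2) * (-ε * (2 * x)) ≤ 0 := by
          have : 0 ≤ Real.exp (-ε * x ^ 2) * (ε * (2 * x)) := by positivity
          linarith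
        simp only [Complex.norm_real, Real.norm_eq_abs]
        rw [abs_of_nonpos this]
      rw [e, intervalIntegral.integral_neg, intervalIntegral.integral_eq_sub_of_hasDerivAt
        (f := fun x => Real.exp (-ε * x ^ 2))]
      · have h1 : Real.exp (-ε * δ ^ 2) ≤ 1 := by
          rw [Real.exp_le_one_iff]
          nlinarith [sq_nonneg δ]
        have h2 := Real.exp_pos (-ε * R ^ 2)
        linarith
      · intro x _
        refine ((hasDerivAt_pow 2 x).const_mul (-ε)).exp.congr_deriv ?_
        push_cast
        ring
      · exact Continuous.intervalIntegrable (by fun_prop) _ _)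
  norm_num at h
  convert h using 2
  · refine intervalIntegral.integral_congr fun x _ => ?_
    rw [← Complex.exp_add]
    congr 1
    ring

/-- The truncated Fresnel integral. -/
theorem norm_integral_fresnel_sub_le {κ δ : ℝ} (hκ : 0 < κ) (hδ : 0 < δ) :
    ‖(∫ x in (-δ)..δ, Complex.exp (Complex.I * (κ / 2 * x ^ 2 : ℝ))) -
      √(2 * Real.pi / κ) * Complex.exp (Complex.I * (Real.pi / 4 : ℝ))‖ ≤ 10 / (κ * δ) := by
  have hint : ∀ ε : ℝ, Continuous fun x : ℝ => Complex.exp (-(ε - Complex.I * (κ / 2)) * x ^ 2) :=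
    fun ε => by fun_prop
  -- With damping `ε > 0` the full Gaussian integral is known and the two tails are bounded
  -- uniformly in `ε`; afterwards `ε → 0`.
  have hε : ∀ ε : ℝ, 0 < ε → ‖(∫ x in (-δ)..δ, Complex.exp (-(ε - Complex.I * (κ / 2)) * x ^ 2)) -
      (Real.pi / (ε - Complex.I * (κ / 2))) ^ (1 / 2 : ℂ)‖ ≤ 10 / (κ * δ) := by
    intro ε hε
    have hre : 0 < (ε - Complex.I * (κ / 2) : ℂ).re := by
      have : (Complex.I * (κ / 2) : ℂ) = ((κ / 2 : ℝ) : ℂ) * Complex.I := by push_cast; ring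
      rw [this]
      simpa using hε
    have hg := integral_gaussian_complex hre
    have ht := intervalIntegral_tendsto_integral (μ := volume)
      (integrable_cexp_neg_mul_sq hre) tendsto_neg_atTop_atBot (tendsto_id (α := ℝ))
    rw [hg] at ht
    refine le_of_tendsto (ht.const_sub _).norm ?_
    filter_upwards [eventually_ge_atTop δ] with R hR
    have i := fun p q => (hint ε).intervalIntegrable (μ := volume) p q
    have hsplit : (∫ x in (-δ)..δ, Complex.exp (-(ε - Complex.I * (κ / 2)) * x ^ 2)) -
        (∫ x in (-R)..R, Complex.exp (-(ε - Complex.I * (κ / 2)) * x ^ 2)) =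
        -((∫ x in (-R)..(-δ), Complex.exp (-(ε - Complex.I * (κ / 2)) * x ^ 2)) +
        (∫ x in δ..R, Complex.exp (-(ε - Complex.I * (κ / 2)) * x ^ 2))) := by
      rw [← intervalIntegral.integral_add_adjacent_intervals (i (-R) (-δ)) (i (-δ) R),
        ← intervalIntegral.integral_add_adjacent_intervals (i (-δ) δ) (i δ R)]
      ring
    have hneg : ∫ x in (-R)..(-δ), Complex.exp (-(ε - Complex.I * (κ / 2)) * x ^ 2) =
        ∫ x in δ..R, Complex.exp (-(ε - Complex.I * (κ / 2)) * x ^ 2) := by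
      rw [← intervalIntegral.integral_comp_neg]
      simp
    simp only [id]
    rw [hsplit, norm_neg, hneg]
    refine (norm_add_le _ _).trans ?_
    have := norm_integral_gaussian_tail_le hκ hδ hR hε.le
    calc _ ≤ 5 / (κ * δ) + 5 / (κ * δ) := add_le_add this this
      _ = _ := by ring
  have t1 : Tendsto (fun ε : ℝ => ∫ x in (-δ)..δ, Complex.exp (-(ε - Complex.I * (κ / 2)) * x ^ 2))
      (𝓝[>] 0) (𝓝 (∫ x in (-δ)..δ, Complex.exp (-((0 : ℝ) - Complex.I * (κ / 2)) * x ^ 2))) := by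
    have hc : Continuous fun ε : ℝ =>
        ∫ x in (-δ)..δ, Complex.exp (-(ε - Complex.I * (κ / 2)) * x ^ 2) := by
      refine intervalIntegral.continuous_parametric_intervalIntegral_of_continuous' ?_ _ _
      fun_prop
    exact (hc.tendsto 0).mono_left nhdsWithin_le_nhds
  have hval : (Real.pi / ((0 : ℝ) - Complex.I * (κ / 2)) : ℂ) =
      ((2 * Real.pi / κ : ℝ) : ℂ) * Complex.exp ((Real.pi / 2 : ℝ) * Complex.I) := by
    have hk : (κ : ℂ) ≠ 0 := by exact_mod_cast hκ.ne'
    have : Complex.exp ((Real.pi / 2 : ℝ) * Complex.I) = Complex.I := by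
      push_cast
      exact Complex.exp_pi_div_two_mul_I
    rw [this]
    push_cast
    rw [zero_sub]
    field_simp [Complex.I_ne_zero]
    rw [Complex.I_sq]
  have hpk : 0 < 2 * Real.pi / κ := by positivity
  have t2 : Tendsto (fun ε : ℝ => (Real.pi / (ε - Complex.I * (κ / 2)) : ℂ) ^ (1 / 2 : ℂ))
      (𝓝[>] 0) (𝓝 ((Real.pi / ((0 : ℝ) - Complex.I * (κ / 2)) : ℂ) ^ (1 / 2 : ℂ))) := by
    have hne : ((0 : ℝ) - Complex.I * (κ / 2) : ℂ) ≠ 0 := by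
      have hk : (κ : ℂ) ≠ 0 := by exact_mod_cast hκ.ne'
      simp [hk]
    -- At `ε = 0` the argument of the root lies on the positive imaginary axis, off the cut of the
    -- principal branch.
    have hsl : (Real.pi / ((0 : ℝ) - Complex.I * (κ / 2)) : ℂ) ∈ Complex.slitPlane := by
      right
      rw [hval, Complex.im_ofReal_mul, Complex.exp_ofReal_mul_I_im, Real.sin_pi_div_two, mul_one]
      exact hpk.ne'
    have hc : ContinuousAt (fun ε : ℝ => (Real.pi / (ε - Complex.I * (κ / 2)) : ℂ) ^ (1 / 2 : ℂ)) 0 := by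
      refine ContinuousAt.cpow ?_ continuousAt_const hsl
      exact continuousAt_const.div (by fun_prop) hne
    exact hc.tendsto.mono_left nhdsWithin_le_nhds
  have hroot : (Real.pi / ((0 : ℝ) - Complex.I * (κ / 2)) : ℂ) ^ (1 / 2 : ℂ) =
      √(2 * Real.pi / κ) * Complex.exp (Complex.I * (Real.pi / 4 : ℝ)) := by
    have h2 := ofReal_mul_exp_cpow hpk (φ := Real.pi / 2) (by linarith [Real.pi_pos])
      (by linarith [Real.pi_pos]) (1 / 2)
    rw [hval, Real.sqrt_eq_rpow]
    rw [show (1 / 2 : ℂ) = ((1 / 2 : ℝ) : ℂ) by push_cast; rfl, h2]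
    congr 2
    push_cast
    ring
  have hfin := le_of_tendsto (t1.sub t2).norm (by
    filter_upwards [self_mem_nhdsWithin] with ε h
    exact hε ε h)
  rw [hroot] at hfin
  have e : ∫ x in (-δ)..δ, Complex.exp (Complex.I * (κ / 2 * x ^ 2 : ℝ)) =
      ∫ x in (-δ)..δ, Complex.exp (-((0 : ℝ) - Complex.I * (κ / 2)) * x ^ 2) := by
    refine intervalIntegral.integral_congr fun x _ => ?_
    congr 1
    push_cast
    ring
  rw [e]
  exact hfin

/-- The phase `-cos x - x sin θ` is stationary at `θ` with second derivative `cos θ`; this is its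
quadratic Taylor formula with a cubic remainder uniform in `θ`. -/
theorem cos_phase_taylor {θ h : ℝ} (hh : |h| ≤ 1) :
    |(-Real.cos (θ + h) - Real.sin θ * (θ + h)) - (-Real.cos θ - Real.sin θ * θ) -
      Real.cos θ / 2 * h ^ 2| ≤ |h| ^ 3 := by
  have h1 := Real.cos_bound hh
  have h2 := Real.sin_bound hh
  have e : (-Real.cos (θ + h) - Real.sin θ * (θ + h)) - (-Real.cos θ - Real.sin θ * θ) -
      Real.cos θ / 2 * h ^ 2 = -Real.cos θ * (Real.cos h - (1 - h ^ 2 / 2)) +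
      Real.sin θ * (Real.sin h - (h - h ^ 3 / 6)) - Real.sin θ * (h ^ 3 / 6) := by
    rw [Real.cos_add]
    ring
  have h3 : |h| ^ 4 ≤ |h| ^ 3 := pow_le_pow_of_le_one (abs_nonneg h) hh (by norm_num)
  have h0 : 0 ≤ |h| ^ 3 := by positivity
  rw [e]
  have i1 : |-Real.cos θ * (Real.cos h - (1 - h ^ 2 / 2))| ≤ |h| ^ 4 * (5 / 96) := by
    rw [abs_mul, abs_neg]
    exact (mul_le_of_le_one_left (abs_nonneg _) (Real.abs_cos_le_one θ)).trans h1
  have h4' : |h| ^ 5 ≤ |h| ^ 3 := pow_le_pow_of_le_one (abs_nonneg h) hh (by norm_num)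
  have i2 : |Real.sin θ * (Real.sin h - (h - h ^ 3 / 6))| ≤ |h| ^ 5 / 100 := by
    rw [abs_mul]
    exact (mul_le_of_le_one_left (abs_nonneg _) (Real.abs_sin_le_one θ)).trans h2
  have i3 : |Real.sin θ * (h ^ 3 / 6)| ≤ |h| ^ 3 / 6 := by
    rw [abs_mul, abs_div, abs_pow, abs_of_pos (by norm_num : (0 : ℝ) < 6)]
    exact mul_le_of_le_one_left (by positivity) (Real.abs_sin_le_one θ)
  have := abs_sub (-Real.cos θ * (Real.cos h - (1 - h ^ 2 / 2)) +
      Real.sin θ * (Real.sin h - (h - h ^ 3 / 6))) (Real.sin θ * (h ^ 3 / 6))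
  have := abs_add_le (-Real.cos θ * (Real.cos h - (1 - h ^ 2 / 2)))
      (Real.sin θ * (Real.sin h - (h - h ^ 3 / 6)))
  linarith

theorem norm_exp_I_mul_sub_le (x y : ℝ) :
    ‖Complex.exp (Complex.I * x) - Complex.exp (Complex.I * y)‖ ≤ |x - y| := by
  have e : Complex.exp (Complex.I * x) - Complex.exp (Complex.I * y) =
      Complex.exp (Complex.I * y) * (Complex.exp (Complex.I * ((x - y : ℝ) : ℂ)) - 1) := by
    rw [mul_sub, ← Complex.exp_add, mul_one]
    congr 2
    push_cast
    ring
  rw [e, norm_mul, mul_comm Complex.I (y : ℂ), Complex.norm_exp_ofReal_mul_I, one_mul]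
  exact Real.norm_exp_I_mul_ofReal_sub_one_le

theorem norm_exp_I_mul_ofReal' (x : ℝ) : ‖Complex.exp (Complex.I * x)‖ = 1 := by
  rw [mul_comm, Complex.norm_exp_ofReal_mul_I]

theorem hasDerivAt_cos_phase (t ν x : ℝ) :
    HasDerivAt (fun x => -(t * Real.cos x) - ν * x) (t * Real.sin x - ν) x := by
  refine ((((Real.hasDerivAt_cos x).const_mul t).neg).sub
    ((hasDerivAt_id x).const_mul ν)).congr_deriv ?_
  ring

theorem hasDerivAt_sin_phase (t ν x : ℝ) :
    HasDerivAt (fun x => t * Real.sin x - ν) (t * Real.cos x) x :=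
  ((Real.hasDerivAt_sin x).const_mul t).sub_const ν

/-- Non-stationary phase for the integrals of Bessel type. -/
theorem norm_integral_exp_cos_phase_le {a a' : ℝ → ℂ} {c d μ A A' t ν : ℝ} (hcd : c ≤ d)
    (ht : 0 ≤ t) (hcos : ∀ x ∈ Icc c d, 0 ≤ Real.cos x) (hμ : 0 < μ)
    (hφμ : ∀ x ∈ Icc c d, μ ≤ |t * Real.sin x - ν|)
    (ha : ∀ x ∈ Icc c d, HasDerivAt a (a' x) x) (hac : ContinuousOn a' (Icc c d))
    (hA : ∀ x ∈ Icc c d, ‖a x‖ ≤ A) (hA' : ∀ x ∈ Icc c d, ‖a' x‖ ≤ A') :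
    ‖∫ x in c..d, Complex.exp (Complex.I * (-(t * Real.cos x) - ν * x : ℝ)) * a x‖ ≤
      (4 * A + A' * (d - c)) / μ := by
  refine norm_integral_exp_mul_le hcd (fun x _ => hasDerivAt_cos_phase t ν x)
    (fun x _ => hasDerivAt_sin_phase t ν x) (Continuous.continuousOn (by fun_prop))
    (fun x hx => mul_nonneg ht (hcos x hx)) hμ hφμ ha hac hA ?_
  calc ∫ x in c..d, ‖a' x‖ ≤ ∫ x in c..d, A' :=
        intervalIntegral.integral_mono_on hcd (hac.norm.intervalIntegrable_of_Icc hcd)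
          intervalIntegrable_const hA'
    _ = _ := by rw [intervalIntegral.integral_const, smul_eq_mul, mul_comm]

theorem le_abs_sin_sub_sin {c d m θ x : ℝ} (hm : ∀ y ∈ Icc c d, m ≤ Real.cos y)
    (hθ : θ ∈ Icc c d) (hx : x ∈ Icc c d) :
    m * |x - θ| ≤ |Real.sin x - Real.sin θ| := by
  have key : ∀ u ∈ Icc c d, ∀ v ∈ Icc c d, u ≤ v → m * (v - u) ≤ Real.sin v - Real.sin u := by
    intro u hu v hv huv
    refine (convex_Icc c d).mul_sub_le_image_sub_of_le_deriv Real.continuous_sin.continuousOn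
      Real.differentiable_sin.differentiableOn (fun y hy => ?_) u hu v hv huv
    rw [Real.deriv_sin]
    exact hm y (interior_subset hy)
  rcases le_total θ x with h | h
  · rw [abs_of_nonneg (sub_nonneg.2 h)]
    exact (key θ hθ x hx h).trans (le_abs_self _)
  · rw [abs_sub_comm, abs_of_nonneg (sub_nonneg.2 h), abs_sub_comm]
    exact (key x hx θ hθ h).trans (le_abs_self _)

/-- Stationary phase with a window of width `δ` around the stationary point. -/
theorem norm_integral_stationary_sub_le {a a' : ℝ → ℂ} {c d m A A' t δ θ : ℝ}
    (ht : 0 < t) (hδ : 0 < δ) (hδ1 : δ ≤ 1) (hl : c ≤ θ - δ) (hr : θ + δ ≤ d) (hm : 0 < m)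
    (hcos : ∀ x ∈ Icc c d, m ≤ Real.cos x)
    (ha : ∀ x ∈ Icc c d, HasDerivAt a (a' x) x) (hac : ContinuousOn a' (Icc c d))
    (hA : ∀ x ∈ Icc c d, ‖a x‖ ≤ A) (hA' : ∀ x ∈ Icc c d, ‖a' x‖ ≤ A') :
    ‖(∫ x in c..d, Complex.exp (Complex.I * (-(t * Real.cos x) - t * Real.sin θ * x : ℝ)) * a x) -
      Complex.exp (Complex.I * (-(t * Real.cos θ) - t * Real.sin θ * θ : ℝ)) *
        (√(2 * Real.pi / (t * Real.cos θ)) * Complex.exp (Complex.I * (Real.pi / 4 : ℝ))) * a θ‖ ≤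
      2 * A * (t * δ ^ 4) + 2 * A' * δ ^ 2 + (18 * A + 2 * A' * (d - c)) / (m * (t * δ)) := by
  have hθ : θ ∈ Icc c d := ⟨by linarith, by linarith⟩
  have hA0 : 0 ≤ A := (norm_nonneg _).trans (hA θ hθ)
  have hA'0 : 0 ≤ A' := (norm_nonneg _).trans (hA' θ hθ)
  have hμ : 0 < m * (t * δ) := by positivity
  have hacc : ContinuousOn a (Icc c d) := fun x hx => (ha x hx).continuousAt.continuousWithinAt
  set F : ℝ → ℂ := fun x =>
    Complex.exp (Complex.I * (-(t * Real.cos x) - t * Real.sin θ * x : ℝ)) * a x with hF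
  have hFc : ContinuousOn F (Icc c d) := (Continuous.continuousOn (by fun_prop)).mul hacc
  have hsub1 : Icc c (θ - δ) ⊆ Icc c d := Icc_subset_Icc_right (by linarith)
  have hsub2 : Icc (θ - δ) (θ + δ) ⊆ Icc c d := Icc_subset_Icc hl hr
  have hsub3 : Icc (θ + δ) d ⊆ Icc c d := Icc_subset_Icc_left (by linarith)
  have i1 : IntervalIntegrable F volume c (θ - δ) := (hFc.mono hsub1).intervalIntegrable_of_Icc hl
  have i2 : IntervalIntegrable F volume (θ - δ) (θ + δ) :=
    (hFc.mono hsub2).intervalIntegrable_of_Icc (by linarith)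
  have i3 : IntervalIntegrable F volume (θ + δ) d := (hFc.mono hsub3).intervalIntegrable_of_Icc hr
  have hsplit : ∫ x in c..d, F x = (∫ x in c..(θ - δ), F x) + (∫ x in (θ - δ)..(θ + δ), F x) +
      ∫ x in (θ + δ)..d, F x := by
    rw [intervalIntegral.integral_add_adjacent_intervals i1 i2,
      intervalIntegral.integral_add_adjacent_intervals (i1.trans i2) i3]
  -- Outside the window the derivative of the phase is at least `m t δ`, so the two outer integrals
  -- are non-stationary.
  have hlow : ∀ x ∈ Icc c d, δ ≤ |x - θ| → m * (t * δ) ≤ |t * Real.sin x - t * Real.sin θ| := by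
    intro x hx hxδ
    rw [← mul_sub, abs_mul, abs_of_pos ht]
    have := le_abs_sin_sub_sin hcos hθ hx
    calc m * (t * δ) = t * (m * δ) := by ring
      _ ≤ t * (m * |x - θ|) := by gcongr
      _ ≤ _ := by gcongr
  have b1 : ‖∫ x in c..(θ - δ), F x‖ ≤ (4 * A + A' * (d - c)) / (m * (t * δ)) := by
    refine (norm_integral_exp_cos_phase_le hl ht.le
      (fun x hx => hm.le.trans (hcos x (hsub1 hx))) hμ
      (fun x hx => hlow x (hsub1 hx) ?_) (fun x hx => ha x (hsub1 hx)) (hac.mono hsub1)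
      (fun x hx => hA x (hsub1 hx)) (fun x hx => hA' x (hsub1 hx))).trans ?_
    · rw [abs_sub_comm]
      exact le_trans (by linarith [hx.2]) (le_abs_self _)
    · gcongr
      linarith
  have b3 : ‖∫ x in (θ + δ)..d, F x‖ ≤ (4 * A + A' * (d - c)) / (m * (t * δ)) := by
    refine (norm_integral_exp_cos_phase_le hr ht.le
      (fun x hx => hm.le.trans (hcos x (hsub3 hx))) hμ
      (fun x hx => hlow x (hsub3 hx) ?_) (fun x hx => ha x (hsub3 hx)) (hac.mono hsub3)
      (fun x hx => hA x (hsub3 hx)) (fun x hx => hA' x (hsub3 hx))).trans ?_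
    · exact le_trans (by linarith [hx.1]) (le_abs_self _)
    · gcongr
      linarith
  set κ := t * Real.cos θ with hκ
  have hκm : t * m ≤ κ := mul_le_mul_of_nonneg_left (hcos θ hθ) ht.le
  have hκ0 : 0 < κ := lt_of_lt_of_le (by positivity) hκm
  set E := Complex.exp (Complex.I * (-(t * Real.cos θ) - t * Real.sin θ * θ : ℝ)) with hE
  have hEn : ‖E‖ = 1 := norm_exp_I_mul_ofReal' _
  set Q : ℝ → ℂ := fun h => Complex.exp (Complex.I * (κ / 2 * h ^ 2 : ℝ)) with hQ
  have hQc : Continuous Q := by fun_prop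
  have hshift : ∫ x in (θ - δ)..(θ + δ), F x = ∫ h in (-δ)..δ, F (θ + h) := by
    rw [intervalIntegral.integral_comp_add_left, sub_eq_add_neg]
  have hmem : ∀ h ∈ Icc (-δ) δ, θ + h ∈ Icc c d := fun h hh =>
    ⟨by linarith [hh.1], by linarith [hh.2]⟩
  -- Inside the window the phase is replaced by its quadratic part, with error `t δ³`, and the
  -- amplitude by its value at `θ`, with error `A' δ`; what remains is a truncated Fresnel integral.
  have hpt : ∀ h ∈ Icc (-δ) δ, ‖F (θ + h) - E * a θ * Q h‖ ≤ A * (t * δ ^ 3) + A' * δ := by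
    intro h hh
    have hhδ : |h| ≤ δ := abs_le.2 hh
    have hT := cos_phase_taylor (θ := θ) (hhδ.trans hδ1)
    have hEQ : E * Q h = Complex.exp (Complex.I * ((-(t * Real.cos θ) - t * Real.sin θ * θ) +
        κ / 2 * h ^ 2 : ℝ)) := by
      rw [hE, hQ, ← Complex.exp_add]
      congr 1
      push_cast
      ring
    have e : F (θ + h) - E * a θ * Q h =
        (Complex.exp (Complex.I * (-(t * Real.cos (θ + h)) - t * Real.sin θ * (θ + h) : ℝ)) -
          E * Q h) * a (θ + h) + E * Q h * (a (θ + h) - a θ) := by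
      simp only [hF]
      ring
    have hEQn : ‖E * Q h‖ = 1 := by rw [hEQ]; exact norm_exp_I_mul_ofReal' _
    have j1 : ‖Complex.exp (Complex.I *
        (-(t * Real.cos (θ + h)) - t * Real.sin θ * (θ + h) : ℝ)) - E * Q h‖ ≤ t * δ ^ 3 := by
      rw [hEQ]
      refine (norm_exp_I_mul_sub_le _ _).trans ?_
      have e2 : -(t * Real.cos (θ + h)) - t * Real.sin θ * (θ + h) -
          ((-(t * Real.cos θ) - t * Real.sin θ * θ) + κ / 2 * h ^ 2) =
          t * ((-Real.cos (θ + h) - Real.sin θ * (θ + h)) - (-Real.cos θ - Real.sin θ * θ) -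
          Real.cos θ / 2 * h ^ 2) := by
        rw [hκ]
        ring
      rw [e2, abs_mul, abs_of_pos ht]
      gcongr
      exact hT.trans (by gcongr)
    have j2 : ‖a (θ + h) - a θ‖ ≤ A' * δ := by
      have := (convex_Icc c d).norm_image_sub_le_of_norm_hasDerivWithin_le
        (fun x hx => (ha x hx).hasDerivWithinAt) hA' hθ (hmem h hh)
      rw [add_sub_cancel_left, Real.norm_eq_abs] at this
      exact this.trans (by gcongr)
    rw [e]
    refine (norm_add_le _ _).trans ?_
    rw [norm_mul, norm_mul, hEQn, one_mul]
    have := mul_le_mul j1 (hA _ (hmem h hh)) (norm_nonneg _) (by positivity)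
    linarith
  have hFsc : ContinuousOn (fun h => F (θ + h)) (Icc (-δ) δ) :=
    hFc.comp (by fun_prop) hmem
  have b2 : ‖(∫ x in (θ - δ)..(θ + δ), F x) - E * a θ * ∫ h in (-δ)..δ, Q h‖ ≤
      2 * A * (t * δ ^ 4) + 2 * A' * δ ^ 2 := by
    have hQi : IntervalIntegrable (fun h => E * a θ * Q h) volume (-δ) δ :=
      (continuous_const.mul hQc).intervalIntegrable _ _
    have hFi : IntervalIntegrable (fun h => F (θ + h)) volume (-δ) δ :=
      hFsc.intervalIntegrable_of_Icc (by linarith)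
    rw [hshift, ← intervalIntegral.integral_const_mul, ← intervalIntegral.integral_sub hFi hQi]
    refine (intervalIntegral.norm_integral_le_of_norm_le_const (C := A * (t * δ ^ 3) + A' * δ)
      fun h hh => hpt h ?_).trans ?_
    · rw [uIoc_of_le (by linarith)] at hh
      exact Ioc_subset_Icc_self hh
    · rw [abs_of_nonneg (by linarith)]
      apply le_of_eq
      ring
  have b4 := norm_integral_fresnel_sub_le hκ0 hδ
  have b4' : ‖(∫ h in (-δ)..δ, Q h) - √(2 * Real.pi / κ) *
      Complex.exp (Complex.I * (Real.pi / 4 : ℝ))‖ ≤ 10 / (m * (t * δ)) := by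
    refine b4.trans ?_
    refine div_le_div_of_nonneg_left (by norm_num) hμ ?_
    calc m * (t * δ) = t * m * δ := by ring
      _ ≤ κ * δ := by gcongr
  set W := (√(2 * Real.pi / κ) : ℂ) * Complex.exp (Complex.I * (Real.pi / 4 : ℝ)) with hW
  have e : (∫ x in c..d, F x) - E * W * a θ = (∫ x in c..(θ - δ), F x) +
      ((∫ x in (θ - δ)..(θ + δ), F x) - E * a θ * ∫ h in (-δ)..δ, Q h) +
      (∫ x in (θ + δ)..d, F x) + E * a θ * ((∫ h in (-δ)..δ, Q h) - W) := by
    rw [hsplit]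
    ring
  have b5 : ‖E * a θ * ((∫ h in (-δ)..δ, Q h) - W)‖ ≤ A * (10 / (m * (t * δ))) := by
    rw [norm_mul, norm_mul, hEn, one_mul]
    exact mul_le_mul (hA θ hθ) b4' (norm_nonneg _) hA0
  rw [e]
  calc _ ≤ (4 * A + A' * (d - c)) / (m * (t * δ)) + (2 * A * (t * δ ^ 4) + 2 * A' * δ ^ 2) +
      (4 * A + A' * (d - c)) / (m * (t * δ)) + A * (10 / (m * (t * δ))) :=
        norm_add₄_le.trans (by gcongr)
    _ = _ := by ring

/-- The contribution of the stationary point `arcsin (ν / t)` to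
`∫ exp (i (-t cos θ - ν θ)) a(θ) dθ`. -/
noncomputable def stationaryTerm (a : ℝ → ℂ) (t ν : ℝ) : ℂ :=
  if ν < t then
    Complex.exp (Complex.I * (-(t * Real.cos (Real.arcsin (ν / t))) -
      ν * Real.arcsin (ν / t) : ℝ)) *
    (√(2 * Real.pi / (t * Real.cos (Real.arcsin (ν / t)))) *
      Complex.exp (Complex.I * (Real.pi / 4 : ℝ))) * a (Real.arcsin (ν / t))
  else 0

theorem one_div_one_add_le_rpow {ν : ℝ} (hν : 0 ≤ ν) :
    1 / (1 + ν) ≤ (1 + ν) ^ (-3 / 5 : ℝ) := by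
  rw [one_div, ← Real.rpow_neg_one]
  exact Real.rpow_le_rpow_of_exponent_le (by linarith) (by norm_num)

/-- Since `1 + ν ≤ 2t`, decay in `t` can be traded for decay in `ν`, the form needed for summation
over `n`. -/
theorem rpow_le_two_mul_rpow {t ν : ℝ} (hν : 0 ≤ ν) (hνt : ν ≤ t) (ht : 1 ≤ t) :
    t ^ (-3 / 5 : ℝ) ≤ 2 * (1 + ν) ^ (-3 / 5 : ℝ) := by
  have i1 : t ^ (-3 / 5 : ℝ) ≤ ((1 + ν) / 2) ^ (-3 / 5 : ℝ) :=
    Real.rpow_le_rpow_of_nonpos (by positivity) (by linarith) (by norm_num)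
  refine i1.trans ?_
  rw [Real.div_rpow (by positivity) (by norm_num), div_le_iff₀ (by positivity)]
  have i2 : (1 : ℝ) ≤ 2 * 2 ^ (-3 / 5 : ℝ) := by
    have : (2 : ℝ) * 2 ^ (-3 / 5 : ℝ) = 2 ^ (2 / 5 : ℝ) := by
      nth_rewrite 1 [← Real.rpow_one 2]
      rw [← Real.rpow_add two_pos]
      norm_num
    rw [this]
    exact Real.one_le_rpow (by norm_num) (by norm_num)
  calc (1 + ν) ^ (-3 / 5 : ℝ) = (1 + ν) ^ (-3 / 5 : ℝ) * 1 := (mul_one _).symm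
    _ ≤ (1 + ν) ^ (-3 / 5 : ℝ) * (2 * 2 ^ (-3 / 5 : ℝ)) := by gcongr
    _ = _ := by ring

theorem intervalIntegral_eq_of_vanishing {f : ℝ → ℂ} {p q c d : ℝ} (hpc : p ≤ c) (hcd : c ≤ d)
    (hdq : d ≤ q) (h0 : ∀ x ∈ Icc p q, x ∉ Ioc c d → f x = 0) :
    ∫ x in p..q, f x = ∫ x in c..d, f x := by
  rw [intervalIntegral.integral_of_le (by linarith), intervalIntegral.integral_of_le hcd]
  exact setIntegral_eq_of_subset_of_forall_sdiff_eq_zero measurableSet_Ioc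
    (Ioc_subset_Ioc hpc hdq) fun x hx => h0 x (Ioc_subset_Icc_self hx.1) hx.2

/-! ### Stationary phase bounds uniform in time -/

section

variable {a : ℝ → ℂ} {η : ℝ}

theorem exists_amplitude_bounds (ha : ContDiffOn ℝ 1 a (Ioo 0 (Real.pi / 2))) (hη : 0 < η)
    (hη4 : 4 * η < Real.pi / 2) :
    ∃ A A' : ℝ, 0 ≤ A ∧ 0 ≤ A' ∧
      (∀ x ∈ Icc (η / 2) (Real.pi / 2 - η / 2), HasDerivAt a (deriv a x) x) ∧
      ContinuousOn (deriv a) (Icc (η / 2) (Real.pi / 2 - η / 2)) ∧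
      (∀ x ∈ Icc (η / 2) (Real.pi / 2 - η / 2), ‖a x‖ ≤ A) ∧
      (∀ x ∈ Icc (η / 2) (Real.pi / 2 - η / 2), ‖deriv a x‖ ≤ A') := by
  have hsub : Icc (η / 2) (Real.pi / 2 - η / 2) ⊆ Ioo 0 (Real.pi / 2) := fun x hx =>
    ⟨by linarith [hx.1], by linarith [hx.2]⟩
  have hd : ContinuousOn (deriv a) (Icc (η / 2) (Real.pi / 2 - η / 2)) :=
    (ha.continuousOn_deriv_of_isOpen isOpen_Ioo le_rfl).mono hsub
  obtain ⟨A, hA⟩ := isCompact_Icc.exists_bound_of_continuousOn (ha.continuousOn.mono hsub)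
  obtain ⟨A', hA'⟩ := isCompact_Icc.exists_bound_of_continuousOn hd
  have hmem : η / 2 ∈ Icc (η / 2) (Real.pi / 2 - η / 2) := ⟨le_rfl, by linarith⟩
  refine ⟨A, A', (norm_nonneg _).trans (hA _ hmem), (norm_nonneg _).trans (hA' _ hmem),
    fun x hx => ?_, hd, hA, hA'⟩
  exact ((ha.differentiableOn one_ne_zero).differentiableAt
    (isOpen_Ioo.mem_nhds (hsub hx))).hasDerivAt

set_option maxHeartbeats 800000 in
-- If `t sin η ≤ ν ≤ t cos η`, the stationary point stays at distance at least `η` from the ends of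
-- `[0, π/2]` and the windowed estimate applies. Otherwise a stationary point, if there is one, lies
-- off the support of `a`, and the derivative of the phase is at least `μ0 (1 + ν)` on that support.
theorem exists_stationary_bound (ha : ContDiffOn ℝ 1 a (Ioo 0 (Real.pi / 2))) (hη : 0 < η)
    (hη4 : 4 * η < Real.pi / 2)
    (h0 : ∀ θ ∈ Icc 0 (Real.pi / 2), θ ∉ Icc (2 * η) (Real.pi / 2 - 2 * η) → a θ = 0) :
    ∃ C : ℝ, 0 ≤ C ∧ ∀ t : ℝ, 1 ≤ t → ∀ ν : ℝ, 0 ≤ ν →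
      ‖(∫ x in 0..(Real.pi / 2), Complex.exp (Complex.I * (-(t * Real.cos x) - ν * x : ℝ)) * a x) -
        stationaryTerm a t ν‖ ≤ C * (1 + ν) ^ (-3 / 5 : ℝ) := by
  obtain ⟨A, A', hA0, hA'0, had, hac, hA, hA'⟩ := exists_amplitude_bounds ha hη hη4
  set c := η / 2 with hc
  set d := Real.pi / 2 - η / 2 with hd
  have hcd : c ≤ d := by linarith
  set m := Real.cos d with hm
  have hm0 : 0 < m := Real.cos_pos_of_mem_Ioo ⟨by linarith, by linarith⟩
  have hcos : ∀ x ∈ Icc c d, m ≤ Real.cos x := fun x hx =>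
    Real.cos_le_cos_of_nonneg_of_le_pi (by linarith [hx.1]) (by linarith) hx.2
  -- At most `1` for the Taylor bound, and at most `η/2` so that the window around `θ ∈ [η, π/2 -
  -- η]` stays in `[c, d]`.
  set l := min (η / 2) 1 with hl
  have hl0 : 0 < l := lt_min (by linarith) one_pos
  have hl1 : l ≤ 1 := min_le_right _ _
  have hlη : l ≤ η / 2 := min_le_left _ _
  set m1 := Real.sin (3 * η / 2) - Real.sin η with hm1
  set m2 := Real.cos η - Real.cos (3 * η / 2) with hm2
  have hm1' : 0 < m1 := sub_pos.2 (Real.sin_lt_sin_of_lt_of_le_pi_div_two (by linarith)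
    (by linarith) (by linarith))
  have hm2' : 0 < m2 := sub_pos.2 (Real.cos_lt_cos_of_nonneg_of_le_pi (by linarith)
    (by linarith) (by linarith))
  have hcη : 0 < Real.cos η := Real.cos_pos_of_mem_Ioo ⟨by linarith, by linarith⟩
  have hcη1 : Real.cos η ≤ 1 := Real.cos_le_one η
  set μ0 := min m1 m2 / 2 with hμ0
  have hμ0' : 0 < μ0 := half_pos (lt_min hm1' hm2')
  set C1 := 2 * A + 2 * A' + (18 * A + 2 * A' * (d - c)) / (m * l) with hC1
  set C2 := (4 * A + A' * (d - c)) / μ0 with hC2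
  have hdc : 0 ≤ d - c := by linarith
  have hC10 : 0 ≤ C1 := by positivity
  have hC20 : 0 ≤ C2 := by positivity
  refine ⟨2 * C1 + C2, by positivity, fun t ht ν hν => ?_⟩
  have ht0 : 0 < t := by linarith
  by_cases hcase : t * Real.sin η ≤ ν ∧ ν ≤ t * Real.cos η
  · obtain ⟨h1, h2⟩ := hcase
    have hνt : ν < t := by
      have : Real.cos η < 1 := by
        have := Real.cos_lt_cos_of_nonneg_of_le_pi le_rfl (by linarith : η ≤ Real.pi) hη
        rwa [Real.cos_zero] at this
      exact h2.trans_lt (mul_lt_of_lt_one_right ht0 this)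
    set θ := Real.arcsin (ν / t) with hθ
    have hξ0 : Real.sin η ≤ ν / t := by rw [le_div_iff₀ ht0]; linarith
    have hξ1 : ν / t ≤ Real.cos η := by rw [div_le_iff₀ ht0]; linarith
    have hθ1 : η ≤ θ := by
      have := Real.monotone_arcsin hξ0
      rwa [Real.arcsin_sin (by linarith) (by linarith)] at this
    have hθ2 : θ ≤ Real.pi / 2 - η := by
      have := Real.monotone_arcsin hξ1
      rwa [← Real.sin_pi_div_two_sub, Real.arcsin_sin (by linarith) (by linarith)] at this
    have hsin : Real.sin θ = ν / t := Real.sin_arcsin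
      (by have := Real.sin_nonneg_of_nonneg_of_le_pi hη.le (by linarith); linarith) (by linarith)
    have htsin : t * Real.sin θ = ν := by rw [hsin]; field_simp
    -- The width `δ = l t^{-2/5}` balances the inner error `t δ⁴` against the outer error `1/(t δ)`:
    -- both are of order `t^{-3/5} = T⁻³`, and `δ²` is smaller.
    set T := t ^ (1 / 5 : ℝ) with hT
    have hT1 : 1 ≤ T := Real.one_le_rpow ht (by norm_num)
    have hT0 : 0 < T := by linarith
    have hT5 : T ^ 5 = t := by
      rw [hT, ← Real.rpow_natCast, ← Real.rpow_mul ht0.le]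
      norm_num
    have hT3 : (T ^ 3)⁻¹ = t ^ (-3 / 5 : ℝ) := by
      rw [hT, ← Real.rpow_natCast, ← Real.rpow_mul ht0.le, ← Real.rpow_neg ht0.le]
      norm_num
    have hδ0 : 0 < l / T ^ 2 := by positivity
    have hδl : l / T ^ 2 ≤ l := div_le_self hl0.le (one_le_pow₀ hT1)
    have key := norm_integral_stationary_sub_le (θ := θ) (c := c) (d := d) ht0 hδ0 (hδl.trans hl1)
      (by linarith) (by linarith) hm0 hcos had hac hA hA'
    rw [htsin] at key
    have hint := intervalIntegral_eq_of_vanishing (f := fun x =>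
      Complex.exp (Complex.I * (-(t * Real.cos x) - ν * x : ℝ)) * a x) (p := 0) (q := Real.pi / 2)
      (c := c) (d := d) (by linarith) hcd (by linarith) (fun x hx hx' => by
        rw [h0 x hx (fun h => hx' ⟨by linarith [h.1], by linarith [h.2]⟩), mul_zero])
    rw [hint, stationaryTerm, if_pos hνt]
    refine key.trans ?_
    have e1 : t * (l / T ^ 2) ^ 4 ≤ (T ^ 3)⁻¹ := by
      rw [← hT5]
      calc T ^ 5 * (l / T ^ 2) ^ 4 = l ^ 4 * (T ^ 3)⁻¹ := by field_simp
        _ ≤ 1 * (T ^ 3)⁻¹ := by gcongr; exact pow_le_one₀ hl0.le hl1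
        _ = _ := one_mul _
    have e2 : (l / T ^ 2) ^ 2 ≤ (T ^ 3)⁻¹ := by
      calc (l / T ^ 2) ^ 2 = l ^ 2 * (T ^ 4)⁻¹ := by field_simp
        _ ≤ 1 * (T ^ 3)⁻¹ := by
          gcongr ?_ * (?_)⁻¹
          · exact pow_le_one₀ hl0.le hl1
          · exact pow_le_pow_right₀ hT1 (by norm_num)
        _ = _ := one_mul _
    have e3 : (18 * A + 2 * A' * (d - c)) / (m * (t * (l / T ^ 2))) =
        (18 * A + 2 * A' * (d - c)) / (m * l) * (T ^ 3)⁻¹ := by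
      rw [← hT5]
      field_simp
    have hTν : (T ^ 3)⁻¹ ≤ 2 * (1 + ν) ^ (-3 / 5 : ℝ) := by
      rw [hT3]
      exact rpow_le_two_mul_rpow hν hνt.le ht
    calc _ ≤ 2 * A * (T ^ 3)⁻¹ + 2 * A' * (T ^ 3)⁻¹ +
          (18 * A + 2 * A' * (d - c)) / (m * l) * (T ^ 3)⁻¹ := by
          rw [e3]
          gcongr
      _ = C1 * (T ^ 3)⁻¹ := by rw [hC1]; ring
      _ ≤ C1 * (2 * (1 + ν) ^ (-3 / 5 : ℝ)) := by gcongr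
      _ ≤ (2 * C1 + C2) * (1 + ν) ^ (-3 / 5 : ℝ) := by
          have : 0 ≤ C2 * (1 + ν) ^ (-3 / 5 : ℝ) := by positivity
          linarith
  · have hmain : stationaryTerm a t ν = 0 := by
      unfold stationaryTerm
      split_ifs with hνt
      · have hξ0 : 0 ≤ ν / t := by positivity
        have hξ1 : ν / t ≤ 1 := by rw [div_le_one ht0]; exact hνt.le
        have hθ0 : 0 ≤ Real.arcsin (ν / t) := Real.arcsin_nonneg.2 hξ0
        have hsin : Real.sin (Real.arcsin (ν / t)) = ν / t := Real.sin_arcsin (by linarith) hξ1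
        have htsin : t * Real.sin (Real.arcsin (ν / t)) = ν := by rw [hsin]; field_simp
        rw [h0 _ ⟨hθ0, Real.arcsin_le_pi_div_two _⟩ ?_, mul_zero]
        intro hmem
        refine hcase ⟨?_, ?_⟩
        · rw [← htsin]
          exact mul_le_mul_of_nonneg_left (Real.sin_le_sin_of_le_of_le_pi_div_two (by linarith)
            (by linarith [hmem.2]) (by linarith [hmem.1])) ht0.le
        · rw [← htsin, ← Real.sin_pi_div_two_sub]
          exact mul_le_mul_of_nonneg_left (Real.sin_le_sin_of_le_of_le_pi_div_two (by linarith)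
            (by linarith) (by linarith [hmem.2])) ht0.le
      · rfl
    -- The cut at `3η/2` lies strictly between `η`, which delimits the present case, and `2η`, where
    -- the support begins; the gaps `m1` and `m2` come from there.
    set c' := 3 * η / 2 with hc'
    set d' := Real.pi / 2 - 3 * η / 2 with hd'
    have hcd' : c' ≤ d' := by linarith
    have hsub : Icc c' d' ⊆ Icc c d := Icc_subset_Icc (by linarith) (by linarith)
    have hint := intervalIntegral_eq_of_vanishing (f := fun x =>
      Complex.exp (Complex.I * (-(t * Real.cos x) - ν * x : ℝ)) * a x) (p := 0) (q := Real.pi / 2)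
      (c := c') (d := d') (by linarith) hcd' (by linarith) (fun x hx hx' => by
        rw [h0 x hx (fun h => hx' ⟨by linarith [h.1], by linarith [h.2]⟩), mul_zero])
    have hlow : ∀ x ∈ Icc c' d', μ0 * (1 + ν) ≤ |t * Real.sin x - ν| := by
      intro x hx
      have hx1 : Real.sin (3 * η / 2) ≤ Real.sin x :=
        Real.sin_le_sin_of_le_of_le_pi_div_two (by linarith) (by linarith [hx.2]) hx.1
      have hx2 : Real.sin x ≤ Real.cos (3 * η / 2) := by
        rw [← Real.sin_pi_div_two_sub]
        exact Real.sin_le_sin_of_le_of_le_pi_div_two (by linarith [hx.1]) (by linarith) hx.2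
      have g1 : μ0 ≤ m1 / 2 := by rw [hμ0]; gcongr; exact min_le_left _ _
      have g2 : μ0 ≤ m2 / 2 := by rw [hμ0]; gcongr; exact min_le_right _ _
      rw [not_and_or, not_le, not_le] at hcase
      rcases hcase with h | h
      · have hsη : Real.sin η ≤ 1 := Real.sin_le_one η
        have htν : (1 + ν) ≤ 2 * t := by
          have := mul_le_of_le_one_right ht0.le hsη
          linarith
        refine le_trans ?_ (le_abs_self _)
        have : t * m1 ≤ t * Real.sin x - ν := by
          have := mul_le_mul_of_nonneg_left hx1 ht0.le
          rw [hm1, mul_sub]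
          linarith
        calc μ0 * (1 + ν) ≤ m1 / 2 * (2 * t) := by gcongr
          _ = t * m1 := by ring
          _ ≤ _ := this
      · rw [abs_sub_comm]
        refine le_trans ?_ (le_abs_self _)
        have i1 : Real.cos η * (1 + ν) ≤ 2 * ν := by
          have k1 := le_mul_of_one_le_left hcη.le ht
          have k2 := mul_le_of_le_one_left hν hcη1
          rw [mul_add, mul_one]
          linarith
        have i2 : m2 * (1 + ν) ≤ 2 * (ν - t * Real.sin x) := by
          have j1 : ν * m2 ≤ Real.cos η * (ν - t * Real.sin x) := by
            have j2 : t * Real.cos η * Real.sin x ≤ ν * Real.cos (3 * η / 2) := by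
              have : 0 ≤ Real.sin x :=
                (Real.sin_nonneg_of_nonneg_of_le_pi (by linarith) (by linarith)).trans hx1
              exact mul_le_mul h.le hx2 this hν
            rw [hm2, mul_sub, mul_sub]
            linarith
          have j3 : Real.cos η * (m2 * (1 + ν)) ≤ Real.cos η * (2 * (ν - t * Real.sin x)) := by
            have := mul_le_mul_of_nonneg_left i1 hm2'.le
            linarith
          exact le_of_mul_le_mul_left j3 hcη
        calc μ0 * (1 + ν) ≤ m2 / 2 * (1 + ν) := by gcongr
          _ ≤ _ := by linarith
    have key := norm_integral_exp_cos_phase_le hcd' ht0.le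
      (fun x hx => hm0.le.trans (hcos x (hsub hx))) (by positivity) hlow
      (fun x hx => had x (hsub hx)) (hac.mono hsub) (fun x hx => hA x (hsub hx))
      (fun x hx => hA' x (hsub hx))
    rw [hint, hmain, sub_zero]
    refine key.trans ?_
    calc (4 * A + A' * (d' - c')) / (μ0 * (1 + ν)) ≤ (4 * A + A' * (d - c)) / (μ0 * (1 + ν)) := by
          gcongr <;> linarith
      _ = C2 * (1 / (1 + ν)) := by rw [hC2]; field_simp
      _ ≤ C2 * (1 + ν) ^ (-3 / 5 : ℝ) := by
          gcongr
          exact one_div_one_add_le_rpow hν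
      _ ≤ (2 * C1 + C2) * (1 + ν) ^ (-3 / 5 : ℝ) := by
          have : 0 ≤ 2 * C1 * (1 + ν) ^ (-3 / 5 : ℝ) := by positivity
          linarith

/-- The derivative `t sin x + ν` of the phase has two nonnegative terms, and `t ≥ 1`, so it is at
least `m (1 + ν)` on the support. -/
theorem exists_nonstationary_bound (ha : ContDiffOn ℝ 1 a (Ioo 0 (Real.pi / 2))) (hη : 0 < η)
    (hη4 : 4 * η < Real.pi / 2)
    (h0 : ∀ θ ∈ Icc 0 (Real.pi / 2), θ ∉ Icc (2 * η) (Real.pi / 2 - 2 * η) → a θ = 0) :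
    ∃ C : ℝ, 0 ≤ C ∧ ∀ t : ℝ, 1 ≤ t → ∀ ν : ℝ, 0 ≤ ν →
      ‖∫ x in 0..(Real.pi / 2), Complex.exp (Complex.I * (-(t * Real.cos x) - -ν * x : ℝ)) * a x‖ ≤
        C * (1 + ν) ^ (-3 / 5 : ℝ) := by
  obtain ⟨A, A', hA0, hA'0, had, hac, hA, hA'⟩ := exists_amplitude_bounds ha hη hη4
  set c := η / 2 with hc
  set d := Real.pi / 2 - η / 2 with hd
  have hcd : c ≤ d := by linarith
  set m := Real.sin c with hm
  have hm0 : 0 < m := Real.sin_pos_of_pos_of_lt_pi (by linarith) (by linarith)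
  have hm1 : m ≤ 1 := Real.sin_le_one _
  have hdc : 0 ≤ d - c := by linarith
  refine ⟨(4 * A + A' * (d - c)) / m, by positivity, fun t ht ν hν => ?_⟩
  have hint := intervalIntegral_eq_of_vanishing (f := fun x =>
      Complex.exp (Complex.I * (-(t * Real.cos x) - -ν * x : ℝ)) * a x) (p := 0) (q := Real.pi / 2)
      (c := c) (d := d) (by linarith) hcd (by linarith) (fun x hx hx' => by
        rw [h0 x hx (fun h => hx' ⟨by linarith [h.1], by linarith [h.2]⟩), mul_zero])
  have key := norm_integral_exp_cos_phase_le (t := t) (ν := -ν) (μ := m * (1 + ν)) hcd (by linarith)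
    (fun x hx => Real.cos_nonneg_of_neg_pi_div_two_le_of_le (by linarith [hx.1])
      (by linarith [hx.2])) (by positivity) (fun x hx => by
        have : m ≤ Real.sin x :=
          Real.sin_le_sin_of_le_of_le_pi_div_two (by linarith) (by linarith [hx.2]) hx.1
        refine le_trans ?_ (le_abs_self _)
        nlinarith) had hac hA hA'
  rw [hint]
  refine key.trans ?_
  calc (4 * A + A' * (d - c)) / (m * (1 + ν)) = (4 * A + A' * (d - c)) / m * (1 / (1 + ν)) := by
        field_simp
    _ ≤ _ := by
        gcongr
        exact one_div_one_add_le_rpow hν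

end

/-! ### The amplitude in the asymptotics of the Jacobi polynomials -/

theorem jacobiPairing_add (α β : ℝ) (p q r : ℝ[X]) :
    jacobiPairing α β (p + q) r = jacobiPairing α β p r + jacobiPairing α β q r := by
  unfold jacobiPairing
  rw [← integral_add (integrableOn_jacobiPairing α β p r) (integrableOn_jacobiPairing α β q r)]
  simp only [Polynomial.eval_add, add_mul]

theorem jacobiPairing_X_mul_X_mul {α β : ℝ} (hα : -1 < α) (hβ : -1 < β) (n : ℕ) :
    jacobiPairing α β (Polynomial.X * jacobiPoly α β (n + 1))
      (Polynomial.X * jacobiPoly α β (n + 1)) =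
      jacobiA α β n ^ 2 + jacobiB α β (n + 1) ^ 2 + jacobiA α β (n + 1) ^ 2 := by
  have h0 : jacobiPairing α β (jacobiPoly α β n) (Polynomial.X * jacobiPoly α β (n + 1)) =
      jacobiA α β n := by
    rw [← jacobiPairing_mul_X_left, jacobiA]
  have h1 : jacobiPairing α β (jacobiPoly α β (n + 1)) (Polynomial.X * jacobiPoly α β (n + 1)) =
      jacobiB α β (n + 1) := by
    rw [jacobiPairing_comm, jacobiB]
  have h2 : jacobiPairing α β (jacobiPoly α β (n + 2)) (Polynomial.X * jacobiPoly α β (n + 1)) =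
      jacobiA α β (n + 1) := by
    rw [jacobiPairing_comm, jacobiA]
  nth_rewrite 1 [jacobiPoly_recurrence hα hβ n]
  rw [jacobiPairing_add, jacobiPairing_add, jacobiPairing_C_mul, jacobiPairing_C_mul,
    jacobiPairing_C_mul, h0, h1, h2]
  ring

/-- By the recurrence the norm squared of `x G_{n+1}` is `a_n² + b_{n+1}² + a_{n+1}²`, which tends
to `1/4 + 0 + 1/4`. -/
theorem tendsto_jacobiPairing_X_mul_X_mul {α β : ℝ} (hα : -1 < α) (hβ : -1 < β) :
    Tendsto (fun n => jacobiPairing α β (Polynomial.X * jacobiPoly α β n)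
      (Polynomial.X * jacobiPoly α β n)) atTop (𝓝 (1 / 2)) := by
  obtain ⟨C, hC, h⟩ := exists_jacobi_coeff_bound hα hβ
  have hle : ∀ n : ℕ, C / ((n : ℝ) + 1) ^ 2 ≤ C / ((n : ℝ) + 1) := fun n => by
    gcongr
    nlinarith [n.cast_nonneg (α := ℝ)]
  have ha : Tendsto (jacobiA α β) atTop (𝓝 (1 / 2)) := by
    rw [tendsto_iff_dist_tendsto_zero]
    exact squeeze_zero (fun _ => dist_nonneg) (fun n => (h n).1.trans (hle n))
      (tendsto_const_div_add_one C)
  have hb : Tendsto (jacobiB α β) atTop (𝓝 0) :=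
    squeeze_zero_norm (fun n => (h n).2.trans (hle n)) (tendsto_const_div_add_one C)
  rw [← tendsto_add_atTop_iff_nat 1]
  simp_rw [jacobiPairing_X_mul_X_mul hα hβ]
  have := ((ha.pow 2).add ((hb.comp (tendsto_add_atTop_nat 1)).pow 2)).add
    ((ha.comp (tendsto_add_atTop_nat 1)).pow 2)
  norm_num at this ⊢
  exact this

theorem integral_sin_smul_comp_cos {E : Type*} [NormedAddCommGroup E] [NormedSpace ℝ E]
    {F : ℝ → E} {ε : ℝ} (hF : ContinuousOn F (Ioo (-1) 1)) (hε : 0 < ε) (hε2 : ε ≤ Real.pi / 2) :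
    ∫ θ in ε..(Real.pi - ε), Real.sin θ • F (Real.cos θ) =
      ∫ x in (-Real.cos ε)..(Real.cos ε), F x := by
  have h := intervalIntegral.integral_deriv_smul_comp' (a := ε) (b := Real.pi - ε) (g := F)
    (fun x _ => Real.hasDerivAt_cos x) (Continuous.continuousOn (by fun_prop)) (hF.mono ?_)
  · rw [Real.cos_pi_sub, intervalIntegral.integral_symm (-Real.cos ε) (Real.cos ε)] at h
    rw [← neg_inj, ← h, ← intervalIntegral.integral_neg]
    simp only [neg_smul, Function.comp]
  · rintro _ ⟨x, hx, rfl⟩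
    rw [uIcc_of_le (by linarith)] at hx
    have hs : 0 < Real.sin x := Real.sin_pos_of_pos_of_lt_pi (by linarith [hx.1])
      (by linarith [hx.2])
    have := Real.sin_sq_add_cos_sq x
    constructor <;> nlinarith

theorem continuousOn_jacobiDensity (α β : ℝ) : ContinuousOn (jacobiDensity α β) (Ioo (-1) 1) := by
  unfold jacobiDensity jacobiWeight
  refine continuousOn_const.mul (ContinuousOn.mul ?_ ?_)
  · exact ContinuousOn.rpow_const (by fun_prop) fun x hx => Or.inl (by linarith [hx.2])
  · exact ContinuousOn.rpow_const (by fun_prop) fun x hx => Or.inl (by linarith [hx.1])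

/-- The integral of `(1 - x²) G_n² τ` is compared with its part over the window. Near the endpoints
`1 - x² ≤ sin² ε` while `G_n² τ` has total mass at most `1`, so no asymptotics are needed there. -/
theorem cos_sq_tail_bound {α β : ℝ} (hα : -1 < α) (hβ : -1 < β) {ε : ℝ} (hε : 0 < ε)
    (hε2 : ε ≤ Real.pi / 2) (n : ℕ) :
    |1 - jacobiPairing α β (Polynomial.X * jacobiPoly α β n) (Polynomial.X * jacobiPoly α β n) -
      ∫ θ in ε..(Real.pi - ε), Real.sin θ ^ 3 *
        (√(jacobiDensity α β (Real.cos θ)) * (jacobiPoly α β n).eval (Real.cos θ)) ^ 2| ≤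
      Real.sin ε ^ 2 := by
  set G := jacobiPoly α β n with hG
  set F : ℝ → ℝ := fun x => (1 - x ^ 2) * (G.eval x * G.eval x * jacobiDensity α β x) with hF
  have hFc : ContinuousOn F (Ioo (-1) 1) :=
    (Continuous.continuousOn (by fun_prop)).mul
      ((G.continuous.mul G.continuous).continuousOn.mul (continuousOn_jacobiDensity α β))
  have i0 := integrableOn_jacobiPairing α β G G
  have i2 := integrableOn_jacobiPairing α β (Polynomial.X * G) (Polynomial.X * G)
  have hFi : IntegrableOn F (Ioo (-1) 1) := by
    refine (i0.sub i2).congr (Eventually.of_forall fun x => ?_)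
    simp only [hF, Pi.sub_apply, Polynomial.eval_mul, Polynomial.eval_X]
    ring
  have hT : 1 - jacobiPairing α β (Polynomial.X * G) (Polynomial.X * G) =
      ∫ x in Ioo (-1 : ℝ) 1, F x := by
    have h1 : jacobiPairing α β G G = 1 := by simp [hG, jacobiPoly_orthonormal hα hβ]
    rw [show 1 - jacobiPairing α β (Polynomial.X * G) (Polynomial.X * G) = jacobiPairing α β G G -
      jacobiPairing α β (Polynomial.X * G) (Polynomial.X * G) by rw [h1]]
    unfold jacobiPairing
    rw [← integral_sub (μ := volume.restrict (Ioo (-1) 1)) i0 i2]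
    refine setIntegral_congr_fun measurableSet_Ioo fun x _ => ?_
    simp only [hF, Polynomial.eval_mul, Polynomial.eval_X]
    ring
  set s := Real.cos ε with hs
  have hs0 : 0 ≤ s := Real.cos_nonneg_of_neg_pi_div_two_le_of_le (by linarith) hε2
  have hs1 : s < 1 := by
    have := Real.cos_lt_cos_of_nonneg_of_le_pi le_rfl (by linarith [Real.pi_pos]) hε
    rwa [Real.cos_zero] at this
  have hbulk : ∫ θ in ε..(Real.pi - ε), Real.sin θ ^ 3 *
        (√(jacobiDensity α β (Real.cos θ)) * G.eval (Real.cos θ)) ^ 2 =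
      ∫ x in Ioc (-s) s, F x := by
    rw [← intervalIntegral.integral_of_le (by linarith), ← integral_sin_smul_comp_cos hFc hε hε2]
    refine intervalIntegral.integral_congr fun θ hθ => ?_
    rw [uIcc_of_le (by linarith)] at hθ
    have hsθ : 0 < Real.sin θ := Real.sin_pos_of_pos_of_lt_pi (by linarith [hθ.1])
      (by linarith [hθ.2])
    have h2 := Real.sin_sq_add_cos_sq θ
    have hmem : Real.cos θ ∈ Ioo (-1 : ℝ) 1 := by constructor <;> nlinarith
    have hsq := Real.sq_sqrt (jacobiDensity_nonneg α β hmem)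
    have e : 1 - Real.cos θ ^ 2 = Real.sin θ ^ 2 := by linarith
    simp only [hF, smul_eq_mul]
    rw [mul_pow, hsq, e]
    ring
  have hsub : Ioc (-s) s ⊆ Ioo (-1 : ℝ) 1 := fun x hx => ⟨by linarith [hx.1], by linarith [hx.2]⟩
  have hdiff : (∫ x in Ioo (-1 : ℝ) 1, F x) - ∫ x in Ioc (-s) s, F x =
      ∫ x in Ioo (-1 : ℝ) 1 \ Ioc (-s) s, F x := (setIntegral_sdiff measurableSet_Ioc hFi hsub).symm
  rw [hT, hbulk, hdiff]
  have hms : MeasurableSet (Ioo (-1 : ℝ) 1 \ Ioc (-s) s) := measurableSet_Ioo.diff measurableSet_Ioc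
  have hFnn : ∀ x ∈ Ioo (-1 : ℝ) 1 \ Ioc (-s) s, 0 ≤ F x := fun x hx => by
    have h1 : 0 ≤ 1 - x ^ 2 := by nlinarith [hx.1.1, hx.1.2]
    exact mul_nonneg h1 (mul_nonneg (mul_self_nonneg _) (jacobiDensity_nonneg α β hx.1))
  rw [abs_of_nonneg (setIntegral_nonneg hms hFnn)]
  have hsin : Real.sin ε ^ 2 = 1 - s ^ 2 := by rw [hs, Real.sin_sq]
  calc ∫ x in Ioo (-1 : ℝ) 1 \ Ioc (-s) s, F x
      ≤ ∫ x in Ioo (-1 : ℝ) 1 \ Ioc (-s) s,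
        Real.sin ε ^ 2 * (G.eval x * G.eval x * jacobiDensity α β x) := by
        refine setIntegral_mono_on (hFi.mono_set sdiff_subset)
          (IntegrableOn.mono_set (i0.const_mul _) sdiff_subset) hms fun x hx => ?_
        refine mul_le_mul_of_nonneg_right ?_ (mul_nonneg (mul_self_nonneg _)
          (jacobiDensity_nonneg α β hx.1))
        rw [hsin]
        have : s ≤ |x| := by
          by_contra hlt
          rw [not_le, abs_lt] at hlt
          exact hx.2 ⟨hlt.1, hlt.2.le⟩
        have : s ^ 2 ≤ x ^ 2 := by rw [← sq_abs x]; gcongr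
        linarith
    _ = Real.sin ε ^ 2 * ∫ x in Ioo (-1 : ℝ) 1 \ Ioc (-s) s,
        (G.eval x * G.eval x * jacobiDensity α β x) := integral_const_mul _ _
    _ ≤ Real.sin ε ^ 2 * 1 := by
        gcongr
        refine le_trans (setIntegral_mono_set i0 ?_ (sdiff_subset.eventuallyLE))
          (jacobiPairing_poly_self_le α β n)
        filter_upwards [ae_restrict_mem measurableSet_Ioo] with x hx
        exact mul_nonneg (mul_self_nonneg _) (jacobiDensity_nonneg α β hx)
    _ = _ := mul_one _

theorem tendsto_integral_sin_sq_mul_cos {α β : ℝ} (hα : -1 < α) (hβ : -1 < β) {ε : ℝ}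
    (hε2 : ε ≤ Real.pi / 2) (c : ℝ) :
    Tendsto (fun n : ℕ => ∫ θ in ε..(Real.pi - ε),
      Real.cos (2 * (((n : ℝ) + (α + β + 1) / 2) * θ - c)) * Real.sin θ ^ 2) atTop (𝓝 0) := by
  have hεπ : ε ≤ Real.pi - ε := by linarith
  set V := ∫ x in ε..(Real.pi - ε), ‖((2 * Real.sin x * Real.cos x : ℝ) : ℂ)‖ with hV
  refine squeeze_zero_norm' ?_ (tendsto_const_div_add_one (4 * 1 + V))
  -- From `α + β > -2` one has `2N > 2n - 1`, which is at least `n + 1` when `n ≥ 2`.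
  filter_upwards [eventually_ge_atTop 2] with n hn
  have hn' : (2 : ℝ) ≤ n := by exact_mod_cast hn
  set N := (n : ℝ) + (α + β + 1) / 2 with hN
  have key := norm_integral_exp_mul_le (φ := fun θ => 2 * (N * θ - c)) (φ' := fun _ => 2 * N)
    (φ'' := fun _ => 0) (a := fun θ => ((Real.sin θ ^ 2 : ℝ) : ℂ))
    (a' := fun x => ((2 * Real.sin x * Real.cos x : ℝ) : ℂ)) (μ := (n : ℝ) + 1) (A := 1) (V := V)
    hεπ (fun x _ => by
      simpa using ((((hasDerivAt_id x).const_mul N).sub_const c).const_mul 2))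
    (fun x _ => hasDerivAt_const x _) continuousOn_const (fun _ _ => le_rfl) (by positivity)
    (fun x _ => le_trans (by linarith) (le_abs_self _))
    (fun x _ => by
      refine HasDerivAt.ofReal_comp ?_
      refine ((Real.hasDerivAt_sin x).pow 2).congr_deriv ?_
      push_cast
      ring)
    (Continuous.continuousOn (by fun_prop))
    (fun x _ => by
      rw [Complex.norm_real, Real.norm_of_nonneg (sq_nonneg _)]
      exact Real.sin_sq_le_one x) le_rfl
  refine le_trans ?_ key
  have hre : ∫ θ in ε..(Real.pi - ε), Real.cos (2 * (N * θ - c)) * Real.sin θ ^ 2 =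
      (∫ θ in ε..(Real.pi - ε), Complex.exp (Complex.I * (2 * (N * θ - c) : ℝ)) *
        ((Real.sin θ ^ 2 : ℝ) : ℂ)).re := by
    have hi : IntervalIntegrable (fun θ : ℝ => Complex.exp (Complex.I * (2 * (N * θ - c) : ℝ)) *
        ((Real.sin θ ^ 2 : ℝ) : ℂ)) volume ε (Real.pi - ε) :=
      Continuous.intervalIntegrable (by fun_prop) _ _
    have := Complex.reCLM.intervalIntegral_comp_comm hi
    simp only [Complex.reCLM_apply] at this
    rw [← this]
    refine intervalIntegral.integral_congr fun θ _ => ?_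
    rw [Complex.re_mul_ofReal, mul_comm Complex.I, Complex.exp_ofReal_mul_I_re]
  rw [hre]
  exact Complex.abs_re_le_norm _

theorem integral_sin_sq_window (ε : ℝ) : ∫ θ in ε..(Real.pi - ε), Real.sin θ ^ 2 =
    (Real.sin ε * Real.cos ε + Real.sin ε * Real.cos ε + (Real.pi - ε) - ε) / 2 := by
  rw [integral_sin_sq, Real.sin_pi_sub, Real.cos_pi_sub]
  ring

/-- Inserting the asymptotics into `∫ (1 - x²) G_n² τ dx` gives `A² sin² θ cos²(…)`, of which only
`(A²/2) sin² θ` survives as `n → ∞`. As `ε → 0` this becomes `1/2 = (A²/2)(π/2)`, and `A ≥ 0`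
selects the root. -/
theorem jacobi_amplitude_eq {α β A : ℝ} (hα : -1 < α) (hβ : -1 < β) (hA0 : 0 ≤ A)
    (hA : ∀ ε > 0, ∃ B : ℝ, 0 ≤ B ∧ ∀ n : ℕ, ∀ θ ∈ Icc ε (Real.pi - ε),
      |√(jacobiDensity α β (Real.cos θ)) * (jacobiPoly α β n).eval (Real.cos θ) -
        A * Real.sin θ ^ (-1 / 2 : ℝ) *
          Real.cos ((n + (α + β + 1) / 2) * θ - (2 * α + 1) * Real.pi / 4)| ≤ B / ((n : ℝ) + 1)) :
    A = √(2 / Real.pi) := by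
  set c := (2 * α + 1) * Real.pi / 4 with hc
  have hbulk : ∀ ε : ℝ, 0 < ε → ε ≤ Real.pi / 2 → Tendsto (fun n => ∫ θ in ε..(Real.pi - ε),
      Real.sin θ ^ 3 *
        (√(jacobiDensity α β (Real.cos θ)) * (jacobiPoly α β n).eval (Real.cos θ)) ^ 2) atTop
      (𝓝 (A ^ 2 / 2 * ∫ θ in ε..(Real.pi - ε), Real.sin θ ^ 2)) := by
    intro ε hε hε2
    have hεπ : ε ≤ Real.pi - ε := by linarith
    obtain ⟨B, hB0, hB⟩ := hA ε hε
    have hsε : 0 < Real.sin ε := Real.sin_pos_of_pos_of_lt_pi hε (by linarith [Real.pi_pos])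
    set W := A * Real.sin ε ^ (-1 / 2 : ℝ) with hW
    have hW0 : 0 ≤ W := by positivity
    have hlim : Tendsto (fun n : ℕ => A ^ 2 / 2 * (∫ θ in ε..(Real.pi - ε), Real.sin θ ^ 2) +
        A ^ 2 / 2 * ∫ θ in ε..(Real.pi - ε),
          Real.cos (2 * (((n : ℝ) + (α + β + 1) / 2) * θ - c)) * Real.sin θ ^ 2) atTop
        (𝓝 (A ^ 2 / 2 * (∫ θ in ε..(Real.pi - ε), Real.sin θ ^ 2) + A ^ 2 / 2 * 0)) :=
      ((tendsto_integral_sin_sq_mul_cos hα hβ hε2 c).const_mul _).const_add _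
    rw [mul_zero, add_zero] at hlim
    refine tendsto_of_tendsto_of_dist hlim ?_
    refine squeeze_zero (fun _ => dist_nonneg) (fun n => ?_)
      (tendsto_const_div_add_one (B * (2 * W + B) * (Real.pi - ε - ε)))
    set N := (n : ℝ) + (α + β + 1) / 2 with hN
    set y : ℝ → ℝ := fun θ => √(jacobiDensity α β (Real.cos θ)) *
      (jacobiPoly α β n).eval (Real.cos θ) with hy
    set w : ℝ → ℝ := fun θ => A * Real.sin θ ^ (-1 / 2 : ℝ) * Real.cos (N * θ - c) with hw
    have hsin : ∀ θ ∈ Icc ε (Real.pi - ε), Real.sin ε ≤ Real.sin θ := by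
      intro θ hθ
      rcases le_total θ (Real.pi / 2) with h | h
      · exact Real.sin_le_sin_of_le_of_le_pi_div_two (by linarith) h hθ.1
      · rw [← Real.sin_pi_sub θ]
        exact Real.sin_le_sin_of_le_of_le_pi_div_two (by linarith) (by linarith)
          (by linarith [hθ.2])
    have hyc : ContinuousOn y (Icc ε (Real.pi - ε)) := by
      refine ContinuousOn.mul (Real.continuous_sqrt.comp_continuousOn
        ((continuousOn_jacobiDensity α β).comp Real.continuous_cos.continuousOn fun θ hθ => ?_))
        ((jacobiPoly α β n).continuous.comp Real.continuous_cos).continuousOn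
      have h1 := hsin θ hθ
      have h2 := Real.sin_sq_add_cos_sq θ
      constructor <;> nlinarith
    have i1 : IntervalIntegrable (fun θ => Real.sin θ ^ 3 * y θ ^ 2) volume ε (Real.pi - ε) :=
      ((Continuous.continuousOn (by fun_prop)).mul (hyc.pow 2)).intervalIntegrable_of_Icc hεπ
    have i2 : IntervalIntegrable (fun θ => A ^ 2 / 2 * Real.sin θ ^ 2) volume ε (Real.pi - ε) :=
      Continuous.intervalIntegrable (by fun_prop) _ _
    have i3 : IntervalIntegrable (fun θ => A ^ 2 / 2 *
        (Real.cos (2 * (N * θ - c)) * Real.sin θ ^ 2)) volume ε (Real.pi - ε) :=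
      Continuous.intervalIntegrable (by fun_prop) _ _
    rw [dist_comm, Real.dist_eq, ← intervalIntegral.integral_const_mul,
      ← intervalIntegral.integral_const_mul, ← intervalIntegral.integral_add i2 i3,
      ← intervalIntegral.integral_sub i1 (i2.add i3), ← Real.norm_eq_abs]
    have hpt : ∀ θ ∈ uIoc ε (Real.pi - ε), ‖Real.sin θ ^ 3 * y θ ^ 2 - (A ^ 2 / 2 * Real.sin θ ^ 2 +
        A ^ 2 / 2 * (Real.cos (2 * (N * θ - c)) * Real.sin θ ^ 2))‖ ≤
        B * (2 * W + B) / ((n : ℝ) + 1) := by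
      intro θ hθ
      rw [uIoc_of_le hεπ] at hθ
      have hθ' := Ioc_subset_Icc_self hθ
      have hsθ : 0 < Real.sin θ := hsε.trans_le (hsin θ hθ')
      have hd : |y θ - w θ| ≤ B / ((n : ℝ) + 1) := hB n θ hθ'
      have hwW : |w θ| ≤ W := by
        simp only [hw]
        rw [abs_mul, abs_of_nonneg (by positivity)]
        refine (mul_le_of_le_one_right (by positivity) (Real.abs_cos_le_one _)).trans ?_
        rw [hW]
        gcongr 1
        exact Real.rpow_le_rpow_of_nonpos hsε (hsin θ hθ') (by norm_num)
      -- The factor `sin³ θ`, of which one power is the Jacobian, absorbs the singular factor `1/sin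
      -- θ` of the squared asymptotics.
      have hwsq : Real.sin θ ^ 3 * w θ ^ 2 = A ^ 2 / 2 * Real.sin θ ^ 2 +
          A ^ 2 / 2 * (Real.cos (2 * (N * θ - c)) * Real.sin θ ^ 2) := by
        have hp : (Real.sin θ ^ (-1 / 2 : ℝ)) ^ 2 = (Real.sin θ)⁻¹ := by
          rw [← Real.rpow_natCast, ← Real.rpow_mul hsθ.le]
          norm_num [Real.rpow_neg_one]
        simp only [hw]
        rw [mul_pow, mul_pow, hp, Real.cos_two_mul]
        field_simp
        ring
      rw [← hwsq, ← mul_sub, Real.norm_eq_abs, abs_mul]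
      have h3 : |Real.sin θ ^ 3| ≤ 1 := by
        rw [abs_pow]
        exact pow_le_one₀ (abs_nonneg _) (Real.abs_sin_le_one θ)
      have h4 : |y θ ^ 2 - w θ ^ 2| ≤ B / ((n : ℝ) + 1) * (2 * W + B) := by
        have e : y θ ^ 2 - w θ ^ 2 = (y θ - w θ) * (2 * w θ + (y θ - w θ)) := by ring
        have hB1 : B / ((n : ℝ) + 1) ≤ B := div_le_self hB0 (by linarith [n.cast_nonneg (α := ℝ)])
        rw [e, abs_mul]
        have h5 : |2 * w θ + (y θ - w θ)| ≤ 2 * W + B := by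
          refine (abs_add_le _ _).trans (add_le_add ?_ (hd.trans hB1))
          rw [abs_mul, abs_two]
          linarith
        gcongr
      calc _ ≤ 1 * (B / ((n : ℝ) + 1) * (2 * W + B)) := by gcongr
        _ = _ := by ring
    refine (intervalIntegral.norm_integral_le_of_norm_le_const hpt).trans ?_
    rw [abs_of_nonneg (by linarith)]
    apply le_of_eq
    ring
  have hineq : ∀ ε : ℝ, 0 < ε → ε ≤ Real.pi / 2 →
      |1 - 1 / 2 - A ^ 2 / 2 * ∫ θ in ε..(Real.pi - ε), Real.sin θ ^ 2| ≤ Real.sin ε ^ 2 := by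
    intro ε hε hε2
    exact le_of_tendsto' (((tendsto_jacobiPairing_X_mul_X_mul hα hβ).const_sub 1).sub
      (hbulk ε hε hε2)).abs fun n => cos_sq_tail_bound hα hβ hε hε2 n
  have hpi := Real.pi_pos
  have hfin : |1 - 1 / 2 - A ^ 2 / 2 * (Real.pi / 2)| ≤ 0 := by
    have t1 : Tendsto (fun ε : ℝ => |1 - 1 / 2 - A ^ 2 / 2 *
        ((Real.sin ε * Real.cos ε + Real.sin ε * Real.cos ε + (Real.pi - ε) - ε) / 2)|) (𝓝[>] 0)
        (𝓝 |1 - 1 / 2 - A ^ 2 / 2 * (Real.pi / 2)|) := by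
      have hc : Continuous fun ε : ℝ => |1 - 1 / 2 - A ^ 2 / 2 *
        ((Real.sin ε * Real.cos ε + Real.sin ε * Real.cos ε + (Real.pi - ε) - ε) / 2)| := by
        fun_prop
      have := (hc.tendsto 0).mono_left (nhdsWithin_le_nhds (s := Ioi 0))
      simpa using this
    have t2 : Tendsto (fun ε : ℝ => Real.sin ε ^ 2) (𝓝[>] 0) (𝓝 0) := by
      have hc : Continuous fun ε : ℝ => Real.sin ε ^ 2 := by fun_prop
      have := (hc.tendsto 0).mono_left (nhdsWithin_le_nhds (s := Ioi 0))
      simpa using this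
    refine le_of_tendsto_of_tendsto t1 t2 ?_
    filter_upwards [Ioc_mem_nhdsGT (by linarith : (0 : ℝ) < Real.pi / 2)] with ε hε
    rw [← integral_sin_sq_window]
    exact hineq ε hε.1 hε.2
  have h0 := abs_nonpos_iff.1 hfin
  have hA2 : A ^ 2 = 2 / Real.pi := by
    field_simp
    linarith
  rw [← hA2, Real.sqrt_sq hA0]

/-- Asymptotics of the orthonormal Jacobi polynomials on compact subsets of `(-1, 1)`. -/
theorem jacobi_asymptotics {α β : ℝ} (hα : -1 < α) (hβ : -1 < β) {ε : ℝ} (hε : 0 < ε) :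
    ∃ B : ℝ, 0 ≤ B ∧ ∀ n : ℕ, ∀ θ ∈ Icc ε (Real.pi - ε),
      |√(jacobiDensity α β (Real.cos θ)) * (jacobiPoly α β n).eval (Real.cos θ) -
        √(2 / Real.pi) * Real.sin θ ^ (-1 / 2 : ℝ) *
          Real.cos ((n + (α + β + 1) / 2) * θ - (2 * α + 1) * Real.pi / 4)| ≤ B / ((n : ℝ) + 1) := by
  obtain ⟨A, hA0, hA⟩ := exists_jacobi_asymptotics hα hβ
  rw [← jacobi_amplitude_eq hα hβ hA0 hA]
  exact hA ε hε

/-! ### The evolution in the spectral representation -/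

/-- Pairing the convergent series for `Φ f` with `φ_n`; orthonormality of the `φ_n` suffices,
completeness does not enter. -/
theorem apply_eq_integral_of_jacobiTransform {α β : ℝ} (hα : -1 < α) (hβ : -1 < β) (f : ℓ²(ℕ, ℂ))
    {g : ℝ → ℂ} (hfg : jacobiTransform α β f =ᵐ[volume.restrict (Ioo (-1 : ℝ) 1)] g) (n : ℕ) :
    f n = ∫ x in Ioo (-1 : ℝ) 1, jacobiPhi α β n x * g x := by
  set e := fun n => (memLp_jacobiPhi α β n).toLp (jacobiPhi α β n) with he
  have h := (innerSL ℂ (e n)).hasSum (hasSum_jacobiTransform hα hβ f)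
  have ho := orthonormal_iff_ite.1 (orthonormal_jacobiPhi hα hβ) n
  have h2 : HasSum (fun m => if m = n then f n else 0)
      (inner ℂ (e n) (jacobiTransform α β f)) := by
    have hfun : (fun m => innerSL ℂ (e n) (f m • e m)) = fun m => if m = n then f n else 0 := by
      funext m
      rw [innerSL_apply_apply, inner_smul_right, ho m]
      by_cases h : n = m
      · subst h
        simp
      · simp [h, Ne.symm h]
    rw [← hfun]
    exact h
  have h3 := h2.unique (hasSum_ite_eq n (f n))
  rw [← h3, L2.inner_def]
  refine integral_congr_ae ?_
  filter_upwards [(memLp_jacobiPhi α β n).coeFn_toLp, hfg] with x hx hx2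
  rw [he]
  simp only
  rw [hx, hx2, jacobiPhi, RCLike.inner_apply, Complex.conj_ofReal, mul_comm]

theorem jacobiPhi_recurrence_zero {α β : ℝ} (hα : -1 < α) (hβ : -1 < β) (x : ℝ) :
    x * jacobiPhi α β 0 x = jacobiB α β 0 * jacobiPhi α β 0 x +
      jacobiA α β 0 * jacobiPhi α β 1 x := by
  have h := congrArg (Polynomial.eval x) (jacobiPoly_recurrence_zero hα hβ)
  simp only [Polynomial.eval_mul, Polynomial.eval_X, Polynomial.eval_C, Polynomial.eval_add] at h
  simp only [jacobiPhi]
  norm_cast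
  linear_combination √(jacobiDensity α β x) * h

theorem jacobiPhi_recurrence {α β : ℝ} (hα : -1 < α) (hβ : -1 < β) (n : ℕ) (x : ℝ) :
    x * jacobiPhi α β (n + 1) x = jacobiA α β n * jacobiPhi α β n x +
      jacobiB α β (n + 1) * jacobiPhi α β (n + 1) x +
      jacobiA α β (n + 1) * jacobiPhi α β (n + 2) x := by
  have h := congrArg (Polynomial.eval x) (jacobiPoly_recurrence hα hβ n)
  simp only [Polynomial.eval_mul, Polynomial.eval_X, Polynomial.eval_C, Polynomial.eval_add] at h
  simp only [jacobiPhi]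
  norm_cast
  linear_combination √(jacobiDensity α β x) * h

/-- The recurrence says that the matrix acts on the coordinates of `h` as multiplication of `h` by
`x`. -/
theorem jacobiAction_integral {α β : ℝ} (hα : -1 < α) (hβ : -1 < β) {h : ℝ → ℂ}
    (hh : ∀ m, IntegrableOn (fun x => jacobiPhi α β m x * h x) (Ioo (-1 : ℝ) 1)) (n : ℕ) :
    jacobiAction (jacobiA α β) (jacobiB α β)
      (fun m => ∫ x in Ioo (-1 : ℝ) 1, jacobiPhi α β m x * h x) n =
      ∫ x in Ioo (-1 : ℝ) 1, jacobiPhi α β n x * (x * h x) := by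
  cases n with
  | zero =>
    simp only [jacobiAction]
    rw [← integral_const_mul, ← integral_const_mul,
      ← integral_add ((hh 0).const_mul _) ((hh 1).const_mul _)]
    congr 1 with x
    linear_combination -h x * jacobiPhi_recurrence_zero hα hβ x
  | succ n =>
    simp only [jacobiAction]
    rw [← integral_const_mul, ← integral_const_mul, ← integral_const_mul,
      ← integral_add ((hh n).const_mul _) ((hh (n + 1)).const_mul _),
      ← integral_add (by exact ((hh n).const_mul _).add ((hh (n + 1)).const_mul _))
        ((hh (n + 2)).const_mul _)]
    congr 1 with x
    linear_combination -h x * jacobiPhi_recurrence hα hβ n x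

theorem integrableOn_jacobiPhi_mul (α β : ℝ) {h : ℝ → ℂ} (hc : Continuous h)
    (hs : HasCompactSupport h) (n : ℕ) :
    IntegrableOn (fun x => jacobiPhi α β n x * h x) (Ioo (-1 : ℝ) 1) :=
  (memLp_jacobiPhi α β n).integrable_mul ((hc.memLp_of_hasCompactSupport hs (p := 2)).restrict _)

theorem jacobiOperator_pow_apply {α β : ℝ} (hα : -1 < α) (hβ : -1 < β) {f : ℓ²(ℕ, ℂ)}
    {g : ℝ → ℂ} (hc : Continuous g) (hs : HasCompactSupport g)
    (hf : ∀ n, f n = ∫ x in Ioo (-1 : ℝ) 1, jacobiPhi α β n x * g x) (k n : ℕ) :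
    ((jacobiOperator α β ^ k) f) n =
      ∫ x in Ioo (-1 : ℝ) 1, jacobiPhi α β n x * ((x : ℂ) ^ k * g x) := by
  induction k generalizing n with
  | zero => simpa using hf n
  | succ k ih =>
    rw [pow_succ']
    change jacobiAction (jacobiA α β) (jacobiB α β) (fun m => ((jacobiOperator α β ^ k) f) m) n = _
    simp only [ih]
    rw [jacobiAction_integral hα hβ]
    · simp only [pow_succ', mul_assoc]
    · exact fun m => integrableOn_jacobiPhi_mul α β (by fun_prop) hs.mul_left m

/-- The coordinates of `e^{-iJt} f` in terms of `g = Φ f`. -/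
noncomputable def jacobiWave (α β : ℝ) (g : ℝ → ℂ) (t : ℝ) (n : ℕ) : ℂ :=
  ∫ x in Ioo (-1 : ℝ) 1, Complex.exp (-(Complex.I * t) * x) * (jacobiPhi α β n x * g x)

/-- The exponential series of the bounded operator is evaluated term by term through its powers;
`|x| ≤ 1` provides the majorant `‖c‖^k / k!` for exchanging sum and integral. -/
theorem jacobiEvolution_apply {α β : ℝ} (hα : -1 < α) (hβ : -1 < β) {f : ℓ²(ℕ, ℂ)}
    {g : ℝ → ℂ} (hc : Continuous g) (hs : HasCompactSupport g)
    (hf : ∀ n, f n = ∫ x in Ioo (-1 : ℝ) 1, jacobiPhi α β n x * g x) (t : ℝ) (n : ℕ) :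
    jacobiEvolution α β t f n = jacobiWave α β g t n := by
  set c : ℂ := -(Complex.I * (t : ℂ)) with hcdef
  have h1 := NormedSpace.exp_series_hasSum_exp' (𝕂 := ℂ) (c • jacobiOperator α β)
  have h2 := (lp.evalCLM (p := 2) ℂ (fun _ : ℕ => ℂ) n).hasSum
    ((ContinuousLinearMap.apply ℂ ℓ²(ℕ, ℂ) f).hasSum h1)
  have hF : ∀ k : ℕ, Integrable (fun x : ℝ => ((k.factorial : ℂ)⁻¹ * c ^ k) *
      (jacobiPhi α β n x * ((x : ℂ) ^ k * g x))) (volume.restrict (Ioo (-1 : ℝ) 1)) := fun k =>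
    (integrableOn_jacobiPhi_mul α β (by fun_prop) hs.mul_left n).const_mul _
  have hg := integrableOn_jacobiPhi_mul α β hc hs n
  have h3 := hasSum_integral_of_summable_integral_norm hF (by
    refine Summable.of_nonneg_of_le (fun _ => integral_nonneg fun _ => norm_nonneg _) (fun k => ?_)
      ((Real.summable_pow_div_factorial ‖c‖).mul_right
        (∫ x in Ioo (-1 : ℝ) 1, ‖jacobiPhi α β n x * g x‖))
    rw [← integral_const_mul]
    refine integral_mono_ae (hF k).norm (hg.norm.const_mul _) ?_
    filter_upwards [ae_restrict_mem measurableSet_Ioo] with x hx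
    have hx1 : ‖(x : ℂ)‖ ^ k ≤ 1 := by
      refine pow_le_one₀ (norm_nonneg _) ?_
      rw [Complex.norm_real]
      exact abs_le.2 ⟨hx.1.le, hx.2.le⟩
    simp only [norm_mul, norm_inv, norm_pow, Complex.norm_natCast]
    have h0 : 0 ≤ (k.factorial : ℝ)⁻¹ * ‖c‖ ^ k * (‖jacobiPhi α β n x‖ * ‖g x‖) := by positivity
    calc _ = ((k.factorial : ℝ)⁻¹ * ‖c‖ ^ k * (‖jacobiPhi α β n x‖ * ‖g x‖)) * ‖(x : ℂ)‖ ^ k := by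
          ring
      _ ≤ _ := mul_le_of_le_one_right h0 hx1
      _ = _ := by ring)
  have h4 : jacobiWave α β g t n = ∫ x in Ioo (-1 : ℝ) 1, ∑' k : ℕ, ((k.factorial : ℂ)⁻¹ * c ^ k) *
      (jacobiPhi α β n x * ((x : ℂ) ^ k * g x)) := by
    unfold jacobiWave
    congr 1 with x
    have h5 := (NormedSpace.exp_series_hasSum_exp' (𝕂 := ℂ) (c * x)).mul_right
      (jacobiPhi α β n x * g x)
    rw [← Complex.exp_eq_exp_ℂ] at h5
    rw [← h5.tsum_eq]
    refine tsum_congr fun k => ?_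
    simp only [smul_eq_mul, mul_pow]
    ring
  rw [h4]
  refine h2.unique ?_
  convert h3 using 2 with k
  rw [integral_const_mul, ← jacobiOperator_pow_apply hα hβ hc hs hf k n, smul_pow, smul_smul]
  rfl

/-! ### Comparison with the model evolution -/

/-- The amplitude in the variable `θ`, `x = cos θ`, common to all frequencies. -/
noncomputable def angularAmplitude (G : ℝ → ℂ) (θ : ℝ) : ℂ :=
  ((√(2 / Real.pi) * Real.sin θ ^ (1 / 2 : ℝ) : ℝ) : ℂ) * G (Real.cos θ)

/-- One of the two exponential halves of `cos (γ θ - δ)` times the amplitude. -/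
noncomputable def phasedAmplitude (G : ℝ → ℂ) (γ δ θ : ℝ) : ℂ :=
  1 / 2 * Complex.exp (Complex.I * (δ - γ * θ : ℝ)) * angularAmplitude G θ

theorem continuous_angularAmplitude {G : ℝ → ℂ} (hG : Continuous G) :
    Continuous (angularAmplitude G) := by
  unfold angularAmplitude
  have h : Continuous fun θ => Real.sin θ ^ (1 / 2 : ℝ) :=
    Real.continuous_sin.rpow_const fun _ => Or.inr (by norm_num)
  fun_prop

theorem contDiffOn_phasedAmplitude {G : ℝ → ℂ} (hG : ContDiff ℝ 1 G) (γ δ : ℝ) :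
    ContDiffOn ℝ 1 (phasedAmplitude G γ δ) (Ioo 0 (Real.pi / 2)) := by
  have h1 : ContDiffOn ℝ 1 (fun θ : ℝ => √(2 / Real.pi) * Real.sin θ ^ (1 / 2 : ℝ))
      (Ioo 0 (Real.pi / 2)) := by
    refine contDiffOn_const.mul (Real.contDiff_sin.contDiffOn.rpow_const_of_ne fun θ hθ => ?_)
    exact (Real.sin_pos_of_pos_of_lt_pi hθ.1 (by linarith [hθ.2, Real.pi_pos])).ne'
  have h2 : ContDiff ℝ 1 fun θ : ℝ => Complex.exp (Complex.I * (δ - γ * θ : ℝ)) :=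
    (contDiff_const.mul (Complex.ofRealCLM.contDiff.comp
      (contDiff_const.sub (contDiff_const.mul contDiff_id)))).cexp
  unfold phasedAmplitude angularAmplitude
  exact (contDiff_const.mul h2).contDiffOn.mul
    ((Complex.ofRealCLM.contDiff.comp_contDiffOn h1).mul
      (hG.comp Real.contDiff_cos).contDiffOn)

/-- Half of the oscillatory integral representing a coordinate of `e^{-iJt} f`. -/
noncomputable def halfWave (G : ℝ → ℂ) (γ δ t : ℝ) (n : ℕ) : ℂ :=
  ∫ θ in 0..(Real.pi / 2), Complex.exp (-(Complex.I * t) * Real.cos θ) *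
    ((Real.cos ((n + γ) * θ - δ) : ℝ) : ℂ) * angularAmplitude G θ

/-- The cosine is split into exponentials with phases `-t cos θ ∓ nθ`; only the upper sign has a
stationary point. The shifts `γ` and `δ` do not depend on `n` and are kept in the amplitude. -/
theorem exists_halfWave_bound {G : ℝ → ℂ} (hG : ContDiff ℝ 1 G) {η : ℝ} (hη : 0 < η)
    (hη4 : 4 * η < Real.pi / 2)
    (h0 : ∀ θ ∈ Icc 0 (Real.pi / 2), θ ∉ Icc (2 * η) (Real.pi / 2 - 2 * η) → G (Real.cos θ) = 0)
    (γ δ : ℝ) :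
    ∃ C : ℝ, 0 ≤ C ∧ ∀ t : ℝ, 1 ≤ t → ∀ n : ℕ,
      ‖halfWave G γ δ t n - stationaryTerm (phasedAmplitude G γ δ) t n‖ ≤
        C * (1 + (n : ℝ)) ^ (-3 / 5 : ℝ) := by
  have hv : ∀ γ δ : ℝ, ∀ θ ∈ Icc 0 (Real.pi / 2), θ ∉ Icc (2 * η) (Real.pi / 2 - 2 * η) →
      phasedAmplitude G γ δ θ = 0 := fun γ δ θ h1 h2 => by
    simp [phasedAmplitude, angularAmplitude, h0 θ h1 h2]
  obtain ⟨C₁, hC₁, h1⟩ := exists_stationary_bound (contDiffOn_phasedAmplitude hG γ δ) hη hη4 (hv γ δ)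
  obtain ⟨C₂, hC₂, h2⟩ :=
    exists_nonstationary_bound (contDiffOn_phasedAmplitude hG (-γ) (-δ)) hη hη4 (hv _ _)
  refine ⟨C₁ + C₂, by positivity, fun t ht n => ?_⟩
  have hc : ∀ γ δ : ℝ, Continuous (phasedAmplitude G γ δ) := fun γ δ => by
    have := continuous_angularAmplitude hG.continuous
    unfold phasedAmplitude
    fun_prop
  have e : halfWave G γ δ t n =
      (∫ x in 0..(Real.pi / 2), Complex.exp (Complex.I * (-(t * Real.cos x) - n * x : ℝ)) *
        phasedAmplitude G γ δ x) +
      ∫ x in 0..(Real.pi / 2), Complex.exp (Complex.I * (-(t * Real.cos x) - -(n : ℝ) * x : ℝ)) *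
        phasedAmplitude G (-γ) (-δ) x := by
    have hc1 := hc γ δ
    have hc2 := hc (-γ) (-δ)
    rw [← intervalIntegral.integral_add
      (Continuous.intervalIntegrable (by fun_prop) _ _)
      (Continuous.intervalIntegrable (by fun_prop) _ _)]
    unfold halfWave
    congr 1 with x
    simp only [phasedAmplitude]
    rw [Complex.ofReal_cos ((n + γ) * x - δ), Complex.cos]
    have e1 : Complex.exp (-(Complex.I * t) * Real.cos x) *
        Complex.exp (((n + γ) * x - δ : ℝ) * Complex.I) =
        Complex.exp (Complex.I * (-(t * Real.cos x) - -(n : ℝ) * x : ℝ)) *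
        Complex.exp (Complex.I * (-δ - -γ * x : ℝ)) := by
      rw [← Complex.exp_add, ← Complex.exp_add]
      congr 1
      push_cast
      ring
    have e2 : Complex.exp (-(Complex.I * t) * Real.cos x) *
        Complex.exp (-((n + γ) * x - δ : ℝ) * Complex.I) =
        Complex.exp (Complex.I * (-(t * Real.cos x) - (n : ℝ) * x : ℝ)) *
        Complex.exp (Complex.I * (δ - γ * x : ℝ)) := by
      rw [← Complex.exp_add, ← Complex.exp_add]
      congr 1
      push_cast
      ring
    linear_combination (1 / 2 * angularAmplitude G x) * (e1 + e2)
  rw [e, add_sub_right_comm, add_mul]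
  exact (norm_add_le _ _).trans (add_le_add (h1 t ht n n.cast_nonneg) (h2 t ht n n.cast_nonneg))

/-! ### The model sequence as a sum of stationary terms -/

/-- With `arcsin ξ = π/2 - arccos ξ` the value of the phase at the stationary point becomes `ψ(ξ) t
- nπ/2`, and the second part is the factor `i^{-n}`. -/
theorem stationaryTerm_phasedAmplitude (G : ℝ → ℂ) (γ δ : ℝ) {t : ℝ} (ht : 0 < t) (n : ℕ) :
    stationaryTerm (phasedAmplitude G γ δ) t n =
      if 0 < (n : ℝ) / t ∧ (n : ℝ) / t < 1 then
        Complex.I ^ (-(n : ℤ)) * Complex.exp (Complex.I * (δ - γ * (Real.pi / 2) : ℝ)) *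
          (t ^ (-1 / 2 : ℝ) : ℝ) * (Complex.exp (Complex.I * (jacobiPhase (n / t) * t : ℝ)) *
          (Complex.exp (Complex.I * (Real.pi / 4 : ℝ)) *
            Complex.exp (Complex.I * (γ * Real.arccos (n / t) : ℝ)) *
            (((n : ℝ) / t) ^ (1 / 2 : ℝ) * (1 - ((n : ℝ) / t) ^ 2) ^ (-1 / 4 : ℝ) : ℝ) *
            G (√(1 - ((n : ℝ) / t) ^ 2))))
      else 0 := by
  unfold stationaryTerm
  by_cases hn : (n : ℝ) < t
  swap
  · rw [if_neg hn, if_neg]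
    rw [div_lt_one ht]
    exact fun h => hn h.2
  rw [if_pos hn]
  have hξ1 : (n : ℝ) / t < 1 := (div_lt_one ht).2 hn
  have hξ0 : 0 ≤ (n : ℝ) / t := by positivity
  have hnt : (n : ℝ) = n / t * t := by field_simp
  set ξ := (n : ℝ) / t with hξ
  have hsin : Real.sin (Real.arcsin ξ) = ξ := Real.sin_arcsin (by linarith) hξ1.le
  -- For `n = 0` the stationary point is `θ = 0`, where the factor `(sin θ)^{1/2}` vanishes; this
  -- agrees with the value `0` of the model.
  rcases hξ0.eq_or_lt with h | hpos
  · rw [if_neg (by rw [← h]; simp), phasedAmplitude, angularAmplitude, hsin, ← h,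
      Real.zero_rpow (by norm_num)]
    simp
  rw [if_pos ⟨hpos, hξ1⟩, phasedAmplitude, angularAmplitude, hsin, Real.cos_arcsin]
  have hq : 0 < 1 - ξ ^ 2 := by nlinarith
  have hamp : √(2 * Real.pi / (t * √(1 - ξ ^ 2))) * (1 / 2) * √(2 / Real.pi) =
      t ^ (-1 / 2 : ℝ) * (1 - ξ ^ 2) ^ (-1 / 4 : ℝ) := by
    have h4 : (1 - ξ ^ 2) ^ (-1 / 4 : ℝ) = (√(1 - ξ ^ 2)) ^ (-1 / 2 : ℝ) := by
      rw [Real.sqrt_eq_rpow, ← Real.rpow_mul hq.le]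
      norm_num
    have hs := Real.sqrt_pos.2 hq
    rw [h4, ← Real.mul_rpow ht.le hs.le, neg_div, Real.rpow_neg (by positivity),
      ← Real.sqrt_eq_rpow, mul_right_comm, ← Real.sqrt_mul (by positivity), ← Real.sqrt_inv]
    have h5 : 2 * Real.pi / (t * √(1 - ξ ^ 2)) * (2 / Real.pi) = 2 ^ 2 * (t * √(1 - ξ ^ 2))⁻¹ := by
      have := Real.pi_pos
      field_simp
    rw [h5, Real.sqrt_mul (by norm_num), Real.sqrt_sq (by norm_num)]
    ring
  have hphase : Complex.exp (Complex.I * (-(t * √(1 - ξ ^ 2)) - n * Real.arcsin ξ : ℝ)) *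
      Complex.exp (Complex.I * (δ - γ * Real.arcsin ξ : ℝ)) =
      Complex.I ^ (-(n : ℤ)) * Complex.exp (Complex.I * (δ - γ * (Real.pi / 2) : ℝ)) *
        Complex.exp (Complex.I * (jacobiPhase ξ * t : ℝ)) *
        Complex.exp (Complex.I * (γ * Real.arccos ξ : ℝ)) := by
    have hI : Complex.I ^ (-(n : ℤ)) = Complex.exp (Complex.I * (-(n * (Real.pi / 2)) : ℝ)) := by
      rw [zpow_neg, zpow_natCast]
      nth_rewrite 1 [← Complex.exp_pi_div_two_mul_I]
      rw [← Complex.exp_nat_mul, ← Complex.exp_neg]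
      congr 1
      push_cast
      ring
    rw [hI, ← Complex.exp_add, ← Complex.exp_add, ← Complex.exp_add, ← Complex.exp_add]
    congr 1
    rw [Real.arcsin_eq_pi_div_two_sub_arccos, jacobiPhase, sub_mul, mul_right_comm, ← hnt]
    push_cast
    ring
  have hamp' := congrArg (fun x : ℝ => (x : ℂ)) hamp
  rw [Complex.ofReal_mul (_ ^ (1 / 2 : ℝ)), Complex.ofReal_mul √(2 / Real.pi)]
  simp only [Complex.ofReal_mul (t ^ (-1 / 2 : ℝ)), Complex.ofReal_mul _ √(2 / Real.pi),
    Complex.ofReal_mul _ (1 / 2 : ℝ)] at hamp'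
  rw [show ((1 / 2 : ℝ) : ℂ) = 1 / 2 by norm_num] at hamp'
  linear_combination (Complex.exp (Complex.I * (Real.pi / 4 : ℝ)) * (ξ ^ (1 / 2 : ℝ) : ℝ) *
    G √(1 - ξ ^ 2)) * ((√(2 * Real.pi / (t * √(1 - ξ ^ 2))) * (1 / 2) * √(2 / Real.pi)) * hphase +
    (Complex.I ^ (-(n : ℤ)) * Complex.exp (Complex.I * (δ - γ * (Real.pi / 2) : ℝ)) *
        Complex.exp (Complex.I * (jacobiPhase ξ * t : ℝ)) *
        Complex.exp (Complex.I * (γ * Real.arccos ξ : ℝ))) * hamp')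

theorem neg_one_pow_mul_conj_I_zpow (n : ℕ) :
    (-1 : ℂ) ^ n * (starRingEnd ℂ) (Complex.I ^ (-(n : ℤ))) = Complex.I ^ (-(n : ℤ)) := by
  rw [zpow_neg, zpow_natCast, ← inv_pow, Complex.inv_I, map_pow, map_neg, Complex.conj_I, neg_neg,
    ← mul_pow, neg_one_mul]

theorem conj_exp_I_mul_ofReal (x : ℝ) :
    (starRingEnd ℂ) (Complex.exp (Complex.I * x)) = Complex.exp (-(Complex.I * x)) := by
  rw [← Complex.exp_conj, map_mul, Complex.conj_I, Complex.conj_ofReal, neg_mul]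

/-- The first term gives `h_+`; the conjugated one, for the reflected function and with `β` in the
phase shift, gives `h_-`. The common prefactors match because the shifts `(α - β)π/4` and `(β -
α)π/4` agree after conjugation and `(-1)^n` times the conjugate of `i^{-n}` is again `i^{-n}`. -/
theorem jacobiModelSeq_of_pos (α β : ℝ) (g : ℝ → ℂ) {t : ℝ} (ht : 0 < t) (n : ℕ) :
    jacobiModelSeq α β g t n =
      stationaryTerm (phasedAmplitude g ((α + β + 1) / 2) ((2 * α + 1) * Real.pi / 4)) t n +
      (-1) ^ n * (starRingEnd ℂ) (stationaryTerm (phasedAmplitude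
        (fun x => (starRingEnd ℂ) (g (-x))) ((α + β + 1) / 2) ((2 * β + 1) * Real.pi / 4)) t n) := by
  rw [stationaryTerm_phasedAmplitude _ _ _ ht, stationaryTerm_phasedAmplitude _ _ _ ht]
  unfold jacobiModelSeq
  simp only [sign_pos ht, SignType.coe_one, abs_of_pos ht]
  split_ifs with h
  swap
  · simp
  simp only [jacobiAmplitude, map_mul, conj_exp_I_mul_ofReal, Complex.conj_conj,
    Complex.conj_ofReal]
  have e1 : (α - β) * Real.pi / 4 =
      (2 * α + 1) * Real.pi / 4 - (α + β + 1) / 2 * (Real.pi / 2) := by ring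
  have e2 : Complex.exp (-(Complex.I *
      ((2 * β + 1) * Real.pi / 4 - (α + β + 1) / 2 * (Real.pi / 2) : ℝ))) =
      Complex.exp (Complex.I *
        ((2 * α + 1) * Real.pi / 4 - (α + β + 1) / 2 * (Real.pi / 2) : ℝ)) := by
    congr 1
    push_cast
    ring
  have e3 := neg_one_pow_mul_conj_I_zpow n
  rw [e1, e2]
  simp only [Int.cast_one, one_mul, Int.cast_neg, mul_neg, neg_mul, Int.reduceNeg, mul_one]
  linear_combination -(Complex.exp (Complex.I *
        ((2 * α + 1) * Real.pi / 4 - (α + β + 1) / 2 * (Real.pi / 2) : ℝ)) *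
      (t ^ (-1 / 2 : ℝ) : ℝ) * (Complex.exp (-(Complex.I * (jacobiPhase (n / t) * t : ℝ))) *
      (Complex.exp (-(Complex.I * (Real.pi / 4 : ℝ))) *
        Complex.exp (-(Complex.I * ((α + β + 1) / 2 * Real.arccos (n / t) : ℝ))) *
        (((n : ℝ) / t) ^ (1 / 2 : ℝ) * (1 - ((n : ℝ) / t) ^ 2) ^ (-1 / 4 : ℝ) : ℝ) *
            g (-√(1 - ((n : ℝ) / t) ^ 2))))) * e3

/-- The localisation of a test function away from the points `0` and `±1`, in the angular
variable. -/
theorem exists_angular_gap {g : ℝ → ℂ} (hgs : tsupport g ⊆ Ioo (-1 : ℝ) 1 \ {0}) :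
    ∃ η : ℝ, 0 < η ∧ 4 * η < Real.pi / 2 ∧ ∀ θ ∈ Icc 0 (Real.pi / 2),
      θ ∉ Icc (2 * η) (Real.pi / 2 - 2 * η) → g (Real.cos θ) = 0 ∧ g (-Real.cos θ) = 0 := by
  have hev : ∀ y : ℝ, y ∉ Ioo (-1 : ℝ) 1 \ {0} → ∀ᶠ x in 𝓝 y, g x = 0 := fun y hy =>
    notMem_tsupport_iff_eventuallyEq.1 fun h => hy (hgs h)
  have h1 : ∀ᶠ θ in 𝓝 (0 : ℝ), g (Real.cos θ) = 0 ∧ g (-Real.cos θ) = 0 := by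
    refine (Real.continuous_cos.continuousAt.eventually
      (p := fun x => g x = 0) ?_).and ((Continuous.continuousAt
      (f := fun θ => -Real.cos θ) (by fun_prop)).eventually (p := fun x => g x = 0) ?_)
    · exact hev _ (by simp)
    · exact hev _ (by simp)
  have h2 : ∀ᶠ θ in 𝓝 (Real.pi / 2), g (Real.cos θ) = 0 ∧ g (-Real.cos θ) = 0 := by
    refine (Real.continuous_cos.continuousAt.eventually
      (p := fun x => g x = 0) ?_).and ((Continuous.continuousAt
      (f := fun θ => -Real.cos θ) (by fun_prop)).eventually (p := fun x => g x = 0) ?_)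
    · exact hev _ (by simp)
    · exact hev _ (by simp)
  obtain ⟨ρ, hρ, h1⟩ := Metric.eventually_nhds_iff.1 h1
  obtain ⟨σ, hσ, h2⟩ := Metric.eventually_nhds_iff.1 h2
  have hpi := Real.pi_pos
  refine ⟨min (min (ρ / 2) (σ / 2)) (Real.pi / 10), by positivity, ?_, fun θ hθ hn => ?_⟩
  · have := min_le_right (min (ρ / 2) (σ / 2)) (Real.pi / 10)
    linarith
  · have i1 := (min_le_left (min (ρ / 2) (σ / 2)) (Real.pi / 10)).trans (min_le_left _ _)
    have i2 := (min_le_left (min (ρ / 2) (σ / 2)) (Real.pi / 10)).trans (min_le_right _ _)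
    rw [mem_Icc, not_and_or, not_le, not_le] at hn
    rcases hn with hn | hn
    · refine h1 ?_
      rw [Real.dist_eq, sub_zero, abs_of_nonneg hθ.1]
      linarith
    · refine h2 ?_
      rw [Real.dist_eq, abs_lt]
      constructor <;> linarith [hθ.2]

/-- Under `θ ↦ π - θ` the exponential turns into its conjugate, and the cosine keeps its form up to
the sign `(-1)^n` with `γπ - δ` in place of `δ`. For the Jacobi shift this interchanges `α` and `β`.
-/
theorem halfWave_reflect (G : ℝ → ℂ) (γ δ t : ℝ) (n : ℕ) :
    (-1) ^ n * (starRingEnd ℂ) (halfWave (fun x => (starRingEnd ℂ) (G (-x))) γ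
      (γ * Real.pi - δ) t n) =
    ∫ θ in (Real.pi / 2)..Real.pi, Complex.exp (-(Complex.I * t) * Real.cos θ) *
      ((Real.cos ((n + γ) * θ - δ) : ℝ) : ℂ) * angularAmplitude G θ := by
  have h := intervalIntegral.integral_comp_sub_left (a := 0) (b := Real.pi / 2)
    (fun θ => Complex.exp (-(Complex.I * t) * Real.cos θ) *
      ((Real.cos ((n + γ) * θ - δ) : ℝ) : ℂ) * angularAmplitude G θ) Real.pi
  rw [sub_zero, sub_half] at h
  have hpi : 0 ≤ Real.pi / 2 := by positivity
  rw [← h, halfWave, intervalIntegral.integral_of_le hpi, intervalIntegral.integral_of_le hpi,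
    ← integral_conj, ← integral_const_mul]
  congr 1 with θ
  have e1 : Real.cos ((n + γ) * (Real.pi - θ) - δ) =
      (-1) ^ n * Real.cos ((n + γ) * θ - (γ * Real.pi - δ)) := by
    rw [← Real.cos_nat_mul_pi_sub]
    congr 1
    ring
  rw [Real.cos_pi_sub, e1]
  simp only [angularAmplitude, Real.sin_pi_sub, Real.cos_pi_sub, map_mul, Complex.conj_conj,
    Complex.conj_ofReal, ← Complex.exp_conj, map_neg, Complex.conj_I]
  push_cast
  ring_nf

theorem integral_eq_halfWave_add {G : ℝ → ℂ} (hG : Continuous G) (γ δ t : ℝ) (n : ℕ) :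
    ∫ θ in 0..Real.pi, Complex.exp (-(Complex.I * t) * Real.cos θ) *
      ((Real.cos ((n + γ) * θ - δ) : ℝ) : ℂ) * angularAmplitude G θ =
    halfWave G γ δ t n + (-1) ^ n * (starRingEnd ℂ) (halfWave (fun x => (starRingEnd ℂ) (G (-x))) γ
      (γ * Real.pi - δ) t n) := by
  rw [halfWave_reflect, halfWave]
  have hc := continuous_angularAmplitude hG
  exact (intervalIntegral.integral_add_adjacent_intervals
    (Continuous.intervalIntegrable (by fun_prop) _ _)
    (Continuous.intervalIntegrable (by fun_prop) _ _)).symm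

theorem jacobiWave_eq_integral_angle (α β : ℝ) {g : ℝ → ℂ} (hg : Continuous g) {ε : ℝ} (hε : 0 < ε)
    (hε2 : ε ≤ Real.pi / 2)
    (h0 : ∀ θ ∈ Icc 0 ε, g (Real.cos θ) = 0 ∧ g (-Real.cos θ) = 0) (t : ℝ) (n : ℕ) :
    jacobiWave α β g t n = ∫ θ in ε..(Real.pi - ε), (Real.sin θ : ℂ) *
      (Complex.exp (-(Complex.I * t) * Real.cos θ) *
        (jacobiPhi α β n (Real.cos θ) * g (Real.cos θ))) := by
  set F : ℝ → ℂ := fun x => Complex.exp (-(Complex.I * t) * x) * (jacobiPhi α β n x * g x) with hF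
  have hFc : ContinuousOn F (Ioo (-1) 1) := by
    have h1 := continuousOn_jacobiDensity α β
    have h2 : ContinuousOn (jacobiPhi α β n) (Ioo (-1) 1) :=
      Complex.continuous_ofReal.comp_continuousOn
        (h1.sqrt.mul (jacobiPoly α β n).continuous.continuousOn)
    exact (Continuous.continuousOn (by fun_prop)).mul (h2.mul hg.continuousOn)
  have h := integral_sin_smul_comp_cos hFc hε hε2
  simp only [Complex.real_smul] at h
  rw [h]
  have hpi := Real.pi_pos
  have hcos : Real.cos ε < 1 := by
    rw [← Real.cos_zero]
    exact Real.cos_lt_cos_of_nonneg_of_le_pi_div_two le_rfl hε2 hε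
  have hcos0 : 0 ≤ Real.cos ε := Real.cos_nonneg_of_mem_Icc ⟨by linarith, hε2⟩
  have hz : ∀ x : ℝ, Real.cos ε ≤ x → x ≤ 1 → g x = 0 ∧ g (-x) = 0 := fun x hx hx1 => by
    have := h0 (Real.arccos x) ⟨Real.arccos_nonneg x, by
      rw [← Real.arccos_cos hε.le (by linarith)]
      exact Real.arccos_le_arccos hx⟩
    rwa [Real.cos_arccos (by linarith) hx1] at this
  rw [← intervalIntegral_eq_of_vanishing (p := -1) (q := 1) (by linarith) (by linarith) hcos.le,
    intervalIntegral.integral_of_le (by norm_num), integral_Ioc_eq_integral_Ioo]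
  · rfl
  · intro x hx hn
    rw [mem_Ioc, not_and_or, not_lt, not_le] at hn
    have : g x = 0 := by
      rcases hn with hn | hn
      · simpa using (hz (-x) (by linarith) (by linarith [hx.1])).2
      · exact (hz x hn.le hx.2).1
    simp [hF, this]

theorem sin_mul_rpow_neg_half {s : ℝ} (hs : 0 < s) :
    s * s ^ (-1 / 2 : ℝ) = s ^ (1 / 2 : ℝ) := by
  nth_rewrite 1 [← Real.rpow_one s]
  rw [← Real.rpow_add hs]
  norm_num

/-- The error of the asymptotics is integrated against a function of modulus at most `|g|`, the
oscillating factor having modulus one; hence the bound is uniform in `t`. The window avoids the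
endpoints because `g` vanishes near `±1`. -/
theorem exists_jacobiWave_halfWave_bound {α β : ℝ} (hα : -1 < α) (hβ : -1 < β) {g : ℝ → ℂ}
    (hg : Continuous g) (hgc : HasCompactSupport g) {η : ℝ} (hη : 0 < η)
    (hη4 : 4 * η < Real.pi / 2)
    (h0 : ∀ θ ∈ Icc 0 (Real.pi / 2), θ ∉ Icc (2 * η) (Real.pi / 2 - 2 * η) →
      g (Real.cos θ) = 0 ∧ g (-Real.cos θ) = 0) :
    ∃ C : ℝ, 0 ≤ C ∧ ∀ (t : ℝ) (n : ℕ), ‖jacobiWave α β g t n -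
      (halfWave g ((α + β + 1) / 2) ((2 * α + 1) * Real.pi / 4) t n +
      (-1) ^ n * (starRingEnd ℂ) (halfWave (fun x => (starRingEnd ℂ) (g (-x))) ((α + β + 1) / 2)
        ((2 * β + 1) * Real.pi / 4) t n))‖ ≤ C * (1 / (1 + (n : ℝ))) := by
  obtain ⟨B, hB0, hB⟩ := jacobi_asymptotics hα hβ hη
  obtain ⟨M, hM⟩ := hgc.exists_bound_of_continuous hg
  have hM0 : 0 ≤ M := (norm_nonneg _).trans (hM 0)
  have hpi := Real.pi_pos
  have hz : ∀ θ ∈ Icc 0 η, g (Real.cos θ) = 0 ∧ g (-Real.cos θ) = 0 := fun θ hθ =>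
    h0 θ ⟨hθ.1, by linarith [hθ.2]⟩ fun h => by linarith [hθ.2, h.1]
  refine ⟨B * M * Real.pi, by positivity, fun t n => ?_⟩
  set γ := (α + β + 1) / 2 with hγ
  set δ := (2 * α + 1) * Real.pi / 4 with hδ
  rw [show (2 * β + 1) * Real.pi / 4 = γ * Real.pi - δ by rw [hγ, hδ]; ring,
    ← integral_eq_halfWave_add hg,
    intervalIntegral_eq_of_vanishing (c := η) (d := Real.pi - η) hη.le (by linarith) (by linarith),
    jacobiWave_eq_integral_angle α β hg hη (by linarith) hz]
  swap
  · intro θ hθ hn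
    have : g (Real.cos θ) = 0 := by
      rw [mem_Ioc, not_and_or, not_lt, not_le] at hn
      rcases hn with hn | hn
      · exact (hz θ ⟨hθ.1, hn⟩).1
      · have := (hz (Real.pi - θ) ⟨by linarith [hθ.2], by linarith⟩).2
        rwa [Real.cos_pi_sub, neg_neg] at this
    simp [angularAmplitude, this]
  have hmem : ∀ θ ∈ uIcc η (Real.pi - η), Real.cos θ ∈ Ioo (-1 : ℝ) 1 := by
    intro θ hθ
    rw [uIcc_of_le (by linarith)] at hθ
    constructor
    · rw [← Real.cos_pi]
      exact Real.cos_lt_cos_of_nonneg_of_le_pi (by linarith [hθ.1]) le_rfl (by linarith [hθ.2])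
    · rw [← Real.cos_zero]
      exact Real.cos_lt_cos_of_nonneg_of_le_pi le_rfl (by linarith [hθ.2]) (by linarith [hθ.1])
  have hφ : ContinuousOn (fun θ => jacobiPhi α β n (Real.cos θ)) (uIcc η (Real.pi - η)) := by
    have h1 : ContinuousOn (jacobiPhi α β n) (Ioo (-1) 1) :=
      Complex.continuous_ofReal.comp_continuousOn
        ((continuousOn_jacobiDensity α β).sqrt.mul (jacobiPoly α β n).continuous.continuousOn)
    exact h1.comp Real.continuous_cos.continuousOn hmem
  have hc := continuous_angularAmplitude hg
  rw [← intervalIntegral.integral_sub]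
  rotate_left
  · exact ContinuousOn.intervalIntegrable (by fun_prop)
  · exact Continuous.intervalIntegrable (by fun_prop) _ _
  refine (intervalIntegral.norm_integral_le_of_norm_le_const (C := B / ((n : ℝ) + 1) * M)
    fun θ hθ => ?_).trans ?_
  · rw [uIoc_of_le (by linarith)] at hθ
    have hs : 0 < Real.sin θ := Real.sin_pos_of_pos_of_lt_pi (by linarith [hθ.1]) (by linarith [hθ.2])
    have key := hB n θ ⟨hθ.1.le, hθ.2⟩
    have e : (Real.sin θ : ℂ) * (Complex.exp (-(Complex.I * t) * Real.cos θ) *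
          (jacobiPhi α β n (Real.cos θ) * g (Real.cos θ))) -
        Complex.exp (-(Complex.I * t) * Real.cos θ) *
          ((Real.cos ((n + γ) * θ - δ) : ℝ) : ℂ) * angularAmplitude g θ =
        Real.sin θ * Complex.exp (Complex.I * (-(t * Real.cos θ) : ℝ)) *
          ((√(jacobiDensity α β (Real.cos θ)) * (jacobiPoly α β n).eval (Real.cos θ) -
            √(2 / Real.pi) * Real.sin θ ^ (-1 / 2 : ℝ) * Real.cos ((n + γ) * θ - δ) : ℝ) : ℂ) *
          g (Real.cos θ) := by
      rw [angularAmplitude, jacobiPhi, ← sin_mul_rpow_neg_half hs,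
        show -(Complex.I * t) * Real.cos θ = Complex.I * (-(t * Real.cos θ) : ℝ) by
          push_cast
          ring]
      simp only [Complex.ofReal_sub, Complex.ofReal_mul _ (Real.cos _), Complex.ofReal_mul √_,
        Complex.ofReal_mul (Real.sin θ)]
      ring
    rw [e, norm_mul, norm_mul, norm_mul, norm_exp_I_mul_ofReal', mul_one, Complex.norm_real,
      Complex.norm_real, Real.norm_eq_abs, Real.norm_eq_abs]
    refine mul_le_mul ?_ (hM _) (norm_nonneg _) (by positivity)
    exact (mul_le_of_le_one_left (abs_nonneg _) (Real.abs_sin_le_one θ)).trans key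
  · rw [abs_of_nonneg (by linarith)]
    have : B / ((n : ℝ) + 1) * M * (Real.pi - η - η) ≤ B / ((n : ℝ) + 1) * M * Real.pi := by
      gcongr
      linarith
    refine this.trans (le_of_eq ?_)
    rw [add_comm]
    ring

theorem exists_jacobiWave_bound {α β : ℝ} (hα : -1 < α) (hβ : -1 < β) {g : ℝ → ℂ}
    (hg : ContDiff ℝ 1 g) (hgc : HasCompactSupport g)
    (hgs : tsupport g ⊆ Ioo (-1 : ℝ) 1 \ {0}) :
    ∃ C : ℝ, 0 ≤ C ∧ ∀ t : ℝ, 1 ≤ t → ∀ n : ℕ,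
      ‖jacobiWave α β g t n - jacobiModelSeq α β g t n‖ ≤ C * (1 + (n : ℝ)) ^ (-3 / 5 : ℝ) := by
  obtain ⟨η, hη, hη4, h0⟩ := exists_angular_gap hgs
  obtain ⟨C₀, hC₀, h⟩ := exists_jacobiWave_halfWave_bound hα hβ hg.continuous hgc hη hη4 h0
  have hg' : ContDiff ℝ 1 fun x => (starRingEnd ℂ) (g (-x)) :=
    Complex.conjCLE.contDiff.comp (hg.comp contDiff_neg)
  obtain ⟨C₁, hC₁, h1⟩ := exists_halfWave_bound hg hη hη4 (fun θ h1 h2 => (h0 θ h1 h2).1)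
    ((α + β + 1) / 2) ((2 * α + 1) * Real.pi / 4)
  obtain ⟨C₂, hC₂, h2⟩ := exists_halfWave_bound hg' hη hη4
    (fun θ h1 h2 => by rw [(h0 θ h1 h2).2, map_zero])
    ((α + β + 1) / 2) ((2 * β + 1) * Real.pi / 4)
  refine ⟨C₀ + C₁ + C₂, by positivity, fun t ht n => ?_⟩
  rw [jacobiModelSeq_of_pos α β g (by linarith) n]
  have i0 := (h t n).trans
    (mul_le_mul_of_nonneg_left (one_div_one_add_le_rpow (Nat.cast_nonneg n)) hC₀)
  have i1 := h1 t ht n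
  have i2 := h2 t ht n
  set P := jacobiWave α β g t n
  set Q₁ := halfWave g ((α + β + 1) / 2) ((2 * α + 1) * Real.pi / 4) t n
  set Q₂ := halfWave (fun x => (starRingEnd ℂ) (g (-x))) ((α + β + 1) / 2)
    ((2 * β + 1) * Real.pi / 4) t n
  set S₁ := stationaryTerm (phasedAmplitude g ((α + β + 1) / 2) ((2 * α + 1) * Real.pi / 4)) t n
  set S₂ := stationaryTerm (phasedAmplitude (fun x => (starRingEnd ℂ) (g (-x)))
    ((α + β + 1) / 2) ((2 * β + 1) * Real.pi / 4)) t n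
  have e : P - (S₁ + (-1) ^ n * (starRingEnd ℂ) S₂) =
      (P - (Q₁ + (-1) ^ n * (starRingEnd ℂ) Q₂)) + (Q₁ - S₁) +
        (-1) ^ n * (starRingEnd ℂ) (Q₂ - S₂) := by
    rw [map_sub]
    ring
  have i3 : ‖(-1 : ℂ) ^ n * (starRingEnd ℂ) (Q₂ - S₂)‖ = ‖Q₂ - S₂‖ := by
    rw [norm_mul, RCLike.norm_conj, norm_pow, norm_neg, norm_one, one_pow, one_mul]
  rw [e]
  refine (norm_add₃_le).trans ?_
  rw [i3]
  linarith

/-! ### Passage to the limit in `ℓ²` -/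

/-- This is the Riemann–Lebesgue lemma. -/
theorem tendsto_jacobiWave (α β : ℝ) (g : ℝ → ℂ) (n : ℕ) :
    Tendsto (fun t : ℝ => jacobiWave α β g t n) atTop (𝓝 0) := by
  have h := Real.tendsto_integral_exp_smul_cocompact
    ((Ioo (-1 : ℝ) 1).indicator fun x => jacobiPhi α β n x * g x)
  have h2 : Tendsto (fun t : ℝ => (2 * Real.pi)⁻¹ * t) atTop (cocompact ℝ) :=
    (tendsto_id.const_mul_atTop (by positivity)).mono_right atTop_le_cocompact
  refine (h.comp h2).congr fun t => ?_
  rw [jacobiWave, ← integral_indicator measurableSet_Ioo]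
  simp only [Function.comp]
  congr 1 with x
  by_cases hx : x ∈ Ioo (-1 : ℝ) 1
  · rw [indicator_of_mem hx, indicator_of_mem hx, Circle.smul_def, Real.fourierChar_apply,
      smul_eq_mul]
    congr 2
    have := Real.pi_pos.ne'
    push_cast
    field_simp
  · rw [indicator_of_notMem hx, indicator_of_notMem hx, smul_zero]

/-- For fixed `n` the ratio `n/|t|` tends to `0`, so the arguments `±√(1 - ξ²)` approach `±1`, where
`g` vanishes; the terms are eventually zero. -/
theorem tendsto_jacobiModelSeq (α β : ℝ) {g : ℝ → ℂ}
    (hgs : tsupport g ⊆ Ioo (-1 : ℝ) 1 \ {0}) (n : ℕ) :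
    Tendsto (fun t : ℝ => jacobiModelSeq α β g t n) atTop (𝓝 0) := by
  have hev : ∀ y : ℝ, y ∉ Ioo (-1 : ℝ) 1 \ {0} → ∀ᶠ x in 𝓝 y, g x = 0 := fun y hy =>
    notMem_tsupport_iff_eventuallyEq.1 fun h => hy (hgs h)
  have h1 : Tendsto (fun t : ℝ => √(1 - ((n : ℝ) / |t|) ^ 2)) atTop (𝓝 1) := by
    have := (((tendsto_const_nhds (x := (n : ℝ))).div_atTop
      tendsto_abs_atTop_atTop).pow 2).const_sub 1
    have := this.sqrt
    simpa using this
  refine tendsto_const_nhds.congr' ?_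
  filter_upwards [h1.eventually (hev 1 (by simp)), h1.neg.eventually (hev (-1) (by simp))]
    with t h2 h3
  simp [jacobiModelSeq, jacobiAmplitude, h2, h3]

/-- Dominated convergence for series: the squared bound `C² (1 + n)^{-6/5}` is summable and
independent of `t ≥ 1`, and every single term tends to zero. -/
theorem tendsto_tsum_jacobiWave {α β : ℝ} (hα : -1 < α) (hβ : -1 < β) {g : ℝ → ℂ}
    (hg : ContDiff ℝ 1 g) (hgc : HasCompactSupport g)
    (hgs : tsupport g ⊆ Ioo (-1 : ℝ) 1 \ {0}) :
    Tendsto (fun t : ℝ => ∑' n, ‖jacobiWave α β g t n - jacobiModelSeq α β g t n‖ ^ 2)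
      atTop (𝓝 0) := by
  obtain ⟨C, hC, h⟩ := exists_jacobiWave_bound hα hβ hg hgc hgs
  have hsum : Summable fun n : ℕ => C ^ 2 * (1 + (n : ℝ)) ^ (-6 / 5 : ℝ) := by
    refine Summable.mul_left _ ?_
    have := (summable_nat_add_iff 1).2
      (Real.summable_nat_rpow.2 (show (-6 / 5 : ℝ) < -1 by norm_num))
    refine this.congr fun n => ?_
    push_cast
    rw [add_comm]
  have := tendsto_tsum_of_dominated_convergence (𝓕 := atTop)
    (f := fun (t : ℝ) n => ‖jacobiWave α β g t n - jacobiModelSeq α β g t n‖ ^ 2) (g := 0) hsum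
    (fun n => by
      have := (((tendsto_jacobiWave α β g n).sub (tendsto_jacobiModelSeq α β hgs n)).norm).pow 2
      simpa using this)
    (by
      filter_upwards [eventually_ge_atTop 1] with t ht n
      rw [Real.norm_of_nonneg (by positivity)]
      have h0 : (0 : ℝ) ≤ 1 + n := by positivity
      calc _ ≤ (C * (1 + (n : ℝ)) ^ (-3 / 5 : ℝ)) ^ 2 := by
            gcongr
            exact h t ht n
        _ = _ := by
            rw [mul_pow, ← Real.rpow_natCast (_ ^ (-3 / 5 : ℝ)), ← Real.rpow_mul h0]
            norm_num)
  simpa using this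

/-- The functions `φ_n` are real, so conjugation reverses time; with `jacobiModelSeq_neg` this
reduces `t → -∞` to `t → +∞` for the conjugate of `g`. -/
theorem jacobiWave_neg (α β : ℝ) (g : ℝ → ℂ) (t : ℝ) (n : ℕ) :
    jacobiWave α β g (-t) n =
      (starRingEnd ℂ) (jacobiWave α β (fun x => (starRingEnd ℂ) (g x)) t n) := by
  rw [jacobiWave, jacobiWave, ← integral_conj]
  congr 1 with x
  simp only [jacobiPhi, map_mul, Complex.conj_conj, Complex.conj_ofReal, ← Complex.exp_conj,
    map_neg, Complex.conj_I]
  push_cast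
  ring_nf

theorem jacobiModelSeq_neg (α β : ℝ) (g : ℝ → ℂ) {t : ℝ} (ht : 0 < t) (n : ℕ) :
    jacobiModelSeq α β g (-t) n =
      (starRingEnd ℂ) (jacobiModelSeq α β (fun x => (starRingEnd ℂ) (g x)) t n) := by
  unfold jacobiModelSeq
  simp only [abs_neg, sign_pos ht, Left.sign_neg]
  split_ifs with h
  · simp only [jacobiAmplitude, map_mul, map_add, Complex.conj_conj, Complex.conj_ofReal,
      ← Complex.exp_conj, map_neg, Complex.conj_I, map_zpow₀]
    have e : (-Complex.I) ^ (-(1 : ℤ) * n) = Complex.I ^ (n : ℤ) := by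
      rw [neg_one_mul, zpow_neg, ← inv_zpow, inv_neg, Complex.inv_I, neg_neg]
    simp only [SignType.coe_one, SignType.coe_neg, e]
    push_cast
    simp only [map_one, map_neg, neg_neg, one_mul, mul_one, neg_mul, mul_neg]
  · simp

theorem theorem6 (α β : ℝ) (hα : -1 < α) (hβ : -1 < β) (f : ℓ²(ℕ, ℂ)) (g : ℝ → ℂ)
    (hg : ContDiff ℝ ∞ g) (hgc : HasCompactSupport g)
    (hgs : tsupport g ⊆ Ioo (-1 : ℝ) 1 \ {0})
    (hfg : jacobiTransform α β f =ᵐ[volume.restrict (Ioo (-1 : ℝ) 1)] g) :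
    Tendsto (fun t : ℝ => ‖jacobiEvolution α β t f - jacobiModel α β g t‖) atTop (𝓝 0) ∧
    Tendsto (fun t : ℝ => ‖jacobiEvolution α β t f - jacobiModel α β g t‖) atBot (𝓝 0) := by
  have hf := apply_eq_integral_of_jacobiTransform hα hβ f hfg
  have hg1 : ContDiff ℝ 1 g := hg.of_le (by exact_mod_cast le_top)
  have hnorm : ∀ t, ‖jacobiEvolution α β t f - jacobiModel α β g t‖ =
      √(∑' n, ‖jacobiWave α β g t n - jacobiModelSeq α β g t n‖ ^ 2) := fun t => by
    rw [← Real.sqrt_sq (norm_nonneg (jacobiEvolution α β t f - jacobiModel α β g t)),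
      norm_sq_eq_tsum]
    congr 2 with n
    rw [← jacobiEvolution_apply hα hβ hg.continuous hgc hf t n]
    rfl
  simp only [hnorm]
  refine ⟨by simpa using (tendsto_tsum_jacobiWave hα hβ hg1 hgc hgs).sqrt, ?_⟩
  -- For negative times the positive-time result is applied to the conjugate of `g`, which has the
  -- same support.
  have hsupp : Function.support (fun x => (starRingEnd ℂ) (g x)) = Function.support g := by
    ext x
    simp
  have hts : tsupport (fun x => (starRingEnd ℂ) (g x)) = tsupport g := by
    rw [tsupport, hsupp, tsupport]
  have h := (tendsto_tsum_jacobiWave hα hβ (Complex.conjCLE.contDiff.comp hg1)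
    (hgc.comp_left (map_zero (starRingEnd ℂ))) (hts.trans_subset hgs)).sqrt
  rw [Real.sqrt_zero] at h
  refine (h.comp tendsto_neg_atBot_atTop).congr' ?_
  filter_upwards [eventually_lt_atBot 0] with t ht
  simp only [Function.comp]
  congr 2 with n
  have e1 := jacobiWave_neg α β g (-t) n
  have e2 := jacobiModelSeq_neg α β g (neg_pos.2 ht) n
  rw [neg_neg] at e1 e2
  rw [e1, e2, ← map_sub, RCLike.norm_conj]
  rfl
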